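/- **Theorem (Generalized Noether formula).** Let $n\ge 1$, $m\ge 0$, let $\Omega\subset\mathbb R^n$ be a bounded open set with Lipschitz boundary and outward unit normal $n$, and let $y:\overline\Omega\to\mathbb R^m$ be Lipschitz. Let $\Sigma\subset\Omega$ be an embedded $C^1$ hypersurface (not necessarily connected), relatively closed in $\Omega$, of finite area, with $\mathcal H^{n-1}(\overline\Sigma\cap\partial\Omega)=0$. Assume that $y$ is piecewise $C^2$ with $\Sigma$ as its only singularity: $y$ is of class $C^2$ on $\Omega\setminus\Sigma$, $\nabla y$ has a limit at every point of $\partial\Omega\setminus\overline\Sigma$, and $\nabla y$ has one-sided limits $F_\pm$ at every point of $\Sigma$ from the two sides of $\Sigma$. Let $W=W(x,y,F)$ be real-valued and of class $C^1$ on an open set containing the closure of $\{(x,y(x),\nabla y(x)):x\in\Omega\setminus\Sigma\}$, and put $$E[y]=\int_\Omega W(x,y(x),\nabla y(x))\,dx,\qquad P=W_F,\qquad P^*=W I_n-F^TP .$$ On $\Sigma$ choose at each point a unit normal $n$, pointing from the $-$ side to the $+$ side, write $[\,\cdot\,]$ for the value on the $+$ side minus the value on the $-$ side, and let $$p^*_\Sigma=[W]-\langle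 P_\pm,[F]\rangle,\qquad \langle A,B\rangle=\operatorname{tr}(A^TB).$$ Assume that $y$ is an extremal, i.e. $W_y-\nabla\cdot P=0$ in $\Omega$ in the sense of distributions. Then: (a) $\langle P_+,[F]\rangle=\langle P_-,[F]\rangle$ on $\Sigma$, so that $p^*_\Sigma$ is well defined. (b) Let $\Phi_\epsilon(x,y)=(X(x,y,\epsilon),Y(x,y,\epsilon))$, $|\epsilon|<\epsilon_0$, be a $C^1$ family of transformations of $\mathbb R^n\times\mathbb R^m$ with $\Phi_0=\mathrm{id}$. That is, each $\Phi_\epsilon$ is Lipschitz on every ball, $\epsilon\mapsto\Phi_\epsilon(p)$ is $C^1$ for each point $p$, each $\partial_\epsilon\Phi_\epsilon$ is Lipschitz on every ball, and $\epsilon\mapsto\partial_\epsilon\Phi_\epsilon$ is continuous in the Lipschitz seminorm on every ball. Let $\delta x(x)=\partial_\epsilon X(x,y(x),0)$ and $\delta y(x)=\partial_\epsilon Y(x,y(x),0)$. Then for all sufficiently small $|\epsilon|$ the image under $\Phi_\epsilon$ of the graph of $y$ is the graph of a Lipschitz function $y_\epsilon$ on an open set $\Omega_\epsilon$, and $W(\tilde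 x,y_\epsilon,\nabla y_\epsilon)$ is integrable over $\Omega_\epsilon$. The function $\epsilon\mapsto\int_{\Omega_\epsilon}W(\tilde x,y_\epsilon(\tilde x),\nabla y_\epsilon(\tilde x))\,d\tilde x$ is differentiable at $\epsilon=0$, and its derivative $\delta E$ is $$\delta E=\int_{\partial\Omega}\{Pn\cdot\delta y+P^*n\cdot\delta x\}\,dS-\int_\Sigma p^*_\Sigma\,n\cdot\delta x\,dS,$$ where both surface integrals converge absolutely, and $P$, $P^*$ on $\partial\Omega$ are evaluated at the limit of $\nabla y$ from inside. (c) If $y$ is stationary, i.e. in addition $W_x-\nabla\cdot P^*=0$ in $\Omega$ in the sense of distributions, then $p^*_\Sigma=0$ at every point of $\Sigma$. -/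

import Mathlib

open MeasureTheory Set Filter Topology
open scoped NNReal RealInnerProductSpace Matrix ContDiff

noncomputable section

namespace GenNoether

/-- The Euclidean space `ℝᵏ`. -/
abbrev Eu (k : ℕ) : Type := EuclideanSpace ℝ (Fin k)

/-- Gradients: `m × n` tensors, as linear maps `ℝⁿ → ℝᵐ`. -/
abbrev Grad (n m : ℕ) : Type := Eu n →L[ℝ] Eu m

/-- The space of triples `(x, y, F)` on which an energy density `W` is a function. -/
abbrev Jet (n m : ℕ) : Type := Eu n × Eu m × Grad n m

/-! ### Domains and surfaces -/

/-- Near each boundary point, in suitable Cartesian coordinates with vertical unit vector `e`,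
the set is the part of space strictly below the graph of a Lipschitz function `φ` of the
horizontal component `z - ⟪e, z⟫ e`. -/
def HasLipschitzBoundary {n : ℕ} (Ω : Set (Eu n)) : Prop :=
  ∀ p ∈ frontier Ω, ∃ (e : Eu n) (K : ℝ≥0) (φ : Eu n → ℝ), ‖e‖ = 1 ∧ LipschitzWith K φ ∧
    ∀ᶠ z in 𝓝 p, (z ∈ Ω ↔ ⟪e, z⟫ < φ (z - ⟪e, z⟫ • e))

/-- `v` is the outward unit normal to `Ω` at `x`: to first order at `x`, the set `Ω` is the
half-space of all `z` with `⟪v, z - x⟫ < 0`. There is at most one such `v`. -/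
def IsOuterUnitNormal {n : ℕ} (Ω : Set (Eu n)) (x v : Eu n) : Prop :=
  ‖v‖ = 1 ∧ ∀ c : ℝ, 0 < c → ∀ᶠ z in 𝓝 x,
    (⟪v, z - x⟫ < -(c * ‖z - x‖) → z ∈ Ω) ∧ (c * ‖z - x‖ < ⟪v, z - x⟫ → z ∉ Ω)

open Classical in
/-- The outward unit normal to `Ω` at `x`. On the boundary of a Lipschitz domain it exists at
almost every point; the value is `0` where it does not exist. -/
def outerNormal {n : ℕ} (Ω : Set (Eu n)) (x : Eu n) : Eu n :=
  if h : ∃ v, IsOuterUnitNormal Ω x v then h.choose else 0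

/-- In the open set `V`, the set `S` is the zero set of the `C¹` function `g`, whose gradient does
not vanish there. The two sides of `S` in `V` are `{g > 0}` and `{g < 0}`. -/
structure IsLocalDefiningFunction {n : ℕ} (S V : Set (Eu n)) (g : Eu n → ℝ) : Prop where
  isOpen : IsOpen V
  contDiffOn : ContDiffOn ℝ 1 g V
  fderiv_ne_zero : ∀ z ∈ V, fderiv ℝ g z ≠ 0
  mem_iff : ∀ z ∈ V, (z ∈ S ↔ g z = 0)

/-- An embedded `C¹` hypersurface without boundary points of its own inside `Ω` (not necessarily
connected, orientable, or compact), closed relative to `Ω`, of finite area, which may reach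
`∂Ω` only in a set of zero area. -/
structure IsSurfaceIn {n : ℕ} (Ω S : Set (Eu n)) : Prop where
  subset : S ⊆ Ω
  relClosed : closure S ∩ Ω ⊆ S
  hypersurface : ∀ x ∈ S, ∃ (V : Set (Eu n)) (g : Eu n → ℝ), x ∈ V ∧ IsLocalDefiningFunction S V g
  finite_area : μHE[n - 1] S < ⊤
  boundary_null : μHE[n - 1] (closure S ∩ frontier Ω) = 0

/-- `v` is one of the two unit normals to the surface `S` at `x`. -/
def IsUnitNormal {n : ℕ} (S : Set (Eu n)) (x v : Eu n) : Prop :=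
  ‖v‖ = 1 ∧ (fun z => ⟪v, z - x⟫) =o[𝓝[S] x] (fun z => z - x)

/-! ### Configurations -/

/-- `(x, y(x), ∇y(x))`. -/
def jet {n m : ℕ} (y : Eu n → Eu m) (x : Eu n) : Jet n m := (x, y x, fderiv ℝ y x)

/-- `y` is of class `C²` away from `S`, and `∇y` has limits at the points of `∂Ω` away from `S`,
and one-sided limits at the points of `S` from each of the two sides of `S`. -/
structure IsPiecewiseC2 {n m : ℕ} (Ω S : Set (Eu n)) (y : Eu n → Eu m) : Prop where
  contDiffOn : ContDiffOn ℝ 2 y (Ω \ S)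
  boundary_limit : ∀ x ∈ frontier Ω \ closure S,
    ∃ F : Grad n m, Tendsto (fderiv ℝ y) (𝓝[Ω \ S] x) (𝓝 F)
  side_limits : ∀ (V : Set (Eu n)) (g : Eu n → ℝ), V ⊆ Ω → IsLocalDefiningFunction S V g →
    ∀ x ∈ S ∩ V,
      (∃ F : Grad n m, Tendsto (fderiv ℝ y) (𝓝[{z | z ∈ V ∧ 0 < g z}] x) (𝓝 F)) ∧
      (∃ F : Grad n m, Tendsto (fderiv ℝ y) (𝓝[{z | z ∈ V ∧ g z < 0}] x) (𝓝 F))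

/-- The boundary value `(x, y(x), ∇y(x))` at `x ∈ ∂Ω`, with `∇y(x)` the limit from inside. -/
def boundaryJet {n m : ℕ} (Ω S : Set (Eu n)) (y : Eu n → Eu m) (x : Eu n) : Jet n m :=
  (x, y x, limUnder (𝓝[Ω \ S] x) (fderiv ℝ y))

/-- The one-sided value `∇y` at `x`, from the side to which `v` points:
`lim ∇y(x + t v)` as `t ↓ 0`. -/
def sideGrad {n m : ℕ} (y : Eu n → Eu m) (x v : Eu n) : Grad n m :=
  limUnder (𝓝[>] (0 : ℝ)) (fun t => fderiv ℝ y (x + t • v))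

/-- The one-sided value of `(x, y(x), ∇y(x))` at `x`, from the side to which `v` points. -/
def sideJet {n m : ℕ} (y : Eu n → Eu m) (x v : Eu n) : Jet n m := (x, y x, sideGrad y x v)

/-! ### Piola and Eshelby tensors -/

/-- The matrix of a gradient: entry `(i, α)` is `∂yⁱ/∂x^α`. -/
def gradMatrix {n m : ℕ} (F : Grad n m) : Matrix (Fin m) (Fin n) ℝ :=
  Matrix.of fun i α => F (EuclideanSpace.single α 1) i

/-- The gradient `e_i ⊗ e_α`. -/
def unitGrad {n m : ℕ} (i : Fin m) (α : Fin n) : Grad n m :=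
  (EuclideanSpace.proj α : Eu n →L[ℝ] ℝ).smulRight (EuclideanSpace.single i (1 : ℝ) : Eu m)

/-- The Piola tensor `P = W_F`: entry `(i, α)` is `∂W/∂F_{iα}`. -/
def piola {n m : ℕ} (W : Jet n m → ℝ) (j : Jet n m) : Matrix (Fin m) (Fin n) ℝ :=
  Matrix.of fun i α => fderiv ℝ W j (0, 0, unitGrad i α)

/-- The Eshelby tensor `P* = W I - Fᵀ P`. -/
def eshelby {n m : ℕ} (W : Jet n m → ℝ) (j : Jet n m) : Matrix (Fin n) (Fin n) ℝ :=
  W j • (1 : Matrix (Fin n) (Fin n) ℝ) - (gradMatrix j.2.2)ᵀ * piola W j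

/-- The inner product `⟨A, B⟩ = ∑ A_{iα} B_{iα}` of matrices. -/
def frob {k l : ℕ} (A B : Matrix (Fin k) (Fin l) ℝ) : ℝ := (Aᵀ * B).trace

/-- The Euler–Lagrange equation `W_y - ∇·P = 0` in `Ω` in the sense of distributions. -/
def IsExtremal {n m : ℕ} (W : Jet n m → ℝ) (Ω : Set (Eu n)) (y : Eu n → Eu m) : Prop :=
  ∀ ψ : Eu n → Eu m, ContDiff ℝ ∞ ψ → HasCompactSupport ψ → tsupport ψ ⊆ Ω →
    ∫ x in Ω, (fderiv ℝ W (jet y x) (0, ψ x, 0)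
      + frob (piola W (jet y x)) (gradMatrix (fderiv ℝ ψ x))) = 0

/-- `y` is an extremal and, in addition, `W_x - ∇·P* = 0` in `Ω` in the sense of distributions. -/
def IsStationary {n m : ℕ} (W : Jet n m → ℝ) (Ω : Set (Eu n)) (y : Eu n → Eu m) : Prop :=
  IsExtremal W Ω y ∧
  ∀ φ : Eu n → Eu n, ContDiff ℝ ∞ φ → HasCompactSupport φ → tsupport φ ⊆ Ω →
    ∫ x in Ω, (fderiv ℝ W (jet y x) (φ x, 0, 0)
      + frob (eshelby W (jet y x)) (gradMatrix (fderiv ℝ φ x))) = 0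

/-- The jump `[F] = F₊ - F₋` of `F = ∇y` at `x`; the unit normal `v` points from `-` to `+`. -/
def jumpGrad {n m : ℕ} (y : Eu n → Eu m) (x v : Eu n) : Matrix (Fin m) (Fin n) ℝ :=
  gradMatrix (sideGrad y x v - sideGrad y x (-v))

/-- `p*_Σ = [W] - ⟨P₊, [F]⟩` at `x`; the unit normal `v` points from `-` to `+`. -/
def pStar {n m : ℕ} (W : Jet n m → ℝ) (y : Eu n → Eu m) (x v : Eu n) : ℝ :=
  W (sideJet y x v) - W (sideJet y x (-v)) - frob (piola W (sideJet y x v)) (jumpGrad y x v)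

/-! ### Transformations of graphs and the energy -/

/-- `∂Φ_ε(p)/∂ε`. -/
def velocity {n m : ℕ} (Φ : ℝ → Eu n × Eu m → Eu n × Eu m) (ε : ℝ) (p : Eu n × Eu m) :
    Eu n × Eu m :=
  deriv (fun s => Φ s p) ε

/-- A `C¹` family `Φ_ε`, `|ε| < ε₀`, of (locally) Lipschitz maps of `ℝⁿ × ℝᵐ` with `Φ_0 = id`:
`ε ↦ Φ_ε` is continuously differentiable pointwise and in the Lipschitz seminorm on every ball. -/
structure IsC1Family {n m : ℕ} (Φ : ℝ → Eu n × Eu m → Eu n × Eu m) (ε₀ : ℝ) : Prop where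
  pos : 0 < ε₀
  zero : ∀ p, Φ 0 p = p
  lipschitz : ∀ R : ℝ, ∀ ε ∈ Ioo (-ε₀) ε₀, ∃ K : ℝ≥0, LipschitzOnWith K (Φ ε) (Metric.ball 0 R)
  contDiffOn : ∀ p, ContDiffOn ℝ 1 (fun ε => Φ ε p) (Ioo (-ε₀) ε₀)
  velocity_lipschitz : ∀ R : ℝ, ∀ ε ∈ Ioo (-ε₀) ε₀, ∃ K : ℝ≥0,
    LipschitzOnWith K (velocity Φ ε) (Metric.ball 0 R)
  velocity_continuous : ∀ R : ℝ, ∀ ε ∈ Ioo (-ε₀) ε₀, ∀ η : ℝ≥0, 0 < η → ∀ᶠ ε' in 𝓝 ε,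
    LipschitzOnWith η (fun p => velocity Φ ε' p - velocity Φ ε p) (Metric.ball 0 R)

/-- `δx(x) = ∂X(x, y(x), ε)/∂ε` at `ε = 0`. -/
def deltaX {n m : ℕ} (Φ : ℝ → Eu n × Eu m → Eu n × Eu m) (y : Eu n → Eu m) (x : Eu n) : Eu n :=
  (velocity Φ 0 (x, y x)).1

/-- `δy(x) = ∂Y(x, y(x), ε)/∂ε` at `ε = 0`. -/
def deltaY {n m : ℕ} (Φ : ℝ → Eu n × Eu m → Eu n × Eu m) (y : Eu n → Eu m) (x : Eu n) : Eu m :=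
  (velocity Φ 0 (x, y x)).2

/-- `Γ` is the graph of a Lipschitz function on an open set. -/
def IsLipschitzGraph {n m : ℕ} (Γ : Set (Eu n × Eu m)) : Prop :=
  ∃ (O : Set (Eu n)) (z : Eu n → Eu m) (K : ℝ≥0),
    IsOpen O ∧ LipschitzOnWith K z O ∧ Γ = O.graphOn z

/-- The domain `Ω_Γ` of the function whose graph is `Γ`. -/
def graphDomain {n m : ℕ} (Γ : Set (Eu n × Eu m)) : Set (Eu n) := Prod.fst '' Γ

open Classical in
/-- The function `y_Γ` whose graph is `Γ` (`0` outside its domain). -/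
def graphFun {n m : ℕ} (Γ : Set (Eu n × Eu m)) (x : Eu n) : Eu m :=
  if h : ∃ v, (x, v) ∈ Γ then h.choose else 0

/-- The energy of a graph, the integral over `Ω_Γ` of `W(x, y_Γ(x), ∇y_Γ(x))`. -/
def graphEnergy {n m : ℕ} (W : Jet n m → ℝ) (Γ : Set (Eu n × Eu m)) : ℝ :=
  ∫ x in graphDomain Γ, W (jet (graphFun Γ) x)

/-- `P n · δy + P* n · δx` at `x ∈ ∂Ω`, with `n` the outward unit normal. -/
def boundaryWork {n m : ℕ} (W : Jet n m → ℝ) (Ω S : Set (Eu n)) (y : Eu n → Eu m)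
    (Φ : ℝ → Eu n × Eu m → Eu n × Eu m) (x : Eu n) : ℝ :=
  ⟪Matrix.toEuclideanLin (piola W (boundaryJet Ω S y x)) (outerNormal Ω x), deltaY Φ y x⟫
    + ⟪Matrix.toEuclideanLin (eshelby W (boundaryJet Ω S y x)) (outerNormal Ω x), deltaX Φ y x⟫

/-- `p*_Σ n · δx` at `x ∈ S`, with the unit normal `n = ν x`. -/
def surfaceWork {n m : ℕ} (W : Jet n m → ℝ) (y : Eu n → Eu m) (ν : Eu n → Eu n)
    (Φ : ℝ → Eu n × Eu m → Eu n × Eu m) (x : Eu n) : ℝ :=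
  pStar W y x (ν x) * ⟪ν x, deltaX Φ y x⟫

end GenNoether

end

open scoped ENNReal

noncomputable section

set_option linter.unusedSectionVars false

/-! Pulling the integral over Ω_ε back to Ω by x ↦ X(x, y(x), ε) fixes the domain of integration.
The derivative at ε = 0 is then the integral over Ω of W_x·δx + W_y·δy + ⟨P, ∇δy - F∇δx⟩ + W tr ∇δx.
Since P* = W I - FᵀP, this equals (W_y·δy + ⟨P, ∇δy⟩) + (W_x·δx + ⟨P*, ∇δx⟩)
(`variationDensity_eq`). Componentwise it is a sum of pairings f δ + ∇δ·q, where q is a row of P or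
of P* and f is its distributional divergence. Gauss's theorem (`FluxData.gauss`) turns such a
pairing into the flux of q through ∂Ω minus the flux of the jump of q through Σ.

For the rows of P the divergence equation holds across Σ, because y is an extremal. Gauss's theorem
with tests supported in Ω and the fundamental lemma then force [P]n = 0 on Σ (`jump_piola`). For P*
the equation holds in general only off Σ: there y is C², so ∇y v may be used as a variation, and
this gives Noether's identity W_x = ∇·P* (`noether_weak`). The behaviour of P* at Σ is algebra.
Since y is Lipschitz, its tangential derivatives from the two sides agree, so [F] = a ⊗ n
(`sideGrad_sub`). Together with [P]n = 0 this gives ⟨P±, [F]⟩ = P±n·a, hence (a), and ⟨[P*]n, v⟩ =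
p*⟨n, v⟩ (`jump_eshelby`), the surface term of (b). If y is stationary, the equation for P* also
holds across Σ, so its jump vanishes, which is (c).

Two matters of regularity take most of the work. The first is Gauss's theorem on Lipschitz domains
for bounded fields with only a weak divergence. Below a Lipschitz graph one tests with a cutoff that
rises from 0 to 1 in a layer of thickness 1/k, whose gradient concentrates on the graph
(`gauss_subgraph`); the area formula identifies the limit as a Hausdorff integral. A C¹ hypersurface
is locally such a graph seen from both sides (`exists_graph_chart`). The set closure Σ ∩ ∂Ω, where
neither kind of chart is available, has zero area and is removed by cutoffs whose gradients tend to
0 in L¹ (`exists_cutoff`).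

The second is differentiability in ε. The family Φ_ε expands to first order in the Lipschitz
seminorm (`IsC1Family.expansion`). Hence for small ε the map x ↦ X is a perturbation of the identity
with Lipschitz constant 1/2, so it is invertible, and the pulled-back integrand expands uniformly at
almost all points (`FirstOrder.density`, `hasDerivAt_graphEnergy`). -/

namespace GenNoether

/-! ### The area formula for expanding maps -/

section AreaFormula

variable {X Y Z : Type*} [MetricSpace X] [MetricSpace Y] [MetricSpace Z]
  [MeasurableSpace Y] [BorelSpace Y] [MeasurableSpace Z] [BorelSpace Z]

theorem euclideanHausdorffMeasure_image_le_of_lipschitzOnWith {f : Y → Z} {s : Set Y} {K : ℝ≥0}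
    (h : LipschitzOnWith K f s) (d : ℕ) : μHE[d] (f '' s) ≤ (K : ℝ≥0∞) ^ d * μHE[d] s := by
  simp_rw [Measure.euclideanHausdorffMeasure_def, Measure.smul_apply, ENNReal.smul_def, smul_eq_mul]
  rw [mul_left_comm]
  gcongr
  simpa using h.hausdorffMeasure_image_le (d := d) (by positivity)

/-- The distance bound makes g constant on the fibres of f, so on s the map g factors through f by a
K-Lipschitz map. No injectivity of f is needed. -/
theorem euclideanHausdorffMeasure_image_le_of_dist_le {f : X → Y} {g : X → Z} {s : Set X} {K : ℝ≥0}
    (h : ∀ x ∈ s, ∀ y ∈ s, dist (g x) (g y) ≤ K * dist (f x) (f y)) (d : ℕ) :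
    μHE[d] (g '' s) ≤ (K : ℝ≥0∞) ^ d * μHE[d] (f '' s) := by
  rcases s.eq_empty_or_nonempty with rfl | ⟨x₀, hx₀⟩
  · simp
  have : Nonempty X := ⟨x₀⟩
  set i : Y → X := Function.invFunOn f s
  have hi : ∀ x ∈ s, i (f x) ∈ s ∧ f (i (f x)) = f x := fun x hx =>
    ⟨Function.invFunOn_mem ⟨x, hx, rfl⟩, Function.invFunOn_eq ⟨x, hx, rfl⟩⟩
  have hgi : ∀ x ∈ s, g (i (f x)) = g x := fun x hx => by
    rw [← dist_le_zero]
    simpa [(hi x hx).2] using h _ (hi x hx).1 x hx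
  have hL : LipschitzOnWith K (g ∘ i) (f '' s) := by
    apply LipschitzOnWith.of_dist_le_mul
    rintro _ ⟨x, hx, rfl⟩ _ ⟨y, hy, rfl⟩
    simpa [hgi x hx, hgi y hy] using h x hx y hy
  have : (g ∘ i) '' (f '' s) = g '' s := by
    rw [image_image]
    exact image_congr fun x hx => hgi x hx
  rw [← this]
  exact euclideanHausdorffMeasure_image_le_of_lipschitzOnWith hL d

variable {F V : Type*} [NormedAddCommGroup F] [InnerProductSpace ℝ F] [FiniteDimensional ℝ F]
  [MeasurableSpace F] [BorelSpace F]
  [NormedAddCommGroup V] [InnerProductSpace ℝ V] [FiniteDimensional ℝ V]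
  [MeasurableSpace V] [BorelSpace V]

/-- `normDet` is the factor by which a linear map scales top-dimensional Hausdorff measure, so it
suffices to compare the two images of the unit ball. -/
theorem ofReal_normDet_le_of_norm_le {A B : F →L[ℝ] V} {K : ℝ≥0}
    (h : ∀ v, ‖B v‖ ≤ K * ‖A v‖) :
    ENNReal.ofReal (LinearMap.normDet B.toLinearMap)
      ≤ (K : ℝ≥0∞) ^ Module.finrank ℝ F * ENNReal.ofReal (LinearMap.normDet A.toLinearMap) := by
  have key := euclideanHausdorffMeasure_image_le_of_dist_le (f := A) (g := B)
    (s := Metric.ball (0 : F) 1) (K := K) (fun x _ y _ => by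
      simpa [dist_eq_norm, ← map_sub] using h (x - y)) (Module.finrank ℝ F)
  have hA := LinearMap.euclideanHausdorffMeasure_image_eq_normDet_mul_volume A.toLinearMap
    (Metric.ball (0 : F) 1)
  have hB := LinearMap.euclideanHausdorffMeasure_image_eq_normDet_mul_volume B.toLinearMap
    (Metric.ball (0 : F) 1)
  simp only [ContinuousLinearMap.coe_coe] at hA hB
  rw [hA, hB, ← mul_assoc] at key
  exact (ENNReal.mul_le_mul_iff_left (Metric.measure_ball_pos volume _ one_pos).ne'
    measure_ball_lt_top.ne).1 key

/-- A map which is expanding and well approximated by linear maps. -/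
theorem area_formula_aux {g : F → V} {g' : F → F →L[ℝ] V} {s : Set F} (hs : MeasurableSet s)
    (hg : ∀ w ∈ s, HasFDerivWithinAt g (g' w) s w) (hlin : ∀ w ∈ s, ∀ v, ‖v‖ ≤ ‖g' w v‖)
    (hexp : ∀ w ∈ s, ∀ w' ∈ s, ‖w - w'‖ ≤ ‖g w - g w'‖) {ε : ℝ≥0} (hε : 0 < ε)
    (hclose : ∀ w ∈ s, ∀ w' ∈ s, ‖g' w - g' w'‖ ≤ ε) :
    μHE[Module.finrank ℝ F] (g '' s) ≤ ((1 + ε : ℝ≥0) : ℝ≥0∞) ^ (2 * Module.finrank ℝ F) *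
      ∫⁻ w in s, ENNReal.ofReal (LinearMap.normDet (g' w).toLinearMap) ∧
    ∫⁻ w in s, ENNReal.ofReal (LinearMap.normDet (g' w).toLinearMap) ≤
      ((1 + ε : ℝ≥0) : ℝ≥0∞) ^ (2 * Module.finrank ℝ F) * μHE[Module.finrank ℝ F] (g '' s) := by
  rcases s.eq_empty_or_nonempty with rfl | hne
  · simp
  -- On the n-th piece g is within ε of A n, and A n is one of the derivatives g' y with y in s, so
  -- it inherits the lower bound `hlin` and the closeness `hclose`.
  obtain ⟨t, A, t_disj, t_meas, t_cover, ht, hA⟩ :=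
    exists_partition_approximatesLinearOn_of_hasFDerivWithinAt g s g' hg (fun _ => ε)
      (fun _ => hε.ne')
  replace hA := hA hne
  have hinj : InjOn g s := fun w hw w' hw' h => by
    have := hexp w hw w' hw'
    rw [h, sub_self, norm_zero] at this
    exact sub_eq_zero.1 (norm_le_zero_iff.1 this)
  have hcont : ContinuousOn g s := fun w hw => (hg w hw).continuousWithinAt
  set p : ℕ → Set F := fun n => s ∩ t n
  have p_meas : ∀ n, MeasurableSet (p n) := fun n => hs.inter (t_meas n)
  have p_disj : Pairwise (Function.onFun Disjoint p) := fun i j hij =>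
    (t_disj hij).mono inter_subset_right inter_subset_right
  have p_union : s = ⋃ n, p n := by
    rw [← inter_iUnion, inter_eq_left.2 t_cover]
  have hp : ∀ n, p n ⊆ s := fun n => inter_subset_left
  set d := Module.finrank ℝ F
  -- Both g and the linear maps are expanding, so an additive error ε‖x - y‖ becomes a factor 1 + ε.
  -- Comparing g with A n costs one factor c, comparing A n with g' another, whence the exponent 2d.
  set c : ℝ≥0∞ := ((1 + ε : ℝ≥0) : ℝ≥0∞) ^ d
  have hAv : ∀ n v, ‖v‖ ≤ ‖A n v‖ := fun n v => by
    obtain ⟨y, hy, h⟩ := hA n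
    rw [h]; exact hlin y hy v
  have hnear : ∀ n, ∀ w ∈ s, ∀ v, ‖A n v - g' w v‖ ≤ ε * ‖v‖ := fun n w hw v => by
    obtain ⟨y, hy, h⟩ := hA n
    rw [h, ← sub_apply]
    exact (ContinuousLinearMap.le_opNorm _ _).trans
      (mul_le_mul_of_nonneg_right (hclose y hy w hw) (norm_nonneg _))
  have e1 : ∀ n, μHE[d] (g '' p n) ≤ c * μHE[d] (A n '' p n) := fun n => by
    refine euclideanHausdorffMeasure_image_le_of_dist_le (fun x hx y hy => ?_) d
    have h1 := ht n x hx y hy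
    have h2 := hAv n (x - y)
    rw [dist_eq_norm, dist_eq_norm, ← map_sub]
    have : g x - g y = (g x - g y - A n (x - y)) + A n (x - y) := by abel
    rw [this]
    refine (norm_add_le _ _).trans ?_
    push_cast
    have : (ε : ℝ) * ‖x - y‖ ≤ ε * ‖A n (x - y)‖ := by gcongr
    linarith
  have e2 : ∀ n, μHE[d] (A n '' p n) ≤ c * μHE[d] (g '' p n) := fun n => by
    refine euclideanHausdorffMeasure_image_le_of_dist_le (fun x hx y hy => ?_) d
    have h1 := ht n x hx y hy
    have h2 := hexp x (hp n hx) y (hp n hy)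
    rw [dist_eq_norm, dist_eq_norm, ← map_sub]
    have : A n (x - y) = (g x - g y) - (g x - g y - A n (x - y)) := by abel
    rw [this]
    refine (norm_sub_le _ _).trans ?_
    push_cast
    have : (ε : ℝ) * ‖x - y‖ ≤ ε * ‖g x - g y‖ := by gcongr
    linarith
  have e3 : ∀ n, μHE[d] (A n '' p n)
      = ENNReal.ofReal (LinearMap.normDet (A n).toLinearMap) * volume (p n) := fun n =>
    LinearMap.euclideanHausdorffMeasure_image_eq_normDet_mul_volume (A n).toLinearMap (p n)
  have e4 : ∀ n, ENNReal.ofReal (LinearMap.normDet (A n).toLinearMap) * volume (p n)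
      ≤ c * ∫⁻ w in p n, ENNReal.ofReal (LinearMap.normDet (g' w).toLinearMap) := fun n => by
    rw [← setLIntegral_const, ← lintegral_const_mul' _ _ (by simp [c])]
    refine setLIntegral_mono' (p_meas n) fun w hw => ofReal_normDet_le_of_norm_le fun v => ?_
    have h1 := hnear n w (hp n hw) v
    have h2 := hlin w (hp n hw) v
    have : A n v = (A n v - g' w v) + g' w v := by abel
    rw [this]
    refine (norm_add_le _ _).trans ?_
    push_cast
    have : (ε : ℝ) * ‖v‖ ≤ ε * ‖g' w v‖ := by gcongr
    linarith
  have e5 : ∀ n, ∫⁻ w in p n, ENNReal.ofReal (LinearMap.normDet (g' w).toLinearMap)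
      ≤ c * (ENNReal.ofReal (LinearMap.normDet (A n).toLinearMap) * volume (p n)) := fun n => by
    rw [← mul_assoc, ← setLIntegral_const]
    refine setLIntegral_mono' (p_meas n) fun w hw => ofReal_normDet_le_of_norm_le fun v => ?_
    have h1 := hnear n w (hp n hw) v
    have h2 := hAv n v
    have : g' w v = A n v - (A n v - g' w v) := by abel
    rw [this]
    refine (norm_sub_le _ _).trans ?_
    push_cast
    have : (ε : ℝ) * ‖v‖ ≤ ε * ‖A n v‖ := by gcongr
    linarith
  have i1 : μHE[d] (g '' s) = ∑' n, μHE[d] (g '' p n) := by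
    conv_lhs => rw [p_union, image_iUnion]
    refine measure_iUnion (fun i j hij => ?_) fun n => ?_
    · exact (p_disj hij).image hinj (hp i) (hp j)
    · exact (p_meas n).image_of_continuousOn_injOn (hcont.mono (hp n)) (hinj.mono (hp n))
  have i2 : ∫⁻ w in s, ENNReal.ofReal (LinearMap.normDet (g' w).toLinearMap)
      = ∑' n, ∫⁻ w in p n, ENNReal.ofReal (LinearMap.normDet (g' w).toLinearMap) := by
    conv_lhs => rw [p_union]
    exact lintegral_iUnion p_meas p_disj _
  have hc : ((1 + ε : ℝ≥0) : ℝ≥0∞) ^ (2 * d) = c * c := by rw [two_mul, pow_add]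
  rw [i1, i2, hc, ← ENNReal.tsum_mul_left, ← ENNReal.tsum_mul_left]
  constructor
  · refine ENNReal.tsum_le_tsum fun n => (e1 n).trans ?_
    rw [mul_assoc]
    exact mul_le_mul_right ((e3 n).trans_le (e4 n)) c
  · refine ENNReal.tsum_le_tsum fun n => (e5 n).trans ?_
    rw [mul_assoc]
    exact mul_le_mul_right ((e3 n).symm.trans_le (e2 n)) c

/-- The area formula for expanding maps. -/
theorem area_formula {g : F → V} {g' : F → F →L[ℝ] V} {s : Set F} (hs : MeasurableSet s)
    (hm : Measurable g')
    (hg : ∀ w ∈ s, HasFDerivWithinAt g (g' w) s w) (hlin : ∀ w ∈ s, ∀ v, ‖v‖ ≤ ‖g' w v‖)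
    (hexp : ∀ w ∈ s, ∀ w' ∈ s, ‖w - w'‖ ≤ ‖g w - g w'‖) :
    μHE[Module.finrank ℝ F] (g '' s)
      = ∫⁻ w in s, ENNReal.ofReal (LinearMap.normDet (g' w).toLinearMap) := by
  set d := Module.finrank ℝ F
  have hinj : InjOn g s := fun w hw w' hw' h => by
    have := hexp w hw w' hw'
    rw [h, sub_self, norm_zero] at this
    exact sub_eq_zero.1 (norm_le_zero_iff.1 this)
  have hcont : ContinuousOn g s := fun w hw => (hg w hw).continuousWithinAt
  have key : ∀ ε : ℝ≥0, 0 < ε →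
      μHE[d] (g '' s) ≤ ((1 + ε : ℝ≥0) : ℝ≥0∞) ^ (2 * d) *
        ∫⁻ w in s, ENNReal.ofReal (LinearMap.normDet (g' w).toLinearMap) ∧
      ∫⁻ w in s, ENNReal.ofReal (LinearMap.normDet (g' w).toLinearMap) ≤
        ((1 + ε : ℝ≥0) : ℝ≥0∞) ^ (2 * d) * μHE[d] (g '' s) := by
    intro ε hε
    set b : ℕ → F →L[ℝ] V := TopologicalSpace.denseSeq (F →L[ℝ] V)
    -- Preimages of balls of radius ε/2 about a dense sequence of linear maps: on each of them g'
    -- oscillates by less than ε.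
    set q : ℕ → Set F := disjointed fun n => g' ⁻¹' (Metric.ball (b n) (ε / 2))
    have q_meas : ∀ n, MeasurableSet (q n) := fun n =>
      MeasurableSet.disjointed (fun n => hm Metric.isOpen_ball.measurableSet) n
    have q_cover : ⋃ n, q n = univ := by
      rw [iUnion_disjointed]
      refine eq_univ_of_forall fun w => mem_iUnion.2 ?_
      obtain ⟨n, hn⟩ := (TopologicalSpace.denseRange_denseSeq (F →L[ℝ] V)).exists_dist_lt (g' w)
        (show (0 : ℝ) < ε / 2 by positivity)
      exact ⟨n, hn⟩
    set p : ℕ → Set F := fun n => s ∩ q n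
    have hp : ∀ n, p n ⊆ s := fun n => inter_subset_left
    have p_meas : ∀ n, MeasurableSet (p n) := fun n => hs.inter (q_meas n)
    have p_disj : Pairwise (Function.onFun Disjoint p) := fun i j hij =>
      (disjoint_disjointed _ hij).mono inter_subset_right inter_subset_right
    have p_union : s = ⋃ n, p n := by
      rw [← inter_iUnion, q_cover, inter_univ]
    have i1 : μHE[d] (g '' s) = ∑' n, μHE[d] (g '' p n) := by
      conv_lhs => rw [p_union, image_iUnion]
      refine measure_iUnion (fun i j hij => ?_) fun n => ?_
      · exact (p_disj hij).image hinj (hp i) (hp j)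
      · exact (p_meas n).image_of_continuousOn_injOn (hcont.mono (hp n)) (hinj.mono (hp n))
    have i2 : ∫⁻ w in s, ENNReal.ofReal (LinearMap.normDet (g' w).toLinearMap)
        = ∑' n, ∫⁻ w in p n, ENNReal.ofReal (LinearMap.normDet (g' w).toLinearMap) := by
      conv_lhs => rw [p_union]
      exact lintegral_iUnion p_meas p_disj _
    have main := fun n => area_formula_aux (p_meas n)
      (fun w hw => (hg w (hp n hw)).mono (hp n)) (fun w hw => hlin w (hp n hw))
      (fun w hw w' hw' => hexp w (hp n hw) w' (hp n hw')) hε (fun w hw w' hw' => by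
        have h1 := disjointed_subset _ _ hw.2
        have h2 := disjointed_subset _ _ hw'.2
        rw [mem_preimage, Metric.mem_ball] at h1 h2
        rw [← dist_eq_norm]
        linarith [dist_triangle_right (g' w) (g' w') (b n)])
    rw [i1, i2, ← ENNReal.tsum_mul_left, ← ENNReal.tsum_mul_left]
    exact ⟨ENNReal.tsum_le_tsum fun n => (main n).1, ENNReal.tsum_le_tsum fun n => (main n).2⟩
  have lim : ∀ a : ℝ≥0∞, Tendsto (fun ε : ℝ≥0 => ((1 + ε : ℝ≥0) : ℝ≥0∞) ^ (2 * d) * a) (𝓝[>] 0)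
      (𝓝 a) := fun a => by
    have h1 : Tendsto (fun ε : ℝ≥0 => ((1 + ε : ℝ≥0) ^ (2 * d) : ℝ≥0)) (𝓝[>] 0) (𝓝 1) := by
      have : Continuous fun ε : ℝ≥0 => ((1 + ε : ℝ≥0) ^ (2 * d) : ℝ≥0) := by fun_prop
      simpa using (this.tendsto 0).mono_left nhdsWithin_le_nhds
    have h2 : Tendsto (fun ε : ℝ≥0 => (((1 + ε : ℝ≥0) ^ (2 * d) : ℝ≥0) : ℝ≥0∞)) (𝓝[>] 0) (𝓝 1) :=
      ENNReal.tendsto_coe.2 h1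
    simpa using ENNReal.Tendsto.mul_const h2 (Or.inl one_ne_zero)
  apply le_antisymm
  · exact ge_of_tendsto (lim _) (by filter_upwards [self_mem_nhdsWithin] with ε hε using (key ε hε).1)
  · exact ge_of_tendsto (lim _) (by filter_upwards [self_mem_nhdsWithin] with ε hε using (key ε hε).2)

end AreaFormula

/-! ### Lipschitz graphs over a hyperplane: coordinates, surface measure and normal -/

section Graph

variable {n : ℕ} {e : Eu n} {φ : Eu n → ℝ} {K : ℝ≥0}

/-- The hyperplane orthogonal to `e`. -/
abbrev hyperplane (e : Eu n) : Submodule ℝ (Eu n) := (ℝ ∙ e)ᗮ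

/-- The parametrization of the graph of `φ` over the hyperplane orthogonal to `e`. -/
def graphMap (e : Eu n) (φ : Eu n → ℝ) (w : hyperplane e) : Eu n := (w : Eu n) + φ w • e

/-- The point at height `t` below the graph of `φ`. -/
def shear (e : Eu n) (φ : Eu n → ℝ) (p : hyperplane e × ℝ) : Eu n :=
  (p.1 : Eu n) + (φ p.1 - p.2) • e

/-- The depth of a point below the graph of `φ`. -/
def depth (e : Eu n) (φ : Eu n → ℝ) (z : Eu n) : ℝ := φ (z - ⟪e, z⟫ • e) - ⟪e, z⟫

/-- The open region below the graph of `φ`. -/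
def subgraph (e : Eu n) (φ : Eu n → ℝ) : Set (Eu n) := {z | ⟪e, z⟫ < φ (z - ⟪e, z⟫ • e)}

theorem inner_hyperplane (w : hyperplane e) : ⟪e, (w : Eu n)⟫ = 0 :=
  Submodule.mem_orthogonal_singleton_iff_inner_right.1 w.2

theorem finrank_hyperplane (he : ‖e‖ = 1) : Module.finrank ℝ (hyperplane e) = n - 1 := by
  have h1 := (ℝ ∙ e).finrank_add_finrank_orthogonal
  rw [finrank_span_singleton (by rintro rfl; simp at he), finrank_euclideanSpace_fin] at h1
  exact Nat.eq_sub_of_add_eq' h1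

theorem inner_add_smul (he : ‖e‖ = 1) (w : hyperplane e) (s : ℝ) :
    ⟪e, (w : Eu n) + s • e⟫ = s := by
  rw [inner_add_right, inner_hyperplane, inner_smul_right, real_inner_self_eq_norm_sq, he]
  simp

theorem proj_mem (he : ‖e‖ = 1) (z : Eu n) : z - ⟪e, z⟫ • e ∈ hyperplane e := by
  rw [Submodule.mem_orthogonal_singleton_iff_inner_right, inner_sub_right, inner_smul_right,
    real_inner_self_eq_norm_sq, he]
  simp

/-- The orthogonal projection onto the hyperplane, as a linear map. -/
def hproj (he : ‖e‖ = 1) : Eu n →L[ℝ] hyperplane e :=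
  (ContinuousLinearMap.id ℝ (Eu n) - (innerSL ℝ e).smulRight e).codRestrict (hyperplane e)
    (fun z => by simpa using proj_mem he z)

@[simp] theorem coe_hproj (he : ‖e‖ = 1) (z : Eu n) : (hproj he z : Eu n) = z - ⟪e, z⟫ • e := by
  simp [hproj]

theorem norm_hproj_le (he : ‖e‖ = 1) (z : Eu n) : ‖hproj he z‖ ≤ ‖z‖ := by
  rw [Submodule.coe_norm]
  apply le_of_sq_le_sq _ (norm_nonneg _)
  rw [coe_hproj, ← real_inner_self_eq_norm_sq, ← real_inner_self_eq_norm_sq]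
  simp only [inner_sub_left, inner_sub_right, inner_smul_left, inner_smul_right,
    real_inner_self_eq_norm_sq, he, real_inner_comm, conj_trivial]
  nlinarith [sq_nonneg ⟪e, z⟫, real_inner_comm e z]

theorem hproj_add_smul (he : ‖e‖ = 1) (w : hyperplane e) (s : ℝ) :
    hproj he ((w : Eu n) + s • e) = w := by
  ext1
  rw [coe_hproj, inner_add_smul he]
  simp

theorem hproj_graphMap (he : ‖e‖ = 1) (w : hyperplane e) : hproj he (graphMap e φ w) = w :=
  hproj_add_smul he w _

theorem hproj_shear (he : ‖e‖ = 1) (p : hyperplane e × ℝ) : hproj he (shear e φ p) = p.1 :=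
  hproj_add_smul he _ _

theorem depth_eq (he : ‖e‖ = 1) (z : Eu n) : depth e φ z = φ (hproj he z) - ⟪e, z⟫ := by
  rw [coe_hproj]; rfl

theorem mem_subgraph_iff {z : Eu n} : z ∈ subgraph e φ ↔ 0 < depth e φ z := by
  simp [subgraph, depth]

theorem depth_shear (he : ‖e‖ = 1) (p : hyperplane e × ℝ) : depth e φ (shear e φ p) = p.2 := by
  rw [depth_eq he, hproj_shear, shear, inner_add_smul he]; ring

theorem depth_graphMap (he : ‖e‖ = 1) (w : hyperplane e) : depth e φ (graphMap e φ w) = 0 := by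
  rw [depth_eq he, hproj_graphMap, graphMap, inner_add_smul he]; ring

theorem graphMap_hproj (he : ‖e‖ = 1) {z : Eu n} (hz : depth e φ z = 0) :
    graphMap e φ (hproj he z) = z := by
  rw [depth_eq he, sub_eq_zero] at hz
  rw [graphMap, hz, coe_hproj]; abel

theorem range_graphMap (he : ‖e‖ = 1) : range (graphMap e φ) = {z | depth e φ z = 0} := by
  ext z
  constructor
  · rintro ⟨w, rfl⟩; exact depth_graphMap he w
  · intro hz; exact ⟨_, graphMap_hproj he hz⟩

theorem shear_zero (w : hyperplane e) : shear e φ (w, 0) = graphMap e φ w := by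
  simp [shear, graphMap]

theorem lipschitzWith_depth (he : ‖e‖ = 1) (hφ : LipschitzWith K φ) :
    LipschitzWith (K + 1) (depth e φ) := by
  apply LipschitzWith.of_dist_le_mul
  intro x y
  rw [depth_eq he, depth_eq he, Real.dist_eq]
  have h1 : |φ (hproj he x) - φ (hproj he y)| ≤ K * dist x y := by
    rw [← Real.dist_eq]
    refine (hφ.dist_le_mul _ _).trans ?_
    gcongr
    rw [dist_eq_norm, dist_eq_norm, ← Submodule.coe_sub, ← map_sub]
    exact norm_hproj_le he _
  have h2 : |⟪e, x⟫ - ⟪e, y⟫| ≤ dist x y := by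
    rw [← inner_sub_right, dist_eq_norm]
    simpa [he] using abs_real_inner_le_norm e (x - y)
  push_cast
  calc _ = |(φ (hproj he x) - φ (hproj he y)) - (⟪e, x⟫ - ⟪e, y⟫)| := by congr 1; ring
    _ ≤ _ := abs_sub _ _
    _ ≤ _ := by linarith

theorem continuous_shear (hφ : LipschitzWith K φ) : Continuous (shear e φ) := by
  have := hφ.continuous
  unfold shear
  fun_prop

theorem continuous_graphMap (hφ : LipschitzWith K φ) : Continuous (graphMap e φ) := by
  have := hφ.continuous
  unfold graphMap
  fun_prop

theorem isOpen_subgraph (he : ‖e‖ = 1) (hφ : LipschitzWith K φ) : IsOpen (subgraph e φ) := by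
  have : subgraph e φ = depth e φ ⁻¹' Ioi 0 := by ext; simp [mem_subgraph_iff]
  rw [this]
  exact isOpen_Ioi.preimage (lipschitzWith_depth he hφ).continuous

theorem graphMap_mem_closure (he : ‖e‖ = 1) (hφ : LipschitzWith K φ) (w : hyperplane e) :
    graphMap e φ w ∈ closure (subgraph e φ) := by
  have h : Tendsto (fun t : ℝ => shear e φ (w, t)) (𝓝[>] 0) (𝓝 (graphMap e φ w)) := by
    rw [← shear_zero]
    exact (((continuous_shear hφ).comp (by fun_prop : Continuous fun t : ℝ => (w, t))).tendsto
      0).mono_left nhdsWithin_le_nhds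
  refine mem_closure_of_tendsto h ?_
  filter_upwards [self_mem_nhdsWithin] with t ht
  rw [mem_subgraph_iff, depth_shear he]; exact ht

theorem frontier_subgraph (he : ‖e‖ = 1) (hφ : LipschitzWith K φ) :
    frontier (subgraph e φ) = {z | depth e φ z = 0} := by
  rw [(isOpen_subgraph he hφ).frontier_eq]
  ext z
  simp only [Set.mem_sdiff, mem_subgraph_iff, mem_ofPred_eq, not_lt]
  constructor
  · rintro ⟨h1, h2⟩
    refine le_antisymm h2 ?_
    have : closure (subgraph e φ) ⊆ depth e φ ⁻¹' Ici 0 :=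
      closure_minimal (fun z hz => (mem_subgraph_iff.1 hz).le)
        (isClosed_Ici.preimage (lipschitzWith_depth he hφ).continuous)
    exact this h1
  · intro hz
    exact ⟨graphMap_hproj he hz ▸ graphMap_mem_closure he hφ _, hz.le⟩

/-- Composition of the orthogonal splitting of space with a skew product that reflects and
translates every vertical line. It provides Fubini coordinates (foot point, depth) adapted to the
graph. -/
theorem measurePreserving_shear (he : ‖e‖ = 1) (hφ : LipschitzWith K φ) :
    MeasurePreserving (shear e φ) (volume.prod volume) volume := by
  have h0 : MeasurePreserving (fun q : (ℝ ∙ e) × hyperplane e => (q.1 : Eu n) + (q.2 : Eu n))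
      (volume.prod volume) volume := by
    have := (Submodule.measurePreserving_measurableEquivProd (ℝ ∙ e) (0 : Eu n)).symm
    rw [InnerProductSpace.euclideanHausdorffMeasure_eq_volume] at this
    convert! this using 1
    ext q
    simp
  have h1 : MeasurePreserving (fun p : hyperplane e × ℝ => (p.1 : Eu n) + p.2 • e)
      (volume.prod volume) volume := by
    have h2 : MeasurePreserving (LinearIsometryEquiv.toSpanUnitSingleton (𝕜 := ℝ) e he)
      volume volume := LinearIsometryEquiv.measurePreserving _
    have h3 := h0.comp ((h2.prod (MeasurePreserving.id (volume : Measure (hyperplane e)))).comp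
      Measure.measurePreserving_swap)
    convert! h3 using 1
    ext1 p
    simp [add_comm]
  have h4 : MeasurePreserving (fun p : hyperplane e × ℝ => (p.1, φ p.1 - p.2))
      (volume.prod volume) (volume.prod volume) := by
    refine (MeasurePreserving.id (volume : Measure (hyperplane e))).skew_product (g := fun w t => φ (w : Eu n) - t) ?_ ?_
    · have := hφ.continuous
      apply Continuous.measurable
      fun_prop
    · filter_upwards with w
      exact (Measure.measurePreserving_sub_left (volume : Measure ℝ) (φ w)).map_eq
  exact h1.comp h4

theorem measurableEmbedding_shear (he : ‖e‖ = 1) (hφ : LipschitzWith K φ) :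
    MeasurableEmbedding (shear e φ) := by
  apply (continuous_shear hφ).measurableEmbedding
  intro p q h
  have h1 := congrArg (hproj he) h
  have h2 := congrArg (depth e φ) h
  rw [hproj_shear, hproj_shear] at h1
  rw [depth_shear he, depth_shear he] at h2
  exact Prod.ext h1 h2

theorem injective_graphMap (he : ‖e‖ = 1) : Function.Injective (graphMap e φ) := fun w w' h => by
  simpa [hproj_graphMap] using congrArg (hproj he) h

theorem measurableEmbedding_graphMap (he : ‖e‖ = 1) (hφ : LipschitzWith K φ) :
    MeasurableEmbedding (graphMap e φ) :=
  (continuous_graphMap hφ).measurableEmbedding (injective_graphMap he)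

/-- The derivative of `φ` along the hyperplane. -/
def slope (e : Eu n) (φ : Eu n → ℝ) (w : hyperplane e) : hyperplane e →L[ℝ] ℝ :=
  fderiv ℝ (fun w : hyperplane e => φ w) w

theorem lipschitzWith_restrict (hφ : LipschitzWith K φ) :
    LipschitzWith K (fun w : hyperplane e => φ w) := by
  simpa [Function.comp_def] using hφ.comp (LipschitzWith.subtype_val (hyperplane e : Set (Eu n)))

theorem norm_slope_le (hφ : LipschitzWith K φ) (w : hyperplane e) : ‖slope e φ w‖ ≤ K :=
  norm_fderiv_le_of_lipschitz ℝ (lipschitzWith_restrict hφ)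

theorem measurable_slope : Measurable (slope e φ) := measurable_fderiv ℝ _

theorem ae_hasFDerivAt_restrict (hφ : LipschitzWith K φ) :
    ∀ᵐ w : hyperplane e, HasFDerivAt (fun w : hyperplane e => φ w) (slope e φ w) w := by
  filter_upwards [(lipschitzWith_restrict hφ).ae_differentiableAt] with w hw using hw.hasFDerivAt

/-- The area element of the graph. -/
def areaElement (e : Eu n) (φ : Eu n → ℝ) (w : hyperplane e) : ℝ := √(1 + ‖slope e φ w‖ ^ 2)

theorem measurable_areaElement : Measurable (areaElement e φ) := by
  have := measurable_slope (e := e) (φ := φ)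
  exact Real.continuous_sqrt.measurable.comp (measurable_const.add (this.norm.pow_const 2))

theorem one_le_areaElement (w : hyperplane e) : 1 ≤ areaElement e φ w := by
  rw [areaElement, Real.one_le_sqrt]
  nlinarith [sq_nonneg ‖slope e φ w‖]

theorem areaElement_le (hφ : LipschitzWith K φ) (w : hyperplane e) :
    areaElement e φ w ≤ √(1 + (K : ℝ) ^ 2) := by
  apply Real.sqrt_le_sqrt
  gcongr
  exact norm_slope_le hφ w

/-- The upward normal vector `e - ∇φ` to the graph. -/
def normalVec (e : Eu n) (φ : Eu n → ℝ) (w : hyperplane e) : Eu n :=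
  e - ((InnerProductSpace.toDual ℝ (hyperplane e)).symm (slope e φ w) : Eu n)

theorem inner_normalVec (he : ‖e‖ = 1) (w : hyperplane e) (v : Eu n) :
    ⟪normalVec e φ w, v⟫ = ⟪e, v⟫ - slope e φ w (hproj he v) := by
  rw [normalVec, inner_sub_left]
  congr 1
  have : (v : Eu n) = (hproj he v : Eu n) + ⟪e, v⟫ • e := by rw [coe_hproj]; abel
  conv_lhs => rw [this]
  rw [inner_add_right, inner_smul_right, real_inner_comm e, inner_hyperplane, mul_zero, add_zero,
    ← Submodule.coe_inner, InnerProductSpace.toDual_symm_apply]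

theorem norm_normalVec (he : ‖e‖ = 1) (w : hyperplane e) :
    ‖normalVec e φ w‖ = areaElement e φ w := by
  rw [areaElement, eq_comm, Real.sqrt_eq_iff_mul_self_eq (by positivity) (norm_nonneg _), ← sq,
    normalVec, norm_sub_sq_real, inner_hyperplane, he, ← Submodule.coe_norm,
    LinearIsometryEquiv.norm_map]
  ring

theorem measurable_normalVec : Measurable (normalVec e φ) := by
  have h := measurable_slope (e := e) (φ := φ)
  unfold normalVec
  have h2 : Continuous (fun L : hyperplane e →L[ℝ] ℝ =>
    ((InnerProductSpace.toDual ℝ (hyperplane e)).symm L : Eu n)) :=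
    continuous_subtype_val.comp (LinearIsometryEquiv.continuous _)
  exact measurable_const.sub (h2.measurable.comp h)

/-- The derivative of the graph parametrization. -/
def graphDeriv (e : Eu n) (φ : Eu n → ℝ) (w : hyperplane e) : hyperplane e →L[ℝ] Eu n :=
  (hyperplane e).subtypeL + (slope e φ w).smulRight e

theorem hasFDerivAt_graphMap {w : hyperplane e}
    (hw : HasFDerivAt (fun w : hyperplane e => φ w) (slope e φ w) w) :
    HasFDerivAt (graphMap e φ) (graphDeriv e φ w) w :=
  (hyperplane e).subtypeL.hasFDerivAt.add (hw.smul_const e)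

theorem norm_le_norm_add_smul (he : ‖e‖ = 1) (w : hyperplane e) (s : ℝ) :
    ‖w‖ ≤ ‖(w : Eu n) + s • e‖ := by
  conv_lhs => rw [← hproj_add_smul he w s]
  exact norm_hproj_le he _

/-- The Gram matrix of the tangent vectors is the identity plus a rank-one matrix, so the matrix
determinant lemma gives 1 + |∇φ|². -/
theorem normDet_graphDeriv (he : ‖e‖ = 1) (w : hyperplane e) :
    LinearMap.normDet (graphDeriv e φ w).toLinearMap = areaElement e φ w := by
  rw [areaElement, eq_comm, Real.sqrt_eq_iff_mul_self_eq (by positivity)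
    (LinearMap.normDet_nonneg _), ← sq]
  set b := stdOrthonormalBasis ℝ (hyperplane e)
  have h1 := LinearMap.normDet_sq_eq_det_gram (graphDeriv e φ w).toLinearMap b
  have h2 : Matrix.gram ℝ (fun i => (graphDeriv e φ w).toLinearMap (b i))
      = 1 + Matrix.replicateCol Unit (fun i => slope e φ w (b i))
        * Matrix.replicateRow Unit (fun i => slope e φ w (b i)) := by
    ext i j
    simp only [Matrix.gram_apply, graphDeriv, ContinuousLinearMap.coe_coe, Matrix.add_apply,
      add_apply, Submodule.subtypeL_apply, ContinuousLinearMap.smulRight_apply,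
      Matrix.mul_apply, Matrix.replicateCol_apply, Matrix.replicateRow_apply, inner_add_left,
      inner_add_right, inner_smul_left, inner_smul_right, inner_hyperplane,
      real_inner_self_eq_norm_sq, he]
    rw [real_inner_comm e (b i : Eu n), inner_hyperplane, ← Submodule.coe_inner,
      orthonormal_iff_ite.1 b.orthonormal i j, Matrix.one_apply]
    simp [mul_comm]
  rw [h2, Matrix.det_one_add_replicateCol_mul_replicateRow] at h1
  have h3 : ‖slope e φ w‖ ^ 2 = (fun i => slope e φ w (b i)) ⬝ᵥ (fun i => slope e φ w (b i)) := by
    rw [← LinearIsometryEquiv.norm_map (InnerProductSpace.toDual ℝ (hyperplane e)).symm,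
      ← b.sum_sq_norm_inner_right, dotProduct]
    refine Finset.sum_congr rfl fun i _ => ?_
    rw [real_inner_comm, InnerProductSpace.toDual_symm_apply, Real.norm_eq_abs, sq_abs, sq]
  rw [h3]
  exact h1.symm

theorem lipschitzWith_graphMap (he : ‖e‖ = 1) (hφ : LipschitzWith K φ) :
    LipschitzWith (1 + K) (graphMap e φ) := by
  apply LipschitzWith.of_dist_le_mul
  intro x y
  have h := (lipschitzWith_restrict hφ).dist_le_mul x y
  rw [Real.dist_eq] at h
  have : graphMap e φ x - graphMap e φ y = ((x : Eu n) - y) + (φ x - φ y) • e := by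
    simp only [graphMap, sub_smul]; abel
  rw [dist_eq_norm, this]
  refine (norm_add_le _ _).trans ?_
  rw [norm_smul, he, Real.norm_eq_abs, ← Submodule.coe_sub, ← Submodule.coe_norm, ← dist_eq_norm]
  push_cast
  linarith

theorem euclideanHausdorffMeasure_image_graphMap_null (he : ‖e‖ = 1) (hφ : LipschitzWith K φ)
    {s : Set (hyperplane e)} (hs : volume s = 0) : μHE[n - 1] (graphMap e φ '' s) = 0 := by
  have := euclideanHausdorffMeasure_image_le_of_lipschitzOnWith
    ((lipschitzWith_graphMap he hφ).lipschitzOnWith (s := s)) (n - 1)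
  rw [← finrank_hyperplane he, InnerProductSpace.euclideanHausdorffMeasure_eq_volume, hs,
    mul_zero] at this
  rw [← finrank_hyperplane he]
  exact le_antisymm this zero_le

/-- The area of the graph of a Lipschitz function. -/
theorem euclideanHausdorffMeasure_image_graphMap (he : ‖e‖ = 1) (hφ : LipschitzWith K φ)
    {s : Set (hyperplane e)} (hs : MeasurableSet s) :
    μHE[n - 1] (graphMap e φ '' s) = ∫⁻ w in s, ENNReal.ofReal (areaElement e φ w) := by
  -- The exceptional set of Rademacher's theorem, enlarged to a measurable null set; its image is
  -- null because `graphMap` is Lipschitz.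
  set t : Set (hyperplane e) :=
    toMeasurable volume {w | ¬ HasFDerivAt (fun w : hyperplane e => φ w) (slope e φ w) w}
  have ht0 : volume t = 0 := by
    rw [measure_toMeasurable]; exact ae_iff.1 (ae_hasFDerivAt_restrict hφ)
  have htm : MeasurableSet t := measurableSet_toMeasurable _ _
  have htd : ∀ w ∈ s \ t, HasFDerivAt (graphMap e φ) (graphDeriv e φ w) w := fun w hw =>
    hasFDerivAt_graphMap (by by_contra h; exact hw.2 (subset_toMeasurable _ _ h))
  have h1 : μHE[n - 1] (graphMap e φ '' (s \ t))
      = ∫⁻ w in s \ t, ENNReal.ofReal (areaElement e φ w) := by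
    -- `graphMap` and its derivative are expanding because the projection back to the hyperplane
    -- does not increase distances.
    have := area_formula (hs.diff htm) (g := graphMap e φ) (g' := graphDeriv e φ) ?_
      (fun w hw => (htd w hw).hasFDerivWithinAt) (fun w _ v => ?_) (fun w _ w' _ => ?_)
    · simpa only [finrank_hyperplane he, normDet_graphDeriv he] using this
    · have h := measurable_slope (e := e) (φ := φ)
      have h2 : Continuous fun L : hyperplane e →L[ℝ] ℝ =>
        (hyperplane e).subtypeL + L.smulRight e := by
        refine continuous_const.add ?_
        exact (ContinuousLinearMap.smulRightL ℝ (hyperplane e) (Eu n)).flip e |>.continuous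
      exact h2.measurable.comp h
    · simpa [graphDeriv] using norm_le_norm_add_smul he v (slope e φ w v)
    · have : graphMap e φ w - graphMap e φ w' = ((w - w' : hyperplane e) : Eu n)
          + (φ w - φ w') • e := by
        simp only [graphMap, sub_smul, Submodule.coe_sub]; abel
      rw [this]; exact norm_le_norm_add_smul he _ _
  have h2 : (s \ t : Set (hyperplane e)) =ᵐ[volume] s := sdiff_null_ae_eq_self ht0
  rw [← setLIntegral_congr h2, ← h1]
  refine le_antisymm ?_ (measure_mono (image_mono sdiff_subset))
  calc _ ≤ μHE[n - 1] (graphMap e φ '' (s \ t) ∪ graphMap e φ '' t) := by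
        refine measure_mono ?_
        rw [← image_union]
        exact image_mono (by rw [sdiff_union_self]; exact subset_union_left)
    _ ≤ _ := measure_union_le _ _
    _ = _ := by rw [euclideanHausdorffMeasure_image_graphMap_null he hφ ht0, add_zero]

theorem restrict_range_graphMap (he : ‖e‖ = 1) (hφ : LipschitzWith K φ) :
    (μHE[n - 1] : Measure (Eu n)).restrict (range (graphMap e φ))
      = (volume.withDensity fun w => ENNReal.ofReal (areaElement e φ w)).map (graphMap e φ) := by
  have hm := measurableEmbedding_graphMap he hφ
  ext B hB
  rw [Measure.restrict_apply hB, hm.map_apply, withDensity_apply _ (hm.measurable hB),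
    ← euclideanHausdorffMeasure_image_graphMap he hφ (hm.measurable hB),
    image_preimage_eq_inter_range]

theorem integral_graph (he : ‖e‖ = 1) (hφ : LipschitzWith K φ) (u : Eu n → ℝ) :
    ∫ x in {z | depth e φ z = 0}, u x ∂μHE[n - 1]
      = ∫ w : hyperplane e, areaElement e φ w * u (graphMap e φ w) := by
  rw [← range_graphMap he, restrict_range_graphMap he hφ,
    (measurableEmbedding_graphMap he hφ).integral_map,
    integral_withDensity_eq_integral_toReal_smul measurable_areaElement.ennreal_ofReal (by simp)]
  refine integral_congr_ae (.of_forall fun w => ?_)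
  simp [ENNReal.toReal_ofReal (zero_le_one.trans (one_le_areaElement w))]

theorem ae_graph_of_ae (he : ‖e‖ = 1) (hφ : LipschitzWith K φ) {p : Eu n → Prop}
    (h : ∀ᵐ w : hyperplane e, p (graphMap e φ w)) :
    ∀ᵐ x ∂(μHE[n - 1] : Measure (Eu n)).restrict {z | depth e φ z = 0}, p x := by
  rw [← range_graphMap he, restrict_range_graphMap he hφ,
    (measurableEmbedding_graphMap he hφ).ae_map_iff]
  exact (withDensity_absolutelyContinuous _ _).ae_le h

/-- If v ≠ v', moving from x in the direction u = v' - v leads into Ω according to v and out of Ω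
according to v'. -/
theorem IsOuterUnitNormal.unique {Ω : Set (Eu n)} {x v v' : Eu n} (h : IsOuterUnitNormal Ω x v)
    (h' : IsOuterUnitNormal Ω x v') : v = v' := by
  by_contra hne
  set u := v' - v
  have hu : 0 < ‖u‖ := norm_pos_iff.2 (sub_ne_zero.2 (Ne.symm hne))
  have h1 : ⟪v', u⟫ = ‖u‖ ^ 2 / 2 := by
    simp only [u, inner_sub_right, norm_sub_sq_real, real_inner_self_eq_norm_sq, h.1, h'.1]; ring
  have h2 : ⟪v, u⟫ = -(‖u‖ ^ 2 / 2) := by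
    simp only [u, inner_sub_right, norm_sub_sq_real, real_inner_self_eq_norm_sq, h.1, h'.1,
      real_inner_comm v' v]; ring
  have ht : Tendsto (fun t : ℝ => x + t • u) (𝓝[>] 0) (𝓝 x) := by
    have : Continuous fun t : ℝ => x + t • u := by fun_prop
    simpa using (this.tendsto 0).mono_left nhdsWithin_le_nhds
  -- The inner products of u with v' and v are ±‖u‖²/2, so the aperture ‖u‖/4 is half of the slope
  -- ‖u‖/2 at which the ray leaves x.
  have e1 := ht.eventually (h.2 (‖u‖ / 4) (by positivity))
  have e2 := ht.eventually (h'.2 (‖u‖ / 4) (by positivity))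
  obtain ⟨t, a1, a2, ht0⟩ := (e1.and (e2.and self_mem_nhdsWithin)).exists
  replace ht0 : 0 < t := ht0
  simp only [add_sub_cancel_left, inner_smul_right, norm_smul, Real.norm_of_nonneg ht0.le, h1, h2]
    at a1 a2
  refine a2.2 ?_ (a1.1 ?_) <;> nlinarith [mul_pos ht0 (pow_pos hu 2)]

theorem IsOuterUnitNormal.congr {Ω Ω' : Set (Eu n)} {x v : Eu n} (h : IsOuterUnitNormal Ω x v)
    (hΩ : ∀ᶠ z in 𝓝 x, (z ∈ Ω ↔ z ∈ Ω')) : IsOuterUnitNormal Ω' x v :=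
  ⟨h.1, fun c hc => by filter_upwards [h.2 c hc, hΩ] with z h1 h2; rwa [← h2]⟩

theorem IsOuterUnitNormal.outerNormal_eq {Ω : Set (Eu n)} {x v : Eu n}
    (h : IsOuterUnitNormal Ω x v) : outerNormal Ω x = v := by
  have h' : ∃ v, IsOuterUnitNormal Ω x v := ⟨v, h⟩
  rw [outerNormal, dif_pos h']
  exact h'.choose_spec.unique h

theorem norm_outerNormal_le (Ω : Set (Eu n)) (x : Eu n) : ‖outerNormal Ω x‖ ≤ 1 := by
  rw [outerNormal]
  split_ifs with h
  · exact h.choose_spec.1.le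
  · simp

/-- To first order at the graph point x, `depth` is -⟪`normalVec`, z - x⟫. Since `areaElement`, the
length of `normalVec`, is at least 1, normalising does not spoil the error bound c‖z - x‖. -/
theorem isOuterUnitNormal_subgraph (he : ‖e‖ = 1) {w : hyperplane e}
    (hw : HasFDerivAt (fun w : hyperplane e => φ w) (slope e φ w) w) :
    IsOuterUnitNormal (subgraph e φ) (graphMap e φ w)
      ((areaElement e φ w)⁻¹ • normalVec e φ w) := by
  have hJ := one_le_areaElement (φ := φ) w
  have hJ0 : 0 < areaElement e φ w := by linarith
  refine ⟨?_, fun c hc => ?_⟩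
  · rw [norm_smul, norm_normalVec he, norm_inv, Real.norm_of_nonneg hJ0.le,
      inv_mul_cancel₀ hJ0.ne']
  have h1 : ∀ᶠ w' : hyperplane e in 𝓝 w, |φ w' - φ w - slope e φ w (w' - w)| ≤ c * ‖w' - w‖ := by
    simpa using (hasFDerivAt_iff_isLittleO.1 hw).bound hc
  have h2 : Tendsto (hproj he) (𝓝 (graphMap e φ w)) (𝓝 w) := by
    have := (hproj he).continuous.tendsto (graphMap e φ w)
    rwa [hproj_graphMap] at this
  filter_upwards [h2.eventually h1] with z hz
  set x := graphMap e φ w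
  have h3 : ‖hproj he z - w‖ ≤ ‖z - x‖ := by
    conv_lhs => rw [← hproj_graphMap (φ := φ) he w, ← map_sub]
    exact norm_hproj_le he _
  have h4 : depth e φ z = (φ (hproj he z) - φ w - slope e φ w (hproj he z - w))
      - ⟪normalVec e φ w, z - x⟫ := by
    rw [inner_normalVec he, (hproj he).map_sub, hproj_graphMap, depth_eq he, inner_sub_right]
    have : ⟪e, x⟫ = φ w := inner_add_smul he _ _
    rw [this]; ring
  have h5 : |φ (hproj he z) - φ w - slope e φ w (hproj he z - w)| ≤ c * ‖z - x‖ :=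
    hz.trans (by gcongr)
  have h6 : ⟪(areaElement e φ w)⁻¹ • normalVec e φ w, z - x⟫ * areaElement e φ w
      = ⟪normalVec e φ w, z - x⟫ := by
    rw [real_inner_smul_left]; field_simp
  have h7 : 0 ≤ c * ‖z - x‖ := by positivity
  rw [mem_subgraph_iff, h4, ← h6]
  obtain ⟨h8, h9⟩ := abs_le.1 h5
  constructor
  · intro h; nlinarith
  · intro h; rw [not_lt]; nlinarith

end Graph

/-! ### Gauss's theorem below a Lipschitz graph -/

section LocalGauss

variable {n : ℕ} {e : Eu n} {φ : Eu n → ℝ} {K : ℝ≥0}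

/-- Lipschitz functions with compact support in `A`. -/
structure IsTest {n : ℕ} (A : Set (Eu n)) (δ : Eu n → ℝ) : Prop where
  lipschitz : ∃ L, LipschitzWith L δ
  compact : HasCompactSupport δ
  subset : tsupport δ ⊆ A

theorem lipschitzWith_mul {f g : Eu n → ℝ} {A B : ℝ≥0} {L M : ℝ≥0} (hf : LipschitzWith L f)
    (hg : LipschitzWith M g) (hA : ∀ x, |f x| ≤ A) (hB : ∀ x, |g x| ≤ B) :
    LipschitzWith (A * M + B * L) (fun x => f x * g x) := by
  apply LipschitzWith.of_dist_le_mul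
  intro x y
  have h1 := hf.dist_le_mul x y
  have h2 := hg.dist_le_mul x y
  rw [Real.dist_eq] at h1 h2 ⊢
  have : f x * g x - f y * g y = f x * (g x - g y) + g y * (f x - f y) := by ring
  rw [this]
  refine (abs_add_le _ _).trans ?_
  rw [abs_mul, abs_mul]
  have h3 : |f x| * |g x - g y| ≤ A * (M * dist x y) := by gcongr; exact hA x
  have h4 : |g y| * |f x - f y| ≤ B * (L * dist x y) := by gcongr; exact hB y
  push_cast
  linarith

theorem exists_bound_of_hasCompactSupport {δ : Eu n → ℝ} (h : Continuous δ)
    (hc : HasCompactSupport δ) : ∃ A : ℝ≥0, ∀ x, |δ x| ≤ A := by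
  obtain ⟨C, hC⟩ := h.bounded_above_of_compact_support hc
  exact ⟨⟨C, (norm_nonneg _).trans (hC 0)⟩, hC⟩

theorem IsTest.mul {A B : Set (Eu n)} {δ χ : Eu n → ℝ} (hδ : IsTest A δ)
    (hχ : ∃ L, LipschitzWith L χ) {b : ℝ≥0} (hb : ∀ x, |χ x| ≤ b) (hB : tsupport χ ⊆ B) :
    IsTest (A ∩ B) (fun x => δ x * χ x) := by
  obtain ⟨L, hL⟩ := hδ.lipschitz
  obtain ⟨M, hM⟩ := hχ
  obtain ⟨a, ha⟩ := exists_bound_of_hasCompactSupport hL.continuous hδ.compact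
  exact ⟨⟨_, lipschitzWith_mul hL hM ha hb⟩, hδ.compact.mul_right, subset_inter
    ((tsupport_mul_subset_left).trans hδ.subset) ((tsupport_mul_subset_right).trans hB)⟩

/-- A cutoff function vanishing near the graph. -/
def layerCut (e : Eu n) (φ : Eu n → ℝ) (k : ℝ) (z : Eu n) : ℝ :=
  max 0 (min 1 (k * depth e φ z - 1))

theorem abs_layerCut_le (k : ℝ) (z : Eu n) : |layerCut e φ k z| ≤ 1 := by
  rw [layerCut, abs_of_nonneg (le_max_left _ _)]
  exact max_le zero_le_one (min_le_left _ _)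

theorem lipschitz_layerCut (he : ‖e‖ = 1) (hφ : LipschitzWith K φ) (k : ℝ) :
    ∃ L, LipschitzWith L (layerCut e φ k) := by
  have h1 : LipschitzWith (‖k‖₊ * (K + 1)) (fun z => k * depth e φ z - 1) := by
    apply LipschitzWith.of_dist_le_mul
    intro x y
    have := (lipschitzWith_depth he hφ).dist_le_mul x y
    rw [Real.dist_eq] at this ⊢
    rw [sub_sub_sub_cancel_right, ← mul_sub, abs_mul]
    push_cast at this ⊢
    rw [mul_assoc, Real.norm_eq_abs]
    gcongr
  exact ⟨_, (h1.const_min 1).const_max 0⟩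

theorem layerCut_eq_zero {k : ℝ} {z : Eu n} (h : k * depth e φ z ≤ 1) : layerCut e φ k z = 0 := by
  rw [layerCut, max_eq_left]
  exact (min_le_right _ _).trans (by linarith)

theorem layerCut_eq_one {k : ℝ} {z : Eu n} (h : 2 ≤ k * depth e φ z) : layerCut e φ k z = 1 := by
  rw [layerCut, min_eq_left (by linarith), max_eq_right zero_le_one]

theorem tsupport_layerCut_subset (he : ‖e‖ = 1) (hφ : LipschitzWith K φ) {k : ℝ} (hk : 0 < k) :
    tsupport (layerCut e φ k) ⊆ subgraph e φ := by
  have h1 : tsupport (layerCut e φ k) ⊆ {z | 1 ≤ k * depth e φ z} := by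
    apply closure_minimal
    · intro z hz
      by_contra h
      exact hz (layerCut_eq_zero (not_le.1 h).le)
    · exact isClosed_le continuous_const
        (continuous_const.mul (lipschitzWith_depth he hφ).continuous)
  intro z hz
  have : 1 ≤ k * depth e φ z := h1 hz
  rw [mem_subgraph_iff]
  by_contra h
  nlinarith [mul_nonneg hk.le (neg_nonneg.2 (not_lt.1 h))]

theorem hasFDerivAt_depth (he : ‖e‖ = 1) {p : hyperplane e × ℝ}
    (hw : HasFDerivAt (fun w : hyperplane e => φ w) (slope e φ p.1) p.1) :
    HasFDerivAt (depth e φ) (-innerSL ℝ (normalVec e φ p.1)) (shear e φ p) := by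
  have h1 : HasFDerivAt (fun z => φ (hproj he z)) ((slope e φ p.1).comp (hproj he))
      (shear e φ p) := by
    refine HasFDerivAt.comp (g := fun w : hyperplane e => φ w) (f := hproj he) _ ?_
      (hproj he).hasFDerivAt
    rwa [hproj_shear he]
  have h2 := h1.sub (innerSL ℝ e).hasFDerivAt
  have h3 : depth e φ = (fun z => φ (hproj he z)) - fun z => innerSL ℝ e z := by
    ext z; simp [depth]
  rw [h3]
  convert! h2 using 1
  ext v
  simp [inner_normalVec he]

-- Off the two depths 1/k and 2/k, which are null by Fubini, the cutoff is locally constant or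
-- affine in `depth`.
open Classical in
theorem ae_fderiv_layerCut (he : ‖e‖ = 1) (hφ : LipschitzWith K φ) {k : ℝ} (hk : 0 < k) :
    ∀ᵐ p ∂((volume : Measure (hyperplane e)).prod (volume : Measure ℝ)), ∀ v,
      DifferentiableAt ℝ (layerCut e φ k) (shear e φ p) ∧
      fderiv ℝ (layerCut e φ k) (shear e φ p) v
        = -((Ioo (1 / k) (2 / k)).indicator (fun _ => k) p.2 * ⟪normalVec e φ p.1, v⟫) := by
  have h1 := Measure.quasiMeasurePreserving_fst (μ := (volume : Measure (hyperplane e)))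
    (ν := (volume : Measure ℝ)) |>.ae (ae_hasFDerivAt_restrict hφ)
  have h2 : ∀ a : ℝ, ∀ᵐ t : ℝ, t ≠ a := fun a => by simp [ae_iff]
  have h3 := fun a => Measure.quasiMeasurePreserving_snd (μ := (volume : Measure (hyperplane e)))
    (ν := (volume : Measure ℝ)) |>.ae (h2 a)
  have hd := (lipschitzWith_depth he hφ).continuous
  filter_upwards [h1, h3 (1 / k), h3 (2 / k)] with p hp h4 h5 v
  have hc : Tendsto (fun z => k * depth e φ z) (𝓝 (shear e φ p)) (𝓝 (k * p.2)) := by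
    have : Continuous fun z => k * depth e φ z := continuous_const.mul hd
    simpa only [depth_shear he] using this.tendsto (shear e φ p)
  have key : HasFDerivAt (layerCut e φ k)
      (-((Ioo (1 / k) (2 / k)).indicator (fun _ => k) p.2 • innerSL ℝ (normalVec e φ p.1)))
      (shear e φ p) := by
    rcases lt_or_gt_of_ne h4 with h | h
    · have h6 : layerCut e φ k =ᶠ[𝓝 (shear e φ p)] fun _ => 0 := by
        have : k * p.2 < 1 := by rwa [lt_div_iff₀ hk, mul_comm] at h
        filter_upwards [hc.eventually (gt_mem_nhds this)] with z hz
        exact layerCut_eq_zero hz.le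
      rw [indicator_of_notMem (fun h' => absurd h'.1 (not_lt.2 h.le)), zero_smul, neg_zero]
      exact (hasFDerivAt_const _ _).congr_of_eventuallyEq h6
    rcases lt_or_gt_of_ne h5 with h' | h'
    · have e1 : 1 < k * p.2 := by rwa [div_lt_iff₀ hk, mul_comm] at h
      have e2 : k * p.2 < 2 := by rwa [lt_div_iff₀ hk, mul_comm] at h'
      have h6 : layerCut e φ k =ᶠ[𝓝 (shear e φ p)] fun z => k * depth e φ z - 1 := by
        filter_upwards [hc.eventually (gt_mem_nhds e2), hc.eventually (lt_mem_nhds e1)] with z h7 h8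
        rw [layerCut, min_eq_right (by linarith), max_eq_right (by linarith)]
      rw [indicator_of_mem (show p.2 ∈ Ioo (1 / k) (2 / k) from ⟨h, h'⟩), ← smul_neg]
      exact (((hasFDerivAt_depth he hp).const_mul k).sub_const 1).congr_of_eventuallyEq h6
    · have h6 : layerCut e φ k =ᶠ[𝓝 (shear e φ p)] fun _ => 1 := by
        have : 2 < k * p.2 := by rwa [div_lt_iff₀ hk, mul_comm] at h'
        filter_upwards [hc.eventually (lt_mem_nhds this)] with z hz
        exact layerCut_eq_one hz.le
      rw [indicator_of_notMem (fun h => absurd h.2 (not_lt.2 h'.le)), zero_smul, neg_zero]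
      exact (hasFDerivAt_const _ _).congr_of_eventuallyEq h6
  refine ⟨key.differentiableAt, ?_⟩
  rw [key.fderiv]
  simp

/-- The gradient of the cutoff is -k `normalVec` in the layer of depths between 1/k and 2/k. In the
coordinates of `shear` the weight k on that interval has mass 1, so the integral over t is an
average that tends to the boundary value. The normal is not normalised, so the limit is an integral
in dw without area element. -/
theorem layer_limit (he : ‖e‖ = 1) (hφ : LipschitzWith K φ) {u : Eu n → Eu n} {C R : ℝ}
    (hm : AEStronglyMeasurable u (volume.restrict (subgraph e φ)))
    (hb : ∀ z ∈ subgraph e φ, ‖u z‖ ≤ C) (hsupp : ∀ z, R < ‖z‖ → u z = 0)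
    {ub : hyperplane e → Eu n}
    (hlim : ∀ w, Tendsto u (𝓝[subgraph e φ] graphMap e φ w) (𝓝 (ub w))) :
    Tendsto (fun k : ℕ => ∫ z in subgraph e φ, fderiv ℝ (layerCut e φ k) z (u z)) atTop
      (𝓝 (-∫ w, ⟪normalVec e φ w, ub w⟫)) := by
  set D := subgraph e φ
  have hD : MeasurableSet D := (isOpen_subgraph he hφ).measurableSet
  have hs := measurePreserving_shear he hφ
  have hse := measurableEmbedding_shear he hφ
  set g : hyperplane e × ℝ → ℝ := fun p => ⟪normalVec e φ p.1, D.indicator u (shear e φ p)⟫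
  have hC : 0 ≤ C := (norm_nonneg _).trans (hb (shear e φ (0, 1))
    (by rw [mem_subgraph_iff, depth_shear he]; exact one_pos))
  have hgm : AEStronglyMeasurable g (volume.prod volume) := by
    refine AEStronglyMeasurable.inner ?_ ?_
    · exact (measurable_normalVec.comp measurable_fst).aestronglyMeasurable
    · exact ((aestronglyMeasurable_indicator_iff hD).2 hm).comp_quasiMeasurePreserving
        hs.quasiMeasurePreserving
  set C' := √(1 + (K : ℝ) ^ 2) * C
  have hC' : 0 ≤ C' := by positivity
  have hgb : ∀ p, ‖g p‖ ≤ C' := fun p => by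
    refine (norm_inner_le_norm _ _).trans ?_
    rw [norm_normalVec he]
    refine mul_le_mul (areaElement_le hφ _) ?_ (norm_nonneg _) (Real.sqrt_nonneg _)
    by_cases h : shear e φ p ∈ D
    · rw [indicator_of_mem h]; exact hb _ h
    · rw [indicator_of_notMem h, norm_zero]; exact hC
  have hg0 : ∀ p : hyperplane e × ℝ, R < ‖p.1‖ → g p = 0 := fun p hp => by
    have : R < ‖shear e φ p‖ := hp.trans_le (norm_le_norm_add_smul he _ _)
    have h0 : D.indicator u (shear e φ p) = 0 := indicator_apply_eq_zero.2 fun _ => hsupp _ this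
    simp only [g, h0, inner_zero_right]
  set B : Set (hyperplane e) := Metric.closedBall 0 R
  have hgB : ∀ p : hyperplane e × ℝ, ‖g p‖ ≤ B.indicator (fun _ => C') p.1 := fun p => by
    by_cases h : p.1 ∈ B
    · rw [indicator_of_mem h]; exact hgb p
    · rw [indicator_of_notMem h, hg0 p (by simpa [B] using h), norm_zero]
  set G : ℕ → hyperplane e × ℝ → ℝ := fun k p =>
    (Ioo (1 / (k : ℝ)) (2 / k)).indicator (fun _ => (k : ℝ)) p.2 * g p
  have hGm : ∀ k, AEStronglyMeasurable (G k) (volume.prod volume) := fun k =>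
    (((measurable_const.indicator measurableSet_Ioo).comp measurable_snd).aestronglyMeasurable).mul
      hgm
  have hGi : ∀ k, Integrable (G k) (volume.prod volume) := fun k => by
    have h1 : Integrable (fun p : hyperplane e × ℝ => B.indicator (fun _ => C') p.1 *
        (Ioo (1 / (k : ℝ)) (2 / k)).indicator (fun _ => (k : ℝ)) p.2) (volume.prod volume) := by
      refine Integrable.mul_prod (f := B.indicator fun _ => C')
        (g := (Ioo (1 / (k : ℝ)) (2 / k)).indicator fun _ => (k : ℝ)) ?_ ?_
      · exact (integrable_indicator_iff measurableSet_closedBall).2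
          (integrableOn_const (measure_closedBall_lt_top.ne))
      · exact (integrable_indicator_iff measurableSet_Ioo).2
          (integrableOn_const (measure_Ioo_lt_top.ne))
    refine h1.mono' (hGm k) (.of_forall fun p => ?_)
    have h2 : 0 ≤ (Ioo (1 / (k : ℝ)) (2 / k)).indicator (fun _ => (k : ℝ)) p.2 :=
      indicator_nonneg (fun _ _ => by positivity) _
    simp only [G]
    rw [norm_mul, Real.norm_of_nonneg h2, mul_comm]
    exact mul_le_mul_of_nonneg_right (hgB p) h2
  have e1 : ∀ k : ℕ, 0 < k → ∫ z in D, fderiv ℝ (layerCut e φ k) z (u z)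
      = -∫ w, ∫ t, G k (w, t) := fun k hk => by
    rw [← integral_prod _ (hGi k), ← integral_indicator hD, ← hs.integral_comp hse, ← integral_neg]
    apply integral_congr_ae
    filter_upwards [ae_fderiv_layerCut he hφ (k := k) (by exact_mod_cast hk)] with p hp
    by_cases h : shear e φ p ∈ D
    · rw [indicator_of_mem h, (hp _).2]
      simp only [G, g, indicator_of_mem h]
    · rw [indicator_of_notMem h]
      simp only [G, g, indicator_of_notMem h, inner_zero_right, mul_zero, neg_zero]
  have e2 : ∀ᵐ w : hyperplane e, ∀ k : ℕ, Integrable fun t => G k (w, t) :=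
    ae_all_iff.2 fun k => (hGi k).prod_right_ae
  have e3 : Tendsto (fun k : ℕ => ∫ w, ∫ t, G k (w, t)) atTop
      (𝓝 (∫ w, ⟪normalVec e φ w, ub w⟫)) := by
    refine tendsto_integral_of_dominated_convergence (B.indicator fun _ => C')
      (fun k => (hGi k).integral_prod_left.aestronglyMeasurable)
      ((integrable_indicator_iff measurableSet_closedBall).2
          (integrableOn_const (measure_closedBall_lt_top.ne))) (fun k => ?_) ?_
    · refine .of_forall fun w => ?_
      have h1 : ∫ t, G k (w, t) = ∫ t in Ioo (1 / (k : ℝ)) (2 / k), (k : ℝ) * g (w, t) := by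
        rw [← integral_indicator measurableSet_Ioo]
        refine integral_congr_ae (.of_forall fun t => ?_)
        simp only [G, indicator_apply]
        split_ifs <;> simp
      rw [h1]
      refine (norm_setIntegral_le_of_norm_le_const (C := k * B.indicator (fun _ => C') w)
        measure_Ioo_lt_top fun t _ => ?_).trans ?_
      · rw [norm_mul, Real.norm_natCast]
        exact mul_le_mul_of_nonneg_left (hgB (w, t)) (by positivity)
      · have h0 : 0 ≤ B.indicator (fun _ => C') w := indicator_nonneg (fun _ _ => hC') _
        rw [Real.volume_real_Ioo_of_le (by gcongr; norm_num)]
        -- For k = 0 the convention 1/0 = 0 makes the layer empty.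
        rcases Nat.eq_zero_or_pos k with rfl | hk
        · simpa using h0
        · have : (k : ℝ) ≠ 0 := by positivity
          apply le_of_eq; field_simp; ring
    · filter_upwards [e2] with w hw
      set c := ⟪normalVec e φ w, ub w⟫
      have hgc : Tendsto (fun t : ℝ => g (w, t)) (𝓝[>] 0) (𝓝 c) := by
        have h1 : Tendsto (fun t : ℝ => shear e φ (w, t)) (𝓝[>] 0) (𝓝[D] graphMap e φ w) := by
          refine tendsto_nhdsWithin_iff.2 ⟨?_, ?_⟩
          · rw [← shear_zero]
            exact (((continuous_shear hφ).comp
              (by fun_prop : Continuous fun t : ℝ => (w, t))).tendsto 0).mono_left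
                nhdsWithin_le_nhds
          · filter_upwards [self_mem_nhdsWithin] with t ht
            rw [mem_subgraph_iff, depth_shear he]; exact ht
        refine ((tendsto_const_nhds (x := normalVec e φ w)).inner ((hlim w).comp h1)).congr' ?_
        filter_upwards [self_mem_nhdsWithin] with t ht
        have : shear e φ (w, t) ∈ D := by rw [mem_subgraph_iff, depth_shear he]; exact ht
        simp only [g, indicator_of_mem this, Function.comp]
      rw [Metric.tendsto_atTop]
      intro ε hε
      obtain ⟨η, hη, hball⟩ := Metric.mem_nhdsWithin_iff.1
        (hgc.eventually (Metric.closedBall_mem_nhds c (half_pos hε)))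
      -- Depths in the k-th layer are below 2/k, hence below η for k > N.
      obtain ⟨N, hN⟩ := exists_nat_gt (2 / η)
      refine ⟨N + 1, fun k hk => ?_⟩
      have hk0 : (0 : ℝ) < k := by
        have : 0 < k := by omega
        exact_mod_cast this
      have hkη : 2 / (k : ℝ) < η := by
        rw [div_lt_comm₀ hk0 hη]
        refine hN.trans ?_
        have : N < k := by omega
        exact_mod_cast this
      have h1 : ∫ t, G k (w, t) - (Ioo (1 / (k : ℝ)) (2 / k)).indicator (fun _ => (k : ℝ) * c) t
          = (∫ t, G k (w, t)) - c := by
        rw [integral_sub (hw k) ((integrable_indicator_iff measurableSet_Ioo).2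
          (integrableOn_const (measure_Ioo_lt_top.ne))), integral_indicator measurableSet_Ioo,
          setIntegral_const, Real.volume_real_Ioo_of_le (by gcongr; norm_num), smul_eq_mul]
        congr 1
        field_simp; ring
      have h2 : ∀ t, G k (w, t) - (Ioo (1 / (k : ℝ)) (2 / k)).indicator (fun _ => (k : ℝ) * c) t
          = (Ioo (1 / (k : ℝ)) (2 / k)).indicator (fun t => (k : ℝ) * (g (w, t) - c)) t := by
        intro t
        simp only [G, indicator_apply]
        split_ifs <;> ring
      simp_rw [h2] at h1
      rw [dist_eq_norm, ← h1, integral_indicator measurableSet_Ioo]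
      refine (norm_setIntegral_le_of_norm_le_const (C := k * (ε / 2))
        measure_Ioo_lt_top fun t ht => ?_).trans_lt ?_
      · rw [norm_mul, Real.norm_natCast]
        refine mul_le_mul_of_nonneg_left ?_ hk0.le
        have h3 : 0 < t := lt_trans (by positivity) ht.1
        have : t ∈ Metric.ball 0 η ∩ Ioi 0 := by
          refine ⟨?_, h3⟩
          rw [Metric.mem_ball, dist_zero_right, Real.norm_of_nonneg h3.le]
          exact ht.2.trans hkη
        simpa [dist_eq_norm] using hball this
      · rw [Real.volume_real_Ioo_of_le (by gcongr; norm_num)]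
        have : (k : ℝ) * (ε / 2) * (2 / k - 1 / k) = ε / 2 := by field_simp; ring
        rw [this]; linarith
  refine e3.neg.congr' ?_
  filter_upwards [eventually_gt_atTop 0] with k hk
  exact (e1 k hk).symm

theorem aestronglyMeasurable_fderiv_apply {μ : Measure (Eu n)} (δ : Eu n → ℝ) {q : Eu n → Eu n}
    (hq : AEStronglyMeasurable q μ) : AEStronglyMeasurable (fun z => fderiv ℝ δ z (q z)) μ :=
  (isBoundedBilinearMap_apply (𝕜 := ℝ) (E := Eu n) (F := ℝ)).continuous.comp_aestronglyMeasurable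
    ((measurable_fderiv ℝ δ).aestronglyMeasurable.prodMk hq)

theorem integrableOn_pairing {A : Set (Eu n)} (hA : MeasurableSet A) {q : Eu n → Eu n}
    {f δ : Eu n → ℝ} {C : ℝ} (hqm : AEStronglyMeasurable q (volume.restrict A))
    (hfm : AEStronglyMeasurable f (volume.restrict A)) (hqb : ∀ z ∈ A, ‖q z‖ ≤ C)
    (hfb : ∀ z ∈ A, |f z| ≤ C) (hδ : ∃ L, LipschitzWith L δ) (hc : HasCompactSupport δ) :
    IntegrableOn (fun z => f z * δ z) A ∧ IntegrableOn (fun z => fderiv ℝ δ z (q z)) A := by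
  obtain ⟨L, hL⟩ := hδ
  obtain ⟨a, ha⟩ := exists_bound_of_hasCompactSupport hL.continuous hc
  have hT : MeasurableSet (tsupport δ) := (isClosed_tsupport δ).measurableSet
  have hi : ∀ c : ℝ, IntegrableOn ((tsupport δ).indicator fun _ => c) A := fun c =>
    ((integrable_indicator_iff hT).2 (integrableOn_const hc.measure_lt_top.ne)).integrableOn
  constructor
  · refine (hi (C * a)).mono' (hfm.mul hL.continuous.aestronglyMeasurable) ?_
    filter_upwards [ae_restrict_mem hA] with z hz
    by_cases h : z ∈ tsupport δ
    · rw [indicator_of_mem h, norm_mul]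
      exact mul_le_mul (hfb z hz) (ha z) (norm_nonneg _) ((abs_nonneg _).trans (hfb z hz))
    · rw [indicator_of_notMem h, image_eq_zero_of_notMem_tsupport h]; simp
  · refine (hi (L * C)).mono' (aestronglyMeasurable_fderiv_apply δ hqm) ?_
    filter_upwards [ae_restrict_mem hA] with z hz
    by_cases h : z ∈ tsupport δ
    · rw [indicator_of_mem h]
      refine (ContinuousLinearMap.le_opNorm _ _).trans ?_
      exact mul_le_mul (norm_fderiv_le_of_lipschitz ℝ hL) (hqb z hz) (norm_nonneg _) L.2
    · rw [indicator_of_notMem h, fderiv_of_notMem_tsupport ℝ h]; simp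

/-- Gauss's theorem below a Lipschitz graph, for a bounded vector field `q` with distributional
divergence `f` and with boundary values `qb`. -/
theorem gauss_subgraph (he : ‖e‖ = 1) (hφ : LipschitzWith K φ) {V : Set (Eu n)} (hV : IsOpen V)
    {q qb : Eu n → Eu n} {f : Eu n → ℝ} {C : ℝ}
    (hqm : AEStronglyMeasurable q (volume.restrict (V ∩ subgraph e φ)))
    (hfm : AEStronglyMeasurable f (volume.restrict (V ∩ subgraph e φ)))
    (hqC : ∀ z ∈ V ∩ subgraph e φ, ‖q z‖ ≤ C) (hfC : ∀ z ∈ V ∩ subgraph e φ, |f z| ≤ C)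
    (hlim : ∀ x ∈ V, depth e φ x = 0 → Tendsto q (𝓝[subgraph e φ] x) (𝓝 (qb x)))
    (hweak : ∀ δ, IsTest (V ∩ subgraph e φ) δ →
      ∫ z in V ∩ subgraph e φ, (f z * δ z + fderiv ℝ δ z (q z)) = 0)
    {δ : Eu n → ℝ} (hδ : IsTest V δ) :
    ∫ z in V ∩ subgraph e φ, (f z * δ z + fderiv ℝ δ z (q z))
      = ∫ x in {z | depth e φ z = 0}, δ x * ⟪qb x, outerNormal (subgraph e φ) x⟫ ∂μHE[n - 1] := by
  set D := subgraph e φ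
  have hDo : IsOpen D := isOpen_subgraph he hφ
  have hVD : MeasurableSet (V ∩ D) := (hV.inter hDo).measurableSet
  obtain ⟨L, hL⟩ := hδ.lipschitz
  obtain ⟨a, ha⟩ := exists_bound_of_hasCompactSupport hL.continuous hδ.compact
  have hδ0 : ∀ z, z ∉ V → δ z = 0 := fun z hz =>
    image_eq_zero_of_notMem_tsupport fun h => hz (hδ.subset h)
  obtain ⟨hi1, hi2⟩ := integrableOn_pairing hVD hqm hfm hqC hfC hδ.lipschitz hδ.compact
  have hF : IntegrableOn (fun z => f z * δ z + fderiv ℝ δ z (q z)) (V ∩ D) := hi1.add hi2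
  have hcut : ∀ k : ℕ, 0 < k → IsTest (V ∩ D) (fun z => δ z * layerCut e φ k z) := fun k hk =>
    hδ.mul (lipschitz_layerCut he hφ k) (b := 1) (fun x => by simpa using abs_layerCut_le k x)
      (tsupport_layerCut_subset he hφ (by exact_mod_cast hk))
  -- The function δ `layerCut` vanishes near the graph, so it is admissible in `hweak`. The product
  -- rule isolates the term that carries the gradient of the cutoff.
  have hsplit : ∀ k : ℕ, 0 < k →
      ∫ z in V ∩ D, layerCut e φ k z * (f z * δ z + fderiv ℝ δ z (q z))
        = - ∫ z in D, fderiv ℝ (layerCut e φ k) z (δ z • q z) := fun k hk => by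
    obtain ⟨M, hM⟩ := lipschitz_layerCut he hφ k
    have hw := hweak _ (hcut k hk)
    have j1 : IntegrableOn (fun z => layerCut e φ k z * (f z * δ z + fderiv ℝ δ z (q z)))
        (V ∩ D) := by
      refine hF.bdd_mul (c := 1) hM.continuous.aestronglyMeasurable (.of_forall fun z => ?_)
      exact abs_layerCut_le k z
    have j2 : IntegrableOn (fun z => fderiv ℝ (layerCut e φ k) z (δ z • q z)) (V ∩ D) := by
      have hT : MeasurableSet (tsupport δ) := (isClosed_tsupport δ).measurableSet
      have hi : IntegrableOn ((tsupport δ).indicator fun _ => (M : ℝ) * (a * C)) (V ∩ D) :=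
        ((integrable_indicator_iff hT).2
          (integrableOn_const hδ.compact.measure_lt_top.ne)).integrableOn
      refine hi.mono' (aestronglyMeasurable_fderiv_apply _
        (hL.continuous.aestronglyMeasurable.smul hqm)) ?_
      filter_upwards [ae_restrict_mem hVD] with z hz
      by_cases h : z ∈ tsupport δ
      · rw [indicator_of_mem h]
        refine (ContinuousLinearMap.le_opNorm _ _).trans ?_
        refine mul_le_mul (norm_fderiv_le_of_lipschitz ℝ hM) ?_ (norm_nonneg _) M.2
        rw [norm_smul]
        exact mul_le_mul (ha z) (hqC z hz) (norm_nonneg _) a.2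
      · rw [indicator_of_notMem h, image_eq_zero_of_notMem_tsupport h]; simp
    have j3 : ∫ z in V ∩ D, (f z * (δ z * layerCut e φ k z)
        + fderiv ℝ (fun z => δ z * layerCut e φ k z) z (q z))
        = ∫ z in V ∩ D, (layerCut e φ k z * (f z * δ z + fderiv ℝ δ z (q z))
          + fderiv ℝ (layerCut e φ k) z (δ z • q z)) := by
      refine integral_congr_ae (ae_restrict_of_ae ?_)
      filter_upwards [hL.ae_differentiableAt, hM.ae_differentiableAt] with z h1 h2
      rw [fderiv_fun_mul h1 h2]
      simp only [add_apply, smul_apply, map_smul, smul_eq_mul]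
      ring
    rw [j3, integral_add j1 j2] at hw
    rw [eq_neg_of_add_eq_zero_left hw]
    congr 1
    refine (setIntegral_eq_of_subset_of_forall_sdiff_eq_zero hDo.measurableSet inter_subset_right
      fun z hz => ?_).symm
    have : z ∉ V := fun h => hz.2 ⟨h, hz.1⟩
    rw [hδ0 z this, zero_smul, map_zero]
  have lim1 : Tendsto (fun k : ℕ =>
      ∫ z in V ∩ D, layerCut e φ k z * (f z * δ z + fderiv ℝ δ z (q z))) atTop
      (𝓝 (∫ z in V ∩ D, (f z * δ z + fderiv ℝ δ z (q z)))) := by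
    refine tendsto_integral_of_dominated_convergence
      (fun z => ‖f z * δ z + fderiv ℝ δ z (q z)‖) (fun k => ?_) hF.norm (fun k => ?_) ?_
    · obtain ⟨M, hM⟩ := lipschitz_layerCut he hφ k
      exact hM.continuous.aestronglyMeasurable.mul hF.aestronglyMeasurable
    · refine .of_forall fun z => ?_
      rw [norm_mul]
      exact mul_le_of_le_one_left (norm_nonneg _) (abs_layerCut_le _ z)
    · filter_upwards [ae_restrict_mem hVD] with z hz
      have hd : 0 < depth e φ z := mem_subgraph_iff.1 hz.2
      refine tendsto_const_nhds.congr' ?_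
      obtain ⟨N, hN⟩ := exists_nat_gt (2 / depth e φ z)
      filter_upwards [eventually_ge_atTop N] with k hk
      rw [layerCut_eq_one, one_mul]
      rw [div_lt_iff₀ hd] at hN
      have : (N : ℝ) ≤ k := by exact_mod_cast hk
      nlinarith
  obtain ⟨R, hR⟩ := hδ.compact.isBounded.exists_norm_le
  have lim2 := layer_limit he hφ (u := fun z => δ z • q z) (C := a * |C|) (R := R)
    (ub := fun w => δ (graphMap e φ w) • qb (graphMap e φ w)) ?_ ?_ ?_ ?_
  · have := tendsto_nhds_unique lim1 (lim2.neg.congr' (by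
      filter_upwards [eventually_gt_atTop 0] with k hk using (hsplit k hk).symm))
    rw [this, neg_neg, integral_graph he hφ]
    -- The area element of the surface measure cancels the normalisation of the unit normal.
    apply integral_congr_ae
    filter_upwards [ae_hasFDerivAt_restrict hφ] with w hw
    have hJ := one_le_areaElement (φ := φ) w
    rw [(isOuterUnitNormal_subgraph he hw).outerNormal_eq, inner_smul_right, inner_smul_right,
      real_inner_comm (normalVec e φ w)]
    field_simp
  · have h1 : (fun z => δ z • q z) = V.indicator (fun z => δ z • q z) := by
      ext1 z
      by_cases h : z ∈ V
      · rw [indicator_of_mem h]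
      · rw [indicator_of_notMem h, hδ0 z h, zero_smul]
    rw [h1, aestronglyMeasurable_indicator_iff hV.measurableSet,
      Measure.restrict_restrict hV.measurableSet]
    exact hL.continuous.aestronglyMeasurable.smul hqm
  · intro z hz
    rw [norm_smul]
    by_cases h : z ∈ V
    · exact mul_le_mul (ha z) ((hqC z ⟨h, hz⟩).trans (le_abs_self C)) (norm_nonneg _) a.2
    · rw [hδ0 z h, norm_zero, zero_mul]; positivity
  · intro z hz
    rw [image_eq_zero_of_notMem_tsupport fun h => hz.not_ge (hR z h), zero_smul]
  · intro w
    by_cases h : graphMap e φ w ∈ V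
    · exact ((hL.continuous.tendsto _).mono_left nhdsWithin_le_nhds).smul
        (hlim _ h (depth_graphMap he w))
    · have h0 : graphMap e φ w ∉ tsupport δ := fun h' => h (hδ.subset h')
      rw [hδ0 _ h, zero_smul]
      refine tendsto_const_nhds.congr' (EventuallyEq.filter_mono ?_ nhdsWithin_le_nhds)
      filter_upwards [(isClosed_tsupport δ).isOpen_compl.mem_nhds h0] with z hz
      rw [image_eq_zero_of_notMem_tsupport hz, zero_smul]

end LocalGauss

/-! ### Cutoff functions near compact sets of zero area -/

section Cutoff

/-- A null set has covers with small Σ diam^d. Each covering set is replaced by a slightly larger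
open ball centred on E, and compactness leaves finitely many. -/
theorem exists_finite_cover_of_null {X : Type*} [MetricSpace X] [MeasurableSpace X] [BorelSpace X]
    {d : ℕ} [Nonempty X] {E : Set X} (hE : IsCompact E) (h0 : μHE[d] E = 0)
    {η : ℝ} (hη : 0 < η) :
    ∃ (s : Finset ℕ) (x : ℕ → X) (ρ : ℕ → ℝ), (∀ i ∈ s, 0 < ρ i ∧ ρ i ≤ η ∧ x i ∈ E) ∧
      E ⊆ ⋃ i ∈ s, Metric.ball (x i) (ρ i) ∧ ∑ i ∈ s, ρ i ^ d ≤ η := by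
  have h1 : μH[d] E = 0 := by
    rw [Measure.euclideanHausdorffMeasure_def, Measure.smul_apply, ENNReal.smul_def, smul_eq_mul,
      mul_eq_zero] at h0
    exact h0.resolve_left (by
      simpa using Measure.addHaarScalarFactor_volume_hausdorffMeasure_ne_zero d)
  rcases E.eq_empty_or_nonempty with rfl | hne
  · exact ⟨∅, fun _ => Classical.arbitrary X, fun _ => 0, by simp, by simp, by simpa using hη.le⟩
  -- In dimension zero every nonempty set has Hausdorff measure at least 1.
  have hd : d ≠ 0 := by
    rintro rfl
    have := Measure.one_le_hausdorffMeasure_zero_of_nonempty hne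
    simp only [Nat.cast_zero] at h1
    rw [h1] at this
    simp at this
  -- The constant in (a + b)^d ≤ 2^(d-1) (a^d + b^d).
  set c : ℝ := (2 : ℝ) ^ (d - 1)
  have hc : 0 < c := by positivity
  -- The first bound controls the sum of the ρ^d, the second keeps the radii, at most 2θ, below η,
  -- and the third gives ε_i ≤ 1, so that ε_i^d ≤ ε_i.
  set θ : ℝ := min (η / (4 * c)) (min (η / 4) (1 / 2))
  have hθ : 0 < θ := by positivity
  have hθ1 : θ ≤ η / (4 * c) := min_le_left _ _
  have hθ2 : θ ≤ η / 4 := (min_le_right _ _).trans (min_le_left _ _)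
  have hθ3 : θ ≤ 1 / 2 := (min_le_right _ _).trans (min_le_right _ _)
  rw [Measure.hausdorffMeasure_apply] at h1
  have h2 := le_of_le_of_eq (le_iSup₂ (f := fun (r : ℝ≥0∞) (_ : 0 < r) =>
    ⨅ (t : ℕ → Set X) (_ : E ⊆ ⋃ n, t n) (_ : ∀ n, Metric.ediam (t n) ≤ r),
      ∑' n, ⨆ _ : (t n).Nonempty, Metric.ediam (t n) ^ (d : ℝ)) (ENNReal.ofReal θ)
      (ENNReal.ofReal_pos.2 hθ)) h1
  have h3 := lt_of_le_of_lt h2 (ENNReal.ofReal_pos.2 hθ)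
  simp only [iInf_lt_iff] at h3
  obtain ⟨t, ht1, ht2, ht3⟩ := h3
  obtain ⟨ε, hε, a, ha, haθ⟩ := NNReal.exists_pos_sum_of_countable
    (ε := ⟨θ, hθ.le⟩) (fun h => hθ.ne' (congrArg NNReal.toReal h)) ℕ
  have hx : ∀ i, ∃ x ∈ E, (t i ∩ E).Nonempty → x ∈ t i := fun i => by
    by_cases h : (t i ∩ E).Nonempty
    · exact ⟨h.some, h.some_mem.2, fun _ => h.some_mem.1⟩
    · exact ⟨hne.some, hne.some_mem, fun h' => absurd h' h⟩
  choose x hxE hxt using hx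
  have hfin : ∀ i, Metric.ediam (t i) ≠ ⊤ := fun i => ((ht2 i).trans_lt ENNReal.ofReal_lt_top).ne
  set D : ℕ → ℝ := fun i => (Metric.ediam (t i)).toReal
  have hD0 : ∀ i, 0 ≤ D i := fun i => ENNReal.toReal_nonneg
  have hDθ : ∀ i, D i ≤ θ := fun i => ENNReal.toReal_le_of_le_ofReal hθ.le (ht2 i)
  -- The summable positive slack ε_i lets the open ball contain the whole part of E in t i, even
  -- when the diameter is 0.
  set ρ : ℕ → ℝ := fun i => D i + ε i
  have hεθ : ∀ s : Finset ℕ, ∑ i ∈ s, (ε i : ℝ) ≤ θ := fun s => by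
    have h := (sum_le_hasSum s (fun i _ => zero_le) ha).trans haθ.le
    have h' : ((∑ i ∈ s, ε i : ℝ≥0) : ℝ) ≤ θ := h
    simpa using h'
  have hεθ1 : ∀ i, (ε i : ℝ) ≤ θ := fun i => by simpa using hεθ {i}
  have hρ : ∀ i, 0 < ρ i := fun i => add_pos_of_nonneg_of_pos (hD0 i) (hε i)
  have hcover : E ⊆ ⋃ i, Metric.ball (x i) (ρ i) := fun z hz => by
    obtain ⟨i, hi⟩ := mem_iUnion.1 (ht1 hz)
    refine mem_iUnion.2 ⟨i, ?_⟩
    rw [Metric.mem_ball, dist_edist]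
    have : (edist z (x i)).toReal ≤ D i := ENNReal.toReal_mono (hfin i)
      (Metric.edist_le_ediam_of_mem hi (hxt i ⟨z, hi, hz⟩))
    exact this.trans_lt (lt_add_of_pos_right _ (hε i))
  obtain ⟨s, hs⟩ := hE.elim_finite_subcover _ (fun i => Metric.isOpen_ball) hcover
  have hnt : ∀ i, D i ≠ 0 → (t i).Nonempty := fun i h => by
    by_contra h'
    rw [not_nonempty_iff_eq_empty] at h'
    simp [D, h'] at h
  have hsum : ∑ i ∈ s, D i ^ d ≤ θ := by
    have h4 : ∑ i ∈ s, ENNReal.ofReal (D i ^ d) ≤ ENNReal.ofReal θ := by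
      refine le_trans (Finset.sum_le_sum fun i _ => ?_) ((ENNReal.sum_le_tsum s).trans ht3.le)
      by_cases h : D i = 0
      · simp [h, hd]
      · simp only [hnt i h, iSup_pos, ENNReal.rpow_natCast, D]
        rw [ENNReal.ofReal_pow ENNReal.toReal_nonneg, ENNReal.ofReal_toReal (hfin i)]
    rw [← ENNReal.ofReal_sum_of_nonneg (fun i _ => pow_nonneg (hD0 i) d)] at h4
    exact (ENNReal.ofReal_le_ofReal_iff hθ.le).1 h4
  refine ⟨s, x, ρ, fun i _ => ⟨hρ i, ?_, hxE i⟩, hs, ?_⟩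
  · have h5 := hDθ i
    have h6 := hεθ1 i
    simp only [ρ]
    linarith
  · calc ∑ i ∈ s, ρ i ^ d ≤ ∑ i ∈ s, c * (D i ^ d + ε i) := by
          refine Finset.sum_le_sum fun i _ => (add_pow_le (hD0 i) (ε i).2 d).trans ?_
          refine mul_le_mul_of_nonneg_left ?_ hc.le
          have h7 : ((ε i : ℝ)) ^ d ≤ ε i :=
            pow_le_of_le_one (ε i).2 ((hεθ1 i).trans (by linarith)) hd
          have h8 : ((ε i).1 : ℝ) = (ε i : ℝ) := rfl
          rw [h8]
          linarith
      _ = c * (∑ i ∈ s, D i ^ d + ∑ i ∈ s, (ε i : ℝ)) := by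
          rw [← Finset.sum_add_distrib, Finset.mul_sum]
      _ ≤ c * (η / (4 * c) + η / (4 * c)) := by
          refine mul_le_mul_of_nonneg_left ?_ hc.le
          linarith [hεθ s]
      _ = η / 2 := by field_simp; ring
      _ ≤ η := by linarith

variable {n : ℕ}

/-- A function vanishing on `ball x r` and equal to `1` outside `closedBall x (2 * r)`. -/
def ballCut (x : Eu n) (r : ℝ) (z : Eu n) : ℝ := max 0 (min 1 (dist z x / r - 1))

theorem ballCut_eq_zero {x z : Eu n} {r : ℝ} (hr : 0 < r) (h : dist z x ≤ r) :
    ballCut x r z = 0 := by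
  rw [ballCut, max_eq_left]
  refine (min_le_right _ _).trans ?_
  rw [sub_nonpos]; exact (div_le_one hr).2 h

theorem ballCut_eq_one {x z : Eu n} {r : ℝ} (hr : 0 < r) (h : 2 * r ≤ dist z x) :
    ballCut x r z = 1 := by
  have : 2 ≤ dist z x / r := (le_div_iff₀ hr).2 h
  rw [ballCut, min_eq_left (by linarith), max_eq_right zero_le_one]

theorem ballCut_mem (x z : Eu n) (r : ℝ) : ballCut x r z ∈ Icc (0 : ℝ) 1 :=
  ⟨le_max_left _ _, max_le zero_le_one (min_le_left _ _)⟩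

theorem lipschitzWith_ballCut (x : Eu n) {r : ℝ≥0} (hr : 0 < r) :
    LipschitzWith r⁻¹ (ballCut x r) := by
  have h1 : LipschitzWith r⁻¹ (fun z => dist z x / r - 1) := by
    apply LipschitzWith.of_dist_le_mul
    intro y z
    have hr' : (0 : ℝ) < r := by exact_mod_cast hr
    rw [Real.dist_eq, sub_sub_sub_cancel_right, ← sub_div, abs_div, abs_of_pos hr']
    push_cast
    rw [div_eq_inv_mul]
    gcongr
    exact abs_dist_sub_le _ _ _
  exact (h1.const_min 1).const_max 0

/-- The gradient is at most 1/r and lives on a ball of radius 2r and volume of order r^n, so its L¹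
norm is of order r^(n-1), the scale of area. -/
theorem lintegral_fderiv_ballCut_le (x : Eu n) {r : ℝ≥0} (hr : 0 < r) (hn : 1 ≤ n) :
    ∫⁻ z, ENNReal.ofReal ‖fderiv ℝ (ballCut x r) z‖
      ≤ 2 ^ n * volume (Metric.ball (0 : Eu n) 1) * ENNReal.ofReal ((r : ℝ) ^ (n - 1)) := by
  have h1 : ∀ z, ENNReal.ofReal ‖fderiv ℝ (ballCut x r) z‖
      ≤ (Metric.closedBall x (2 * r)).indicator (fun _ => ENNReal.ofReal (r : ℝ)⁻¹) z := fun z => by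
    by_cases h : z ∈ Metric.closedBall x (2 * r)
    · rw [indicator_of_mem h]
      refine ENNReal.ofReal_le_ofReal ?_
      simpa using norm_fderiv_le_of_lipschitz ℝ (lipschitzWith_ballCut x hr)
    · rw [indicator_of_notMem h]
      have h2 : ballCut x r =ᶠ[𝓝 z] fun _ => 1 := by
        filter_upwards [Metric.isClosed_closedBall.isOpen_compl.mem_nhds h] with y hy
        exact ballCut_eq_one (by exact_mod_cast hr) (by
          simpa using (not_le.1 (fun h' => hy (Metric.mem_closedBall.2 h'))).le)
      rw [h2.fderiv_eq]; simp
  refine (lintegral_mono h1).trans ?_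
  rw [lintegral_indicator_const measurableSet_closedBall,
    Measure.addHaar_closedBall volume x (by positivity), finrank_euclideanSpace_fin,
    mul_comm _ (volume _), ← mul_assoc, mul_comm _ (volume _), mul_assoc, mul_comm (2 ^ n),
    mul_assoc]
  refine mul_le_mul_right ?_ _
  rw [← ENNReal.ofReal_mul (by positivity)]
  have : ((r : ℝ)⁻¹ * (2 * r) ^ n) = 2 ^ n * r ^ (n - 1) := by
    have h3 : (r : ℝ) ≠ 0 := by exact_mod_cast hr.ne'
    obtain ⟨k, rfl⟩ := Nat.exists_eq_add_of_le' hn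
    simp only [Nat.add_sub_cancel]
    rw [inv_mul_eq_div, div_eq_iff h3]
    ring
  rw [this, ENNReal.ofReal_mul (by positivity), ENNReal.ofReal_pow (by norm_num)]
  simp

/-- Take the product of the cutoffs of the single balls. All factors are bounded by 1, so the
product rule makes the L¹ norms of the gradients subadditive. -/
theorem exists_cutoff_finset {ι : Type*} (hn : 1 ≤ n) (s : Finset ι) (x : ι → Eu n) (ρ : ι → ℝ)
    (hρ : ∀ i ∈ s, 0 < ρ i) :
    ∃ χ : Eu n → ℝ, (∃ L, LipschitzWith L χ) ∧ (∀ z, χ z ∈ Icc (0 : ℝ) 1) ∧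
      (∀ i ∈ s, ∀ z ∈ Metric.ball (x i) (ρ i), χ z = 0) ∧
      (∀ z, (∀ i ∈ s, 2 * ρ i ≤ dist z (x i)) → χ z = 1) ∧
      ∫⁻ z, ENNReal.ofReal ‖fderiv ℝ χ z‖ ≤ 2 ^ n * volume (Metric.ball (0 : Eu n) 1)
        * ENNReal.ofReal (∑ i ∈ s, ρ i ^ (n - 1)) := by
  classical
  induction s using Finset.induction_on with
  | empty =>
    exact ⟨fun _ => 1, ⟨0, LipschitzWith.const _⟩, by simp, by simp, by simp, by simp⟩
  | insert i s his ih =>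
    obtain ⟨χ, ⟨L, hL⟩, h1, h2, h3, h4⟩ := ih fun j hj => hρ j (Finset.mem_insert_of_mem hj)
    have hi : 0 < ρ i := hρ i (Finset.mem_insert_self _ _)
    obtain ⟨r, hr⟩ : ∃ r : ℝ≥0, (r : ℝ) = ρ i := ⟨⟨ρ i, hi.le⟩, rfl⟩
    have hr0 : 0 < r := by rw [← NNReal.coe_pos, hr]; exact hi
    have hb := lipschitzWith_ballCut (x i) hr0
    have habs : ∀ a ∈ Icc (0 : ℝ) 1, |a| ≤ ((1 : ℝ≥0) : ℝ) := fun a ha => by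
      rw [abs_of_nonneg ha.1]; simpa using ha.2
    refine ⟨fun z => χ z * ballCut (x i) r z, ⟨_, lipschitzWith_mul hL hb
      (fun z => habs _ (h1 z)) (fun z => habs _ (ballCut_mem _ z _))⟩, fun z => ?_, ?_, ?_, ?_⟩
    · obtain ⟨b1, b2⟩ := ballCut_mem (x i) z r
      exact ⟨mul_nonneg (h1 z).1 b1, mul_le_one₀ (h1 z).2 b1 b2⟩
    · intro j hj z hz
      beta_reduce
      rcases Finset.mem_insert.1 hj with rfl | hj
      · rw [ballCut_eq_zero (by rw [hr]; exact hi) (by rw [hr]; exact (Metric.mem_ball.1 hz).le),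
          mul_zero]
      · rw [h2 j hj z hz, zero_mul]
    · intro z hz
      beta_reduce
      rw [h3 z fun j hj => hz j (Finset.mem_insert_of_mem hj), one_mul,
        ballCut_eq_one (by rw [hr]; exact hi) (by rw [hr]; exact hz i (Finset.mem_insert_self _ _))]
    · have h5 : ∀ᵐ z, ENNReal.ofReal ‖fderiv ℝ (fun z => χ z * ballCut (x i) r z) z‖
          ≤ ENNReal.ofReal ‖fderiv ℝ χ z‖ + ENNReal.ofReal ‖fderiv ℝ (ballCut (x i) r) z‖ := by
        filter_upwards [hL.ae_differentiableAt, hb.ae_differentiableAt] with z d1 d2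
        rw [fderiv_fun_mul d1 d2, add_comm]
        rw [← ENNReal.ofReal_add (norm_nonneg _) (norm_nonneg _)]
        refine ENNReal.ofReal_le_ofReal ((norm_add_le _ _).trans ?_)
        rw [norm_smul, norm_smul]
        exact add_le_add (mul_le_of_le_one_left (norm_nonneg _) (habs _ (ballCut_mem (x i) z r)))
          (mul_le_of_le_one_left (norm_nonneg _) (habs _ (h1 z)))
      refine (lintegral_mono_ae h5).trans ?_
      rw [lintegral_add_left (measurable_fderiv ℝ χ).norm.ennreal_ofReal, Finset.sum_insert his,
        ENNReal.ofReal_add (by positivity) (Finset.sum_nonneg fun j hj =>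
          (pow_nonneg (hρ j (Finset.mem_insert_of_mem hj)).le _)), mul_add, add_comm]
      refine add_le_add ?_ h4
      rw [← hr]
      exact lintegral_fderiv_ballCut_le (x i) hr0 hn

/-- Cutoff functions near a compact set of vanishing area. -/
theorem exists_cutoff (hn : 1 ≤ n) {E : Set (Eu n)} (hE : IsCompact E) (h0 : μHE[n - 1] E = 0) :
    ∃ χ : ℕ → Eu n → ℝ, (∀ k, ∃ L, LipschitzWith L (χ k)) ∧ (∀ k z, χ k z ∈ Icc (0 : ℝ) 1) ∧
      (∀ k, tsupport (χ k) ⊆ Eᶜ) ∧ (∀ z ∉ E, ∀ᶠ k in atTop, χ k z = 1) ∧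
      Tendsto (fun k => ∫⁻ z, ENNReal.ofReal ‖fderiv ℝ (χ k) z‖) atTop (𝓝 0) := by
  have hη : ∀ k : ℕ, (0 : ℝ) < 1 / (k + 1) := fun k => by positivity
  choose s x ρ h1 h2 h3 using fun k => exists_finite_cover_of_null hE h0 (hη k)
  choose χ c1 c2 c3 c4 c5 using fun k =>
    exists_cutoff_finset hn (s k) (x k) (ρ k) fun i hi => (h1 k i hi).1
  have hlim := tendsto_one_div_add_atTop_nhds_zero_nat (𝕜 := ℝ)
  refine ⟨χ, c1, c2, fun k z hz hzE => ?_, fun z hz => ?_, ?_⟩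
  · obtain ⟨i, hi, hzi⟩ := mem_iUnion₂.1 (h2 k hzE)
    refine (notMem_tsupport_iff_eventuallyEq.2 ?_) hz
    filter_upwards [Metric.isOpen_ball.mem_nhds hzi] with y hy using c3 k i hi y hy
  -- The centres lie on E, at distance at least r from z, so radii below r/2 place z outside all the
  -- doubled balls.
  · obtain ⟨r, hr, hball⟩ := Metric.isOpen_iff.1 hE.isClosed.isOpen_compl z hz
    filter_upwards [hlim.eventually (gt_mem_nhds (half_pos hr))] with k hk
    refine c4 k z fun i hi => ?_
    obtain ⟨p1, p2, p3⟩ := h1 k i hi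
    have : r ≤ dist z (x k i) := by
      by_contra h
      exact hball (show x k i ∈ Metric.ball z r by
        rw [Metric.mem_ball, dist_comm]; exact not_le.1 h) p3
    linarith
  · have hfin : (2 : ℝ≥0∞) ^ n * volume (Metric.ball (0 : Eu n) 1) ≠ ⊤ :=
      ENNReal.mul_ne_top (by simp) measure_ball_lt_top.ne
    have h6 : Tendsto (fun k : ℕ => 2 ^ n * volume (Metric.ball (0 : Eu n) 1)
        * ENNReal.ofReal (1 / ((k : ℝ) + 1))) atTop (𝓝 0) := by
      have := ENNReal.Tendsto.const_mul (a := 2 ^ n * volume (Metric.ball (0 : Eu n) 1))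
        (ENNReal.tendsto_ofReal hlim) (Or.inr hfin)
      simpa using this
    refine tendsto_of_tendsto_of_tendsto_of_le_of_le tendsto_const_nhds h6 (fun k => zero_le)
      fun k => (c5 k).trans ?_
    gcongr
    exact h3 k

end Cutoff

/-! ### C¹ hypersurfaces as Lipschitz graphs -/

section Charts

variable {n : ℕ} {e : Eu n} {φ : Eu n → ℝ} {K : ℝ≥0}

theorem norm_hproj_sq (he : ‖e‖ = 1) (z : Eu n) : ‖hproj he z‖ ^ 2 = ‖z‖ ^ 2 - ⟪e, z⟫ ^ 2 := by
  rw [Submodule.coe_norm, coe_hproj, norm_sub_sq_real, inner_smul_right, norm_smul, he,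
    real_inner_comm z e, mul_one, Real.norm_eq_abs, sq_abs]
  ring

theorem depth_neg (z : Eu n) : depth (-e) (fun x => -φ x) z = -depth e φ z := by
  simp only [depth, inner_neg_left, smul_neg, neg_smul, neg_neg]
  ring

theorem volume_depth_eq_zero (he : ‖e‖ = 1) (hφ : LipschitzWith K φ) :
    volume {z | depth e φ z = 0} = 0 := by
  have hm : MeasurableSet {z | depth e φ z = 0} :=
    (isClosed_eq (lipschitzWith_depth he hφ).continuous continuous_const).measurableSet
  rw [← (measurePreserving_shear he hφ).measure_preimage hm.nullMeasurableSet]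
  have : shear e φ ⁻¹' {z | depth e φ z = 0} = univ ×ˢ {0} := by
    ext p
    simp [depth_shear he]
  rw [this, Measure.prod_prod]
  simp

theorem euclideanHausdorffMeasure_graph_inter_ball_lt_top (he : ‖e‖ = 1) (hφ : LipschitzWith K φ)
    (x : Eu n) (r : ℝ) : μHE[n - 1] ({z | depth e φ z = 0} ∩ Metric.ball x r) < ⊤ := by
  have h1 : {z | depth e φ z = 0} ∩ Metric.ball x r
      ⊆ graphMap e φ '' Metric.ball (hproj he x) r := by
    rintro z ⟨hz, hzx⟩
    refine ⟨hproj he z, ?_, graphMap_hproj he hz⟩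
    rw [Metric.mem_ball, dist_eq_norm, ← map_sub]
    exact (norm_hproj_le he _).trans_lt (by rwa [← dist_eq_norm])
  refine (measure_mono h1).trans_lt ?_
  rw [euclideanHausdorffMeasure_image_graphMap he hφ measurableSet_ball]
  refine (setLIntegral_mono' measurableSet_ball fun w _ =>
    ENNReal.ofReal_le_ofReal (areaElement_le hφ w)).trans_lt ?_
  rw [setLIntegral_const]
  exact ENNReal.mul_lt_top ENNReal.ofReal_lt_top measure_ball_lt_top

/-- The unit normal `∇g / |∇g|` to a level set of `g`. -/
def gradNormal (g : Eu n → ℝ) (x : Eu n) : Eu n := ‖gradient g x‖⁻¹ • gradient g x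

theorem norm_gradient (g : Eu n → ℝ) (x : Eu n) : ‖gradient g x‖ = ‖fderiv ℝ g x‖ := by
  rw [gradient, LinearIsometryEquiv.norm_map]

theorem fderiv_eq_inner_gradNormal {g : Eu n → ℝ} {x : Eu n} (h : fderiv ℝ g x ≠ 0) (v : Eu n) :
    fderiv ℝ g x v = ‖fderiv ℝ g x‖ * ⟪gradNormal g x, v⟫ := by
  rw [gradNormal, real_inner_smul_left, norm_gradient, ← mul_assoc,
    mul_inv_cancel₀ (norm_ne_zero_iff.2 h), one_mul, gradient, InnerProductSpace.toDual_symm_apply]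

theorem norm_gradNormal {g : Eu n → ℝ} {x : Eu n} (h : fderiv ℝ g x ≠ 0) :
    ‖gradNormal g x‖ = 1 := by
  rw [gradNormal, norm_smul, norm_inv, norm_norm, norm_gradient,
    inv_mul_cancel₀ (norm_ne_zero_iff.2 h)]

theorem isOuterUnitNormal_gradNormal {g : Eu n → ℝ} {x : Eu n} (hg : DifferentiableAt ℝ g x)
    (h : fderiv ℝ g x ≠ 0) (hx : g x = 0) :
    IsOuterUnitNormal {z | g z < 0} x (gradNormal g x) := by
  have hc : 0 < ‖fderiv ℝ g x‖ := norm_pos_iff.2 h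
  refine ⟨norm_gradNormal h, fun c hc' => ?_⟩
  have h1 := (hasFDerivAt_iff_isLittleO.1 hg.hasFDerivAt).bound (mul_pos hc' hc)
  filter_upwards [h1] with z hz
  rw [hx, sub_zero, fderiv_eq_inner_gradNormal h, Real.norm_eq_abs] at hz
  obtain ⟨h2, h3⟩ := abs_le.1 hz
  refine ⟨fun h4 => ?_, fun h4 => ?_⟩
  · show g z < 0; nlinarith
  · show ¬ g z < 0; rw [not_lt]; nlinarith

/-- A quantitative implicit function theorem. Near x₀ the function g differs from c⟪e, ·⟫ by a small
Lipschitz error; its zero set is therefore a graph of slope at most 1 in the direction e, and g is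
negative below it and positive above. The graph function comes from the zero set by Lipschitz
extension. -/
theorem exists_graph_chart {S V : Set (Eu n)} {g : Eu n → ℝ} (hg : IsLocalDefiningFunction S V g)
    {x₀ : Eu n} (hx₀ : x₀ ∈ S) (hV : x₀ ∈ V) :
    ∃ (r : ℝ) (φ : Eu n → ℝ), 0 < r ∧ LipschitzWith 1 φ ∧ Metric.ball x₀ r ⊆ V ∧
      ∀ z ∈ Metric.ball x₀ r, (g z < 0 ↔ 0 < depth (gradNormal g x₀) φ z) ∧
        (0 < g z ↔ depth (gradNormal g x₀) φ z < 0) := by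
  have hne := hg.fderiv_ne_zero x₀ hV
  set e := gradNormal g x₀
  have he : ‖e‖ = 1 := norm_gradNormal hne
  set c := ‖fderiv ℝ g x₀‖
  have hc : 0 < c := norm_pos_iff.2 hne
  have hs : HasStrictFDerivAt g (fderiv ℝ g x₀) x₀ :=
    (hg.contDiffOn.contDiffAt (hg.isOpen.mem_nhds hV)).hasStrictFDerivAt one_ne_zero
  -- The quarter serves three times: it bounds the slope of the zero set by 1, it gives g a change
  -- of sign between heights ±R/2, and it fixes the sign of g on each side along vertical lines.
  have h1 := hs.isLittleO.bound (show 0 < c / 4 by positivity)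
  have h2 : ∀ᶠ z in 𝓝 x₀, z ∈ V := hg.isOpen.mem_nhds hV
  rw [nhds_prod_eq, Filter.eventually_prod_self_iff'] at h1
  obtain ⟨s, hs0, h1⟩ := h1
  obtain ⟨R, hR, hball⟩ := Metric.mem_nhds_iff.1 (inter_mem hs0 h2)
  have key : ∀ z ∈ Metric.ball x₀ R, ∀ z' ∈ Metric.ball x₀ R,
      |g z - g z' - c * ⟪e, z - z'⟫| ≤ c / 4 * ‖z - z'‖ := fun z hz z' hz' => by
    have := h1 z (hball hz).1 z' (hball hz').1
    rwa [fderiv_eq_inner_gradNormal hne, Real.norm_eq_abs] at this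
  have hVR : Metric.ball x₀ R ⊆ V := fun z hz => (hball hz).2
  have hgc : ContinuousOn g (Metric.ball x₀ R) := hg.contDiffOn.continuousOn.mono hVR
  -- The zero set is a Lipschitz graph over its projection.
  set B := S ∩ Metric.ball x₀ R
  have hLip : ∀ z ∈ B, ∀ z' ∈ B, |⟪e, z⟫ - ⟪e, z'⟫| ≤ ‖hproj he z - hproj he z'‖ := by
    intro z hz z' hz'
    have h3 := key z hz.2 z' hz'.2
    rw [(hg.mem_iff z (hVR hz.2)).1 hz.1, (hg.mem_iff z' (hVR hz'.2)).1 hz'.1, sub_zero, zero_sub,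
      abs_neg, abs_mul, abs_of_pos hc] at h3
    have h4 : |⟪e, z - z'⟫| ≤ ‖z - z'‖ / 4 := by nlinarith
    rw [← inner_sub_right, ← map_sub]
    refine abs_le_of_sq_le_sq ?_ (norm_nonneg _)
    rw [norm_hproj_sq]
    have h5 := sq_le_sq' (by linarith [abs_nonneg ⟪e, z - z'⟫, norm_nonneg (z - z')]) h4
    rw [sq_abs] at h5
    nlinarith [sq_nonneg ‖z - z'‖]
  set T : Set (Eu n) := (fun z => (hproj he z : Eu n)) '' B
  obtain ⟨i, hi⟩ : ∃ i : Eu n → Eu n, ∀ z ∈ B, i (hproj he z : Eu n) = z := by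
    refine ⟨Function.invFunOn (fun z => (hproj he z : Eu n)) B, fun z hz => ?_⟩
    have m := Function.invFunOn_mem (f := fun z => (hproj he z : Eu n)) (s := B) ⟨z, hz, rfl⟩
    have m' := Function.invFunOn_eq (f := fun z => (hproj he z : Eu n)) (s := B) ⟨z, hz, rfl⟩
    set z' := Function.invFunOn (fun z => (hproj he z : Eu n)) B (hproj he z : Eu n)
    have h6 := hLip z' m z hz
    have m'' : hproj he z' = hproj he z := Subtype.ext m'
    rw [m'', sub_self, norm_zero] at h6
    have h7 : ⟪e, z'⟫ = ⟪e, z⟫ := sub_eq_zero.1 (abs_eq_zero.1 (le_antisymm h6 (abs_nonneg _)))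
    have h8 : ((hproj he z' : Eu n)) + ⟪e, z'⟫ • e = (hproj he z : Eu n) + ⟪e, z⟫ • e := by
      rw [m'', h7]
    simpa using h8
  obtain ⟨φ, hφ, hφT⟩ : ∃ φ : Eu n → ℝ, LipschitzWith 1 φ ∧ EqOn (fun w => ⟪e, i w⟫) φ T := by
    refine LipschitzOnWith.extend_real (LipschitzOnWith.of_dist_le_mul ?_)
    rintro _ ⟨z, hz, rfl⟩ _ ⟨z', hz', rfl⟩
    simp only [hi z hz, hi z' hz', NNReal.coe_one, one_mul]
    rw [Real.dist_eq, dist_eq_norm, ← Submodule.coe_sub, ← Submodule.coe_norm]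
    exact hLip z hz z' hz'
  have hφB : ∀ z ∈ B, φ (hproj he z) = ⟪e, z⟫ := fun z hz => by
    rw [← hφT ⟨z, hz, rfl⟩]
    simp only [hi z hz]
  refine ⟨R / 2, φ, half_pos hR, hφ,
    (Metric.ball_subset_ball (half_le_self hR.le)).trans hVR, fun z hz => ?_⟩
  -- Find the point of the surface above or below `z`.
  set w : Eu n := (hproj he (z - x₀) : Eu n)
  have hw : ‖w‖ < R / 2 := by
    rw [← Submodule.coe_norm]
    exact (norm_hproj_le he _).trans_lt (by rwa [← dist_eq_norm])
  have hline : ∀ s ∈ Icc (-(R / 2)) (R / 2), x₀ + (w + s • e) ∈ Metric.ball x₀ R := by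
    intro s hs
    rw [Metric.mem_ball, dist_eq_norm, add_sub_cancel_left]
    refine (norm_add_le _ _).trans_lt ?_
    rw [norm_smul, he, mul_one, Real.norm_eq_abs]
    have := abs_le.2 hs
    linarith
  have hgx : g x₀ = 0 := (hg.mem_iff x₀ hV).1 hx₀
  have hx₀R : x₀ ∈ Metric.ball x₀ R := Metric.mem_ball_self hR
  have hval : ∀ s ∈ Icc (-(R / 2)) (R / 2),
      |g (x₀ + (w + s • e)) - c * s| ≤ c / 4 * (‖w‖ + |s|) := by
    intro s hs
    have h9 := key _ (hline s hs) x₀ hx₀R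
    rw [hgx, sub_zero, add_sub_cancel_left, inner_add_smul he] at h9
    refine h9.trans (mul_le_mul_of_nonneg_left ((norm_add_le _ _).trans ?_) (by positivity))
    rw [norm_smul, he, mul_one, Real.norm_eq_abs]
  -- The intermediate value theorem shows that the vertical line through z meets the zero set, so φ
  -- is there not merely an arbitrary value of the extension.
  obtain ⟨s, hs, hgs⟩ : ∃ s ∈ Icc (-(R / 2)) (R / 2), g (x₀ + (w + s • e)) = 0 := by
    have hcont : ContinuousOn (fun s : ℝ => g (x₀ + (w + s • e))) (Icc (-(R / 2)) (R / 2)) :=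
      hgc.comp (by fun_prop) hline
    have m1 : -(R / 2) ∈ Icc (-(R / 2)) (R / 2) := ⟨le_rfl, by linarith⟩
    have m2 : R / 2 ∈ Icc (-(R / 2)) (R / 2) := ⟨by linarith, le_rfl⟩
    have h10 := (abs_le.1 (hval _ m1)).2
    have h11 := (abs_le.1 (hval _ m2)).1
    rw [abs_neg, abs_of_pos (half_pos hR)] at h10
    rw [abs_of_pos (half_pos hR)] at h11
    exact intermediate_value_Icc (by linarith) hcont ⟨by nlinarith, by nlinarith⟩
  set z' := x₀ + (w + s • e)
  have hz'R := hline s hs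
  have hz'B : z' ∈ B := ⟨(hg.mem_iff _ (hVR hz'R)).2 hgs, hz'R⟩
  have hproj' : hproj he z' = hproj he z := by
    have : z' = x₀ + (w + s • e) := rfl
    rw [this, (hproj he).map_add, hproj_add_smul, ← map_add, add_sub_cancel]
  have hd : depth e φ z = ⟪e, z' - z⟫ := by
    rw [depth_eq he, ← hproj', hφB z' hz'B, inner_sub_right]
  have hzz : z - z' = (-depth e φ z) • e := by
    have h12 : (hproj he (z - z') : Eu n) = 0 := by
      rw [map_sub, hproj', sub_self]; rfl
    rw [coe_hproj, sub_eq_zero] at h12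
    rw [h12, hd, ← inner_neg_right, neg_sub]
  have h13 := key z (Metric.ball_subset_ball (half_le_self hR.le) hz) z' hz'R
  rw [hgs, sub_zero, hzz, inner_smul_right, real_inner_self_eq_norm_sq, norm_smul, he,
    Real.norm_eq_abs, abs_neg] at h13
  obtain ⟨h14, h15⟩ := abs_le.1 h13
  set τ := depth e φ z
  have hcases : (0 < τ → g z < 0) ∧ (τ < 0 → 0 < g z) ∧ (τ = 0 → g z = 0) := by
    refine ⟨fun h => ?_, fun h => ?_, fun h => ?_⟩
    · rw [abs_of_pos h] at h15; nlinarith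
    · rw [abs_of_neg h] at h14; nlinarith
    · rw [h, abs_zero] at h14 h15; linarith
  obtain ⟨q1, q2, q3⟩ := hcases
  refine ⟨⟨fun h => ?_, q1⟩, ⟨fun h => ?_, q2⟩⟩
  · by_contra h'
    rcases (not_lt.1 h').lt_or_eq with h'' | h''
    · linarith [q2 h'']
    · linarith [q3 h'']
  · by_contra h'
    rcases (not_lt.1 h').lt_or_eq with h'' | h''
    · linarith [q1 h'']
    · linarith [q3 h''.symm]

end Charts

/-! ### Reduction of statements about test functions to local ones -/

section Localization

variable {n : ℕ}

theorem IsTest.mono {A B : Set (Eu n)} {δ : Eu n → ℝ} (h : IsTest A δ) (hAB : A ⊆ B) :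
    IsTest B δ := ⟨h.lipschitz, h.compact, h.subset.trans hAB⟩

theorem IsTest.eq_zero {A : Set (Eu n)} {δ : Eu n → ℝ} (h : IsTest A δ) {z : Eu n} (hz : z ∉ A) :
    δ z = 0 ∧ fderiv ℝ δ z = 0 :=
  have : z ∉ tsupport δ := fun h' => hz (h.subset h')
  ⟨image_eq_zero_of_notMem_tsupport this, fderiv_of_notMem_tsupport ℝ this⟩

theorem IsTest.setIntegral_eq {A B B' : Set (Eu n)} {δ : Eu n → ℝ} (h : IsTest A δ)
    {q : Eu n → Eu n} {f : Eu n → ℝ} (hB : MeasurableSet B) (hBB : B' ⊆ B) (hA : A ∩ B ⊆ B') :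
    ∫ z in B, (f z * δ z + fderiv ℝ δ z (q z)) = ∫ z in B', (f z * δ z + fderiv ℝ δ z (q z)) := by
  refine setIntegral_eq_of_subset_of_forall_sdiff_eq_zero hB hBB fun z hz => ?_
  obtain ⟨h1, h2⟩ := h.eq_zero (fun h' => hz.2 (hA ⟨h', hz.1⟩))
  simp [h1, h2]

/-- A property of test functions which is additive and holds locally holds globally. -/
theorem IsTest.induction_local {A : Set (Eu n)} {P : (Eu n → ℝ) → Prop}
    (hzero : P 0)
    (hadd : ∀ δ₁ δ₂, IsTest A δ₁ → IsTest A δ₂ → P δ₁ → P δ₂ → P (fun z => δ₁ z + δ₂ z))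
    (hloc : ∀ x ∈ A, ∃ V, IsOpen V ∧ x ∈ V ∧ ∀ δ, IsTest (A ∩ V) δ → P δ)
    {δ : Eu n → ℝ} (hδ : IsTest A δ) : P δ := by
  choose! V hVo hxV hP using hloc
  have hr : ∀ x ∈ A, ∃ r : ℝ≥0, 0 < r ∧ Metric.closedBall x (2 * r) ⊆ V x := fun x hx => by
    obtain ⟨ε, hε, h⟩ := Metric.nhds_basis_closedBall.mem_iff.1 ((hVo x hx).mem_nhds (hxV x hx))
    refine ⟨(ε / 2).toNNReal, Real.toNNReal_pos.2 (half_pos hε), ?_⟩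
    rwa [Real.coe_toNNReal _ (half_pos hε).le, mul_div_cancel₀ _ two_ne_zero]
  choose! r hr0 hrV using hr
  have key : ∀ (t : Finset (Eu n)), (∀ x ∈ t, x ∈ A) → ∀ δ, IsTest A δ →
      tsupport δ ⊆ ⋃ x ∈ t, Metric.ball x (r x) → P δ := by
    classical
    intro t
    induction t using Finset.induction_on with
    | empty =>
      intro _ δ _ h
      have : δ = 0 := by
        ext z
        exact image_eq_zero_of_notMem_tsupport fun h' => by simpa using h h'
      rwa [this]
    | insert x t hxt ih =>
      intro ht δ hδ hsup
      have hx : x ∈ A := ht x (Finset.mem_insert_self _ _)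
      have hb := lipschitzWith_ballCut x (hr0 x hx)
      have hrx : (0 : ℝ) < r x := by exact_mod_cast hr0 x hx
      -- Split δ with the cutoff of the ball at x: one part is supported in the closed ball of
      -- radius 2r, hence in V x; the other vanishes on the ball of radius r, so its support is
      -- covered by one ball fewer.
      have hb1 : IsTest (A ∩ V x) (fun z => δ z * (1 - ballCut x (r x) z)) := by
        refine hδ.mul (b := 1) ⟨_, (LipschitzWith.const 1).sub hb⟩ (fun z => ?_) ?_
        · obtain ⟨h1, h2⟩ := ballCut_mem x z (r x)
          rw [abs_of_nonneg (by linarith)]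
          simpa using h1
        · refine (closure_minimal (fun z hz => ?_) Metric.isClosed_closedBall).trans (hrV x hx)
          by_contra h
          refine hz ?_
          beta_reduce
          rw [ballCut_eq_one hrx (by simpa using (not_le.1 h).le), sub_self]
      have hb2 : IsTest (A ∩ (Metric.ball x (r x))ᶜ) (fun z => δ z * ballCut x (r x) z) := by
        refine hδ.mul (b := 1) ⟨_, hb⟩ (fun z => ?_) ?_
        · obtain ⟨h1, h2⟩ := ballCut_mem x z (r x)
          rw [abs_of_nonneg h1]
          simpa using h2
        · refine closure_minimal (fun z hz => ?_) Metric.isOpen_ball.isClosed_compl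
          intro h
          exact hz (ballCut_eq_zero hrx (Metric.mem_ball.1 h).le)
      have h3 := hadd _ _ (hb1.mono inter_subset_left) (hb2.mono inter_subset_left)
        (hP x hx _ hb1) (ih (fun y hy => ht y (Finset.mem_insert_of_mem hy)) _
          (hb2.mono inter_subset_left) (fun z hz => ?_))
      · convert h3 using 2 with z
        ring
      · have h4 := hsup (tsupport_mul_subset_left hz)
        simp only [Finset.mem_insert, iUnion_iUnion_eq_or_left, mem_union] at h4
        exact h4.resolve_left (hb2.subset hz).2
  obtain ⟨t, ht, hcov⟩ := hδ.compact.elim_nhds_subcover (fun x => Metric.ball x (r x))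
    (fun x hx => Metric.ball_mem_nhds x (by exact_mod_cast hr0 x (hδ.subset hx)))
  exact key t (fun x hx => hδ.subset (ht x hx)) δ hδ hcov

end Localization

/-! ### Local pictures of the surface and of the boundary -/

section Geometry

variable {n : ℕ} {Ω S : Set (Eu n)}

theorem IsSurfaceIn.isOpen_diff (hS : IsSurfaceIn Ω S) (hΩ : IsOpen Ω) : IsOpen (Ω \ S) := by
  have : Ω \ S = Ω ∩ (closure S)ᶜ := by
    ext z
    exact ⟨fun h => ⟨h.1, fun h' => h.2 (hS.relClosed ⟨h', h.1⟩)⟩,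
      fun h => ⟨h.1, fun h' => h.2 (subset_closure h')⟩⟩
  rw [this]
  exact hΩ.inter isClosed_closure.isOpen_compl

theorem IsSurfaceIn.measurableSet (hS : IsSurfaceIn Ω S) (hΩ : IsOpen Ω) : MeasurableSet S := by
  have : S = Ω \ (Ω \ S) := by rw [sdiff_sdiff_right_self]; exact (inter_eq_right.2 hS.subset).symm
  rw [this]
  exact hΩ.measurableSet.diff (hS.isOpen_diff hΩ).measurableSet

/-- A local picture of a hypersurface as a Lipschitz graph, with its two sides. -/
structure IsSurfaceChart (S V : Set (Eu n)) (g : Eu n → ℝ) (x₀ : Eu n) (r : ℝ) (e : Eu n)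
    (φ : Eu n → ℝ) : Prop where
  pos : 0 < r
  norm_eq : ‖e‖ = 1
  lipschitz : LipschitzWith 1 φ
  ball_subset : Metric.ball x₀ r ⊆ V
  neg_iff : ∀ z ∈ Metric.ball x₀ r, g z < 0 ↔ z ∈ subgraph e φ
  pos_iff : ∀ z ∈ Metric.ball x₀ r, 0 < g z ↔ z ∈ subgraph (-e) (fun x => -φ x)
  mem_iff : ∀ z ∈ Metric.ball x₀ r, z ∈ S ↔ depth e φ z = 0

theorem exists_surfaceChart {V : Set (Eu n)} {g : Eu n → ℝ} (hg : IsLocalDefiningFunction S V g)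
    {x₀ : Eu n} (hx₀ : x₀ ∈ S) (hV : x₀ ∈ V) : ∃ r e φ, IsSurfaceChart S V g x₀ r e φ := by
  obtain ⟨r, φ, hr, hφ, hball, h⟩ := exists_graph_chart hg hx₀ hV
  refine ⟨r, _, φ, hr, norm_gradNormal (hg.fderiv_ne_zero x₀ hV), hφ, hball, fun z hz => ?_,
    fun z hz => ?_, fun z hz => ?_⟩
  · rw [mem_subgraph_iff]; exact (h z hz).1
  · rw [mem_subgraph_iff, depth_neg, neg_pos]; exact (h z hz).2
  · rw [hg.mem_iff z (hball hz)]
    have h1 := (h z hz).1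
    have h2 := (h z hz).2
    constructor
    · intro h0
      rw [h0] at h1 h2
      exact le_antisymm (not_lt.1 fun h' => lt_irrefl _ (h1.2 h'))
        (not_lt.1 fun h' => lt_irrefl _ (h2.2 h'))
    · intro h0
      rw [h0] at h1 h2
      exact le_antisymm (not_lt.1 fun h' => lt_irrefl _ (h2.1 h'))
        (not_lt.1 fun h' => lt_irrefl _ (h1.1 h'))

theorem lipschitz_neg_fun {φ : Eu n → ℝ} {K : ℝ≥0} (hφ : LipschitzWith K φ) :
    LipschitzWith K (fun x => -φ x) := hφ.neg

namespace IsSurfaceChart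

variable {V : Set (Eu n)} {g : Eu n → ℝ} {x₀ e : Eu n} {r : ℝ} {φ : Eu n → ℝ}
  (h : IsSurfaceChart S V g x₀ r e φ)
include h

theorem nhdsWithin_neg {x : Eu n} (hx : x ∈ Metric.ball x₀ r) :
    𝓝[{z | z ∈ V ∧ g z < 0}] x = 𝓝[subgraph e φ] x := by
  rw [nhdsWithin_eq_iff_eventuallyEq]
  filter_upwards [Metric.isOpen_ball.mem_nhds hx] with z hz
  exact propext ⟨fun h' => (h.neg_iff z hz).1 h'.2,
    fun h' => ⟨h.ball_subset hz, (h.neg_iff z hz).2 h'⟩⟩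

theorem nhdsWithin_pos {x : Eu n} (hx : x ∈ Metric.ball x₀ r) :
    𝓝[{z | z ∈ V ∧ 0 < g z}] x = 𝓝[subgraph (-e) (fun x => -φ x)] x := by
  rw [nhdsWithin_eq_iff_eventuallyEq]
  filter_upwards [Metric.isOpen_ball.mem_nhds hx] with z hz
  exact propext ⟨fun h' => (h.pos_iff z hz).1 h'.2,
    fun h' => ⟨h.ball_subset hz, (h.pos_iff z hz).2 h'⟩⟩

theorem neBot_neg {x : Eu n} (hx : x ∈ Metric.ball x₀ r) (hxS : x ∈ S) :
    (𝓝[{z | z ∈ V ∧ g z < 0}] x).NeBot := by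
  rw [h.nhdsWithin_neg hx, ← mem_closure_iff_nhdsWithin_neBot,
    ← graphMap_hproj h.norm_eq ((h.mem_iff x hx).1 hxS)]
  exact graphMap_mem_closure h.norm_eq h.lipschitz _

theorem neBot_pos {x : Eu n} (hx : x ∈ Metric.ball x₀ r) (hxS : x ∈ S) :
    (𝓝[{z | z ∈ V ∧ 0 < g z}] x).NeBot := by
  have he : ‖-e‖ = 1 := by rw [norm_neg, h.norm_eq]
  have h0 : depth (-e) (fun x => -φ x) x = 0 := by
    rw [depth_neg, (h.mem_iff x hx).1 hxS, neg_zero]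
  rw [h.nhdsWithin_pos hx, ← mem_closure_iff_nhdsWithin_neBot, ← graphMap_hproj he h0]
  exact graphMap_mem_closure he (lipschitz_neg_fun h.lipschitz) _

end IsSurfaceChart

theorem IsSurfaceIn.exists_chart (hS : IsSurfaceIn Ω S) (hΩ : IsOpen Ω) {x : Eu n} (hx : x ∈ S) :
    ∃ V g r e φ, V ⊆ Ω ∧ x ∈ V ∧ IsLocalDefiningFunction S V g ∧
      IsSurfaceChart S V g x r e φ := by
  obtain ⟨V, g, hxV, hg⟩ := hS.hypersurface x hx
  have hg' : IsLocalDefiningFunction S (V ∩ Ω) g := ⟨hg.isOpen.inter hΩ,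
    hg.contDiffOn.mono inter_subset_left, fun z hz => hg.fderiv_ne_zero z hz.1,
    fun z hz => hg.mem_iff z hz.1⟩
  obtain ⟨r, e, φ, h⟩ := exists_surfaceChart hg' hx ⟨hxV, hS.subset hx⟩
  exact ⟨V ∩ Ω, g, r, e, φ, inter_subset_right, ⟨hxV, hS.subset hx⟩, hg', h⟩

theorem IsSurfaceIn.volume_eq_zero (hS : IsSurfaceIn Ω S) (hΩ : IsOpen Ω) : volume S = 0 := by
  refine measure_null_of_locally_null _ fun x hx => ?_
  obtain ⟨V, g, r, e, φ, -, -, -, h⟩ := hS.exists_chart hΩ hx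
  refine ⟨Metric.ball x r ∩ S, inter_mem (mem_nhdsWithin_of_mem_nhds (Metric.ball_mem_nhds x h.pos))
    self_mem_nhdsWithin, measure_mono_null (fun z hz => ?_)
    (volume_depth_eq_zero h.norm_eq h.lipschitz)⟩
  exact (h.mem_iff z hz.1).1 hz.2

theorem outerNormal_congr {Ω Ω' : Set (Eu n)} {x : Eu n} (h : ∀ᶠ z in 𝓝 x, (z ∈ Ω ↔ z ∈ Ω')) :
    outerNormal Ω x = outerNormal Ω' x := by
  have : IsOuterUnitNormal Ω x = IsOuterUnitNormal Ω' x := by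
    ext v
    exact ⟨fun h' => h'.congr h, fun h' => h'.congr (h.mono fun z hz => hz.symm)⟩
  unfold outerNormal
  rw [this]

theorem mem_frontier_congr {Ω Ω' : Set (Eu n)} {x : Eu n} (h : ∀ᶠ z in 𝓝 x, (z ∈ Ω ↔ z ∈ Ω')) :
    x ∈ frontier Ω ↔ x ∈ frontier Ω' := by
  have h1 : 𝓝[Ω] x = 𝓝[Ω'] x := nhdsWithin_eq_iff_eventuallyEq.2 (h.mono fun z hz => propext hz)
  have h2 : 𝓝[Ωᶜ] x = 𝓝[Ω'ᶜ] x := nhdsWithin_eq_iff_eventuallyEq.2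
    (h.mono fun z hz => propext (not_congr hz))
  rw [frontier_eq_closure_inter_closure, frontier_eq_closure_inter_closure, mem_inter_iff,
    mem_inter_iff, mem_closure_iff_nhdsWithin_neBot, mem_closure_iff_nhdsWithin_neBot,
    mem_closure_iff_nhdsWithin_neBot, mem_closure_iff_nhdsWithin_neBot, h1, h2]

/-- A local picture of a Lipschitz domain as a subgraph. -/
theorem HasLipschitzBoundary.exists_chart (hL : HasLipschitzBoundary Ω) {x : Eu n}
    (hx : x ∈ frontier Ω) : ∃ (e : Eu n) (K : ℝ≥0) (φ : Eu n → ℝ) (r : ℝ), ‖e‖ = 1 ∧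
      LipschitzWith K φ ∧ 0 < r ∧ (∀ z ∈ Metric.ball x r, z ∈ Ω ↔ z ∈ subgraph e φ) ∧
      (∀ z ∈ Metric.ball x r, z ∈ frontier Ω ↔ depth e φ z = 0) ∧
      ∀ z ∈ Metric.ball x r, outerNormal Ω z = outerNormal (subgraph e φ) z := by
  obtain ⟨e, K, φ, he, hφ, h⟩ := hL x hx
  obtain ⟨r, hr, hball⟩ := Metric.eventually_nhds_iff_ball.1 h
  have hev : ∀ z ∈ Metric.ball x r, ∀ᶠ z' in 𝓝 z, (z' ∈ Ω ↔ z' ∈ subgraph e φ) := fun z hz => by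
    filter_upwards [Metric.isOpen_ball.mem_nhds hz] with z' hz' using hball z' hz'
  refine ⟨e, K, φ, r, he, hφ, hr, hball, fun z hz => ?_, fun z hz => outerNormal_congr (hev z hz)⟩
  rw [mem_frontier_congr (hev z hz), frontier_subgraph he hφ]
  rfl

theorem HasLipschitzBoundary.finite_area (hL : HasLipschitzBoundary Ω)
    (hb : Bornology.IsBounded Ω) : μHE[n - 1] (frontier Ω) < ⊤ := by
  have hc : IsCompact (frontier Ω) := Metric.isCompact_of_isClosed_isBounded isClosed_frontier
    (hb.closure.subset frontier_subset_closure)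
  refine hc.measure_lt_top_of_nhdsWithin fun x hx => ?_
  obtain ⟨e, K, φ, r, he, hφ, hr, -, h, -⟩ := hL.exists_chart hx
  refine ⟨frontier Ω ∩ Metric.ball x r, inter_mem self_mem_nhdsWithin
    (mem_nhdsWithin_of_mem_nhds (Metric.ball_mem_nhds x hr)), ?_⟩
  refine (measure_mono fun z hz => ?_).trans_lt
    (euclideanHausdorffMeasure_graph_inter_ball_lt_top he hφ x r)
  exact ⟨(h z hz.2).1 hz.1, hz.2⟩

/-- `outerNormal` is defined by choice, so its measurability comes from the explicit formula in a
graph chart, valid almost everywhere there. Compactness of ∂Ω leaves finitely many charts. -/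
theorem HasLipschitzBoundary.aestronglyMeasurable_outerNormal (hL : HasLipschitzBoundary Ω)
    (hb : Bornology.IsBounded Ω) :
    AEStronglyMeasurable (outerNormal Ω) ((μHE[n - 1]).restrict (frontier Ω)) := by
  have hc : IsCompact (frontier Ω) := Metric.isCompact_of_isClosed_isBounded isClosed_frontier
    (hb.closure.subset frontier_subset_closure)
  have hloc : ∀ x ∈ frontier Ω, ∃ U ∈ 𝓝 x,
      AEStronglyMeasurable (outerNormal Ω) ((μHE[n - 1]).restrict (U ∩ frontier Ω)) := by
    intro x hx
    obtain ⟨e, K, φ, r, he, hφ, hr, -, h, hN⟩ := hL.exists_chart hx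
    refine ⟨Metric.ball x r, Metric.ball_mem_nhds x hr, ?_⟩
    have h1 : Measurable (fun z => (areaElement e φ (hproj he z))⁻¹ • normalVec e φ (hproj he z)) :=
      ((measurable_areaElement.comp (hproj he).measurable).inv).smul
        (measurable_normalVec.comp (hproj he).measurable)
    refine h1.aestronglyMeasurable.congr ?_
    have h2 : Metric.ball x r ∩ frontier Ω ⊆ {z | depth e φ z = 0} := fun z hz =>
      (h z hz.1).1 hz.2
    have h3 := ae_graph_of_ae he hφ (p := fun z => (areaElement e φ (hproj he z))⁻¹ •
      normalVec e φ (hproj he z) = outerNormal (subgraph e φ) z) (by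
        filter_upwards [ae_hasFDerivAt_restrict hφ] with w hw
        rw [hproj_graphMap, (isOuterUnitNormal_subgraph he hw).outerNormal_eq])
    filter_upwards [ae_restrict_of_ae_restrict_of_subset h2 h3,
      ae_restrict_mem (measurableSet_ball.inter isClosed_frontier.measurableSet)] with z h4 h5
    rw [h4, hN z h5.1]
  choose! U hU hm using hloc
  obtain ⟨t, ht, hcov⟩ := hc.elim_nhds_subcover U hU
  have : frontier Ω ⊆ ⋃ x : t, (U x ∩ frontier Ω) := fun z hz => by
    obtain ⟨x, hx, hzx⟩ := mem_iUnion₂.1 (hcov hz)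
    exact mem_iUnion.2 ⟨⟨x, hx⟩, hzx, hz⟩
  refine AEStronglyMeasurable.mono_measure ?_ (Measure.restrict_mono this le_rfl)
  rw [aestronglyMeasurable_iUnion_iff]
  exact fun x => hm x (ht x x.2)

end Geometry

/-! ### Gauss's theorem for a field with a jump across a hypersurface -/

section GlobalGauss

variable {n : ℕ} {Ω S : Set (Eu n)}

/-- A bounded vector field `q` on `Ω \ S` with distributional divergence `f` off `S`, with
boundary values `qb` and with the normal jump `jmp` across `S`. -/
structure FluxData (Ω S : Set (Eu n)) (q qb : Eu n → Eu n) (f jmp : Eu n → ℝ) (C : ℝ) : Prop where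
  cont : ContinuousOn q (Ω \ S)
  meas : AEStronglyMeasurable f (volume.restrict Ω)
  bound : ∀ z ∈ Ω \ S, ‖q z‖ ≤ C
  bound' : ∀ z ∈ Ω \ S, |f z| ≤ C
  boundary : ∀ x ∈ frontier Ω \ closure S, Tendsto q (𝓝[Ω \ S] x) (𝓝 (qb x))
  jump : ∀ (V : Set (Eu n)) (g : Eu n → ℝ), V ⊆ Ω → IsLocalDefiningFunction S V g → ∀ x ∈ S ∩ V,
    ∃ a b, Tendsto q (𝓝[{z | z ∈ V ∧ 0 < g z}] x) (𝓝 a) ∧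
      Tendsto q (𝓝[{z | z ∈ V ∧ g z < 0}] x) (𝓝 b) ∧ jmp x = ⟪a - b, gradNormal g x⟫
  weak : ∀ δ, IsTest (Ω \ S) δ → ∫ z in Ω, (f z * δ z + fderiv ℝ δ z (q z)) = 0

theorem continuousOn_gradNormal {V : Set (Eu n)} {g : Eu n → ℝ}
    (hg : IsLocalDefiningFunction S V g) : ContinuousOn (gradNormal g) V := by
  have h1 : ContinuousOn (fderiv ℝ g) V :=
    hg.contDiffOn.continuousOn_fderiv_of_isOpen hg.isOpen le_rfl
  have h2 : ContinuousOn (gradient g) V :=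
    (LinearIsometryEquiv.continuous _).comp_continuousOn h1
  refine (h2.norm.inv₀ fun z hz => ?_).smul h2
  rw [norm_gradient]
  exact norm_ne_zero_iff.2 (hg.fderiv_ne_zero z hz)

namespace FluxData

variable {q qb : Eu n → Eu n} {f jmp : Eu n → ℝ} {C : ℝ} (h : FluxData Ω S q qb f jmp C)
include h

/-- A function with limits at all points of a set extends continuously to it (`extendFrom`), so the
one-sided values depend continuously on the surface point. -/
theorem side_limits {V : Set (Eu n)} {g φ : Eu n → ℝ} {x e : Eu n} {r : ℝ} (hV : V ⊆ Ω)
    (hg : IsLocalDefiningFunction S V g) (hc : IsSurfaceChart S V g x r e φ) :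
    ∃ a b : Eu n → Eu n, ContinuousOn a (S ∩ Metric.ball x r) ∧
      ContinuousOn b (S ∩ Metric.ball x r) ∧ ∀ z ∈ S ∩ Metric.ball x r,
        Tendsto q (𝓝[{z | z ∈ V ∧ 0 < g z}] z) (𝓝 (a z)) ∧
        Tendsto q (𝓝[{z | z ∈ V ∧ g z < 0}] z) (𝓝 (b z)) ∧
        jmp z = ⟪a z - b z, gradNormal g z⟫ ∧ ‖a z‖ ≤ C ∧ ‖b z‖ ≤ C := by
  have hB : ∀ z ∈ S ∩ Metric.ball x r, z ∈ S ∩ V := fun z hz => ⟨hz.1, hc.ball_subset hz.2⟩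
  refine ⟨extendFrom {z | z ∈ V ∧ 0 < g z} q, extendFrom {z | z ∈ V ∧ g z < 0} q,
    continuousOn_extendFrom (fun z hz => mem_closure_iff_nhdsWithin_neBot.2 (hc.neBot_pos hz.2 hz.1))
      fun z hz => ?_,
    continuousOn_extendFrom (fun z hz => mem_closure_iff_nhdsWithin_neBot.2 (hc.neBot_neg hz.2 hz.1))
      fun z hz => ?_, fun z hz => ?_⟩
  · obtain ⟨a, b, ha, -⟩ := h.jump V g hV hg z (hB z hz)
    exact ⟨a, ha⟩
  · obtain ⟨a, b, -, hb, -⟩ := h.jump V g hV hg z (hB z hz)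
    exact ⟨b, hb⟩
  · obtain ⟨a, b, ha, hb, hj⟩ := h.jump V g hV hg z (hB z hz)
    have := hc.neBot_pos hz.2 hz.1
    have := hc.neBot_neg hz.2 hz.1
    rw [extendFrom, extendFrom, ha.limUnder_eq, hb.limUnder_eq]
    refine ⟨ha, hb, hj, le_of_tendsto ha.norm ?_, le_of_tendsto hb.norm ?_⟩
    · filter_upwards [self_mem_nhdsWithin] with z hz
      exact h.bound z ⟨hV hz.1, fun h' => hz.2.ne' ((hg.mem_iff z hz.1).1 h')⟩
    · filter_upwards [self_mem_nhdsWithin] with z hz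
      exact h.bound z ⟨hV hz.1, fun h' => hz.2.ne ((hg.mem_iff z hz.1).1 h')⟩

/-- Replacing g by -g exchanges the sides and reverses the normal, which leaves the product in
`jump` unchanged. Hence the local formulas describe one function although the surface need not be
orientable. -/
theorem continuousOn_jump (hΩ : IsOpen Ω) (hS : IsSurfaceIn Ω S) : ContinuousOn jmp S := by
  intro x hx
  obtain ⟨V, g, r, e, φ, hV, hxV, hg, hc⟩ := hS.exists_chart hΩ hx
  obtain ⟨a, b, ca, cb, hab⟩ := h.side_limits hV hg hc
  have c3 := ContinuousOn.inner (𝕜 := ℝ) (ca.sub cb)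
    ((continuousOn_gradNormal hg).mono fun z hz => hc.ball_subset hz.2)
  have c4 : ContinuousOn jmp (S ∩ Metric.ball x r) := c3.congr fun z hz => (hab z hz).2.2.1
  exact (c4 x ⟨hx, Metric.mem_ball_self hc.pos⟩).mono_of_mem_nhdsWithin
    (inter_mem self_mem_nhdsWithin (mem_nhdsWithin_of_mem_nhds (Metric.ball_mem_nhds x hc.pos)))

theorem jump_le (hΩ : IsOpen Ω) (hS : IsSurfaceIn Ω S) : ∀ x ∈ S, |jmp x| ≤ 2 * C := by
  intro x hx
  obtain ⟨V, g, r, e, φ, hV, hxV, hg, hc⟩ := hS.exists_chart hΩ hx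
  obtain ⟨a, b, ca, cb, hab⟩ := h.side_limits hV hg hc
  obtain ⟨-, -, hj, h1, h2⟩ := hab x ⟨hx, Metric.mem_ball_self hc.pos⟩
  rw [hj]
  refine (abs_real_inner_le_norm _ _).trans ?_
  rw [norm_gradNormal (hg.fderiv_ne_zero x hxV), mul_one]
  linarith [norm_sub_le (a x) (b x)]

theorem integrableOn_jump (hΩ : IsOpen Ω) (hS : IsSurfaceIn Ω S) :
    IntegrableOn jmp S μHE[n - 1] :=
  (integrableOn_const (C := 2 * C) hS.finite_area.ne).mono'
    ((h.continuousOn_jump hΩ hS).aestronglyMeasurable (hS.measurableSet hΩ)) (by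
      filter_upwards [ae_restrict_mem (hS.measurableSet hΩ)] with x hx
      exact h.jump_le hΩ hS x hx)

theorem nhdsWithin_boundary {x : Eu n} (hx : x ∈ frontier Ω \ closure S) :
    𝓝[Ω \ S] x = 𝓝[Ω] x := by
  rw [nhdsWithin_eq_iff_eventuallyEq]
  filter_upwards [isClosed_closure.isOpen_compl.mem_nhds hx.2] with z hz
  exact propext ⟨fun h' => h'.1, fun h' => ⟨h', fun h'' => hz (subset_closure h'')⟩⟩

theorem neBot_boundary {x : Eu n} (hx : x ∈ frontier Ω \ closure S) : (𝓝[Ω \ S] x).NeBot := by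
  rw [h.nhdsWithin_boundary hx, ← mem_closure_iff_nhdsWithin_neBot]
  exact frontier_subset_closure hx.1

theorem continuousOn_boundary : ContinuousOn qb (frontier Ω \ closure S) := by
  have c1 : ContinuousOn (extendFrom (Ω \ S) q) (frontier Ω \ closure S) :=
    continuousOn_extendFrom (fun z hz => mem_closure_iff_nhdsWithin_neBot.2 (h.neBot_boundary hz))
      fun z hz => ⟨_, h.boundary z hz⟩
  refine c1.congr fun z hz => ?_
  have := h.neBot_boundary hz
  rw [extendFrom, (h.boundary z hz).limUnder_eq]

theorem boundary_le {x : Eu n} (hx : x ∈ frontier Ω \ closure S) : ‖qb x‖ ≤ C := by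
  have := h.neBot_boundary hx
  exact le_of_tendsto (h.boundary x hx).norm (by
    filter_upwards [self_mem_nhdsWithin] with z hz using h.bound z hz)

theorem integrableOn_boundary (hΩb : Bornology.IsBounded Ω) (hL : HasLipschitzBoundary Ω)
    (hS : IsSurfaceIn Ω S) :
    IntegrableOn (fun x => ⟪qb x, outerNormal Ω x⟫) (frontier Ω) μHE[n - 1] := by
  have hd : (frontier Ω \ closure S : Set (Eu n)) =ᵐ[μHE[n - 1]] frontier Ω := by
    rw [← sdiff_inter_self_eq_sdiff]
    exact sdiff_null_ae_eq_self hS.boundary_null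
  have hm : MeasurableSet (frontier Ω \ closure S) :=
    isClosed_frontier.measurableSet.diff isClosed_closure.measurableSet
  rw [← integrableOn_congr_set_ae hd]
  refine (integrableOn_const (C := C)
    ((measure_mono sdiff_subset).trans_lt (hL.finite_area hΩb)).ne).mono' ?_ ?_
  · refine AEStronglyMeasurable.inner (𝕜 := ℝ) (h.continuousOn_boundary.aestronglyMeasurable hm) ?_
    exact (hL.aestronglyMeasurable_outerNormal hΩb).mono_measure
      (Measure.restrict_mono sdiff_subset le_rfl)
  · filter_upwards [ae_restrict_mem hm] with x hx
    refine (norm_inner_le_norm _ _).trans ?_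
    have h1 := h.boundary_le hx
    exact (mul_le_of_le_one_right (norm_nonneg _) (norm_outerNormal_le _ _)).trans h1

theorem setIntegral_diff (hΩ : IsOpen Ω) (hS : IsSurfaceIn Ω S) (F : Eu n → ℝ) :
    ∫ z in Ω, F z = ∫ z in Ω \ S, F z :=
  (setIntegral_congr_set (sdiff_null_ae_eq_self (hS.volume_eq_zero hΩ))).symm

/-- In a chart that avoids closure S the domain is a subgraph without a jump inside, so
`gauss_subgraph` applies directly. -/
theorem gauss_near_boundary (hΩ : IsOpen Ω) (hL : HasLipschitzBoundary Ω)
    {x : Eu n} (hx : x ∈ frontier Ω \ closure S) :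
    ∃ V, IsOpen V ∧ x ∈ V ∧ V ∩ S = ∅ ∧ ∀ δ, IsTest V δ →
      ∫ z in Ω, (f z * δ z + fderiv ℝ δ z (q z))
        = ∫ x in frontier Ω, δ x * ⟪qb x, outerNormal Ω x⟫ ∂μHE[n - 1] := by
  obtain ⟨e, K, φ, r, he, hφ, hr, h1, h2, h3⟩ := hL.exists_chart hx.1
  set V := Metric.ball x r ∩ (closure S)ᶜ
  have hVo : IsOpen V := Metric.isOpen_ball.inter isClosed_closure.isOpen_compl
  have hVD : V ∩ subgraph e φ = V ∩ Ω := by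
    ext z
    exact and_congr_right fun hz => (h1 z hz.1).symm
  have hVS : V ∩ S = ∅ := by
    ext z
    simp only [mem_inter_iff, mem_empty_iff_false, iff_false, not_and]
    exact fun hz hzS => hz.2 (subset_closure hzS)
  have hVΩ : V ∩ Ω ⊆ Ω \ S := fun z hz => ⟨hz.2, fun h' => hz.1.2 (subset_closure h')⟩
  refine ⟨V, hVo, ⟨Metric.mem_ball_self hr, hx.2⟩, hVS, fun δ hδ => ?_⟩
  rw [hδ.setIntegral_eq hΩ.measurableSet inter_subset_right subset_rfl, ← hVD,
    gauss_subgraph he hφ hVo (q := q) (qb := qb) (f := f) (C := C) ?_ ?_ ?_ ?_ ?_ ?_ hδ]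
  · have hm : MeasurableSet {z | depth e φ z = 0} :=
      (isClosed_eq (lipschitzWith_depth he hφ).continuous continuous_const).measurableSet
    have e1 : ∀ z ∉ V, δ z = 0 := fun z hz => (hδ.eq_zero hz).1
    rw [setIntegral_eq_of_subset_of_forall_sdiff_eq_zero hm
      (s := V ∩ {z | depth e φ z = 0}) inter_subset_right, eq_comm,
      setIntegral_eq_of_subset_of_forall_sdiff_eq_zero isClosed_frontier.measurableSet
      (s := V ∩ frontier Ω) inter_subset_right]
    · have : V ∩ frontier Ω = V ∩ {z | depth e φ z = 0} := by
        ext z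
        exact and_congr_right fun hz => h2 z hz.1
      rw [this]
      refine setIntegral_congr_fun (hVo.measurableSet.inter hm) fun z hz => ?_
      rw [h3 z hz.1.1]
    · intro z hz
      rw [e1 z fun h' => hz.2 ⟨h', hz.1⟩, zero_mul]
    · intro z hz
      rw [e1 z fun h' => hz.2 ⟨h', hz.1⟩, zero_mul]
  · rw [hVD]
    exact (h.cont.mono hVΩ).aestronglyMeasurable (hVo.inter hΩ).measurableSet
  · rw [hVD]
    exact h.meas.mono_measure (Measure.restrict_mono inter_subset_right le_rfl)
  · rw [hVD]; exact fun z hz => h.bound z (hVΩ hz)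
  · rw [hVD]; exact fun z hz => h.bound' z (hVΩ hz)
  · intro z hz hz0
    have hzf : z ∈ frontier Ω \ closure S := ⟨(h2 z hz.1).2 hz0, hz.2⟩
    have : 𝓝[subgraph e φ] z = 𝓝[Ω \ S] z := by
      rw [h.nhdsWithin_boundary hzf, nhdsWithin_eq_iff_eventuallyEq]
      filter_upwards [Metric.isOpen_ball.mem_nhds hz.1] with y hy
      exact propext (h1 y hy).symm
    rw [this]
    exact h.boundary z hzf
  · intro δ' hδ'
    rw [hVD] at hδ' ⊢
    rw [← hδ'.setIntegral_eq hΩ.measurableSet inter_subset_right inter_subset_left]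
    exact h.weak δ' (hδ'.mono hVΩ)

theorem integrableOn_volume (hΩ : IsOpen Ω) (hS : IsSurfaceIn Ω S) {δ : Eu n → ℝ}
    {A : Set (Eu n)} (hδ : IsTest A δ) :
    IntegrableOn (fun z => f z * δ z) Ω ∧ IntegrableOn (fun z => fderiv ℝ δ z (q z)) Ω := by
  have hd := sdiff_null_ae_eq_self (s := Ω) (hS.volume_eq_zero hΩ)
  rw [← integrableOn_congr_set_ae hd, ← integrableOn_congr_set_ae hd]
  have hm := (hS.isOpen_diff hΩ).measurableSet
  exact integrableOn_pairing hm (h.cont.aestronglyMeasurable hm)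
    (h.meas.mono_measure (Measure.restrict_mono sdiff_subset le_rfl)) h.bound h.bound'
    hδ.lipschitz hδ.compact

/-- Apply `gauss_subgraph` on both sides. The side g < 0 lies below the graph of φ and has outer
normal N = `gradNormal` g; the side g > 0 lies below the graph of -φ in the direction -e and has
outer normal -N. The two fluxes add up to minus the jump. -/
theorem gauss_near_surface (hΩ : IsOpen Ω) (hS : IsSurfaceIn Ω S) {x : Eu n} (hx : x ∈ S) :
    ∃ V, IsOpen V ∧ x ∈ V ∧ V ⊆ Ω ∧ ∀ δ, IsTest V δ →
      ∫ z in Ω, (f z * δ z + fderiv ℝ δ z (q z)) = -∫ x in S, δ x * jmp x ∂μHE[n - 1] := by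
  obtain ⟨V, g, r, e, φ, hV, hxV, hg, hc⟩ := hS.exists_chart hΩ hx
  obtain ⟨a, b, ca, cb, hab⟩ := h.side_limits hV hg hc
  set B := Metric.ball x r with hBdef
  refine ⟨B, Metric.isOpen_ball, Metric.mem_ball_self hc.pos, hc.ball_subset.trans hV,
    fun δ hδ => ?_⟩
  have he := hc.norm_eq
  have he' : ‖-e‖ = 1 := by rw [norm_neg, he]
  have hφ := hc.lipschitz
  have hφ' := lipschitz_neg_fun hφ
  have hBΩ : B ⊆ Ω := hc.ball_subset.trans hV
  have hdS : ∀ z ∈ B, depth e φ z ≠ 0 → z ∈ Ω \ S := fun z hz h0 =>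
    ⟨hBΩ hz, fun h' => h0 ((hc.mem_iff z hz).1 h')⟩
  have hD : ∀ z, z ∈ subgraph e φ ↔ 0 < depth e φ z := fun z => mem_subgraph_iff
  have hD' : ∀ z, z ∈ subgraph (-e) (fun x => -φ x) ↔ depth e φ z < 0 := fun z => by
    rw [mem_subgraph_iff, depth_neg, neg_pos]
  have s1 : B ∩ subgraph e φ ⊆ Ω \ S := fun z hz => hdS z hz.1 ((hD z).1 hz.2).ne'
  have s2 : B ∩ subgraph (-e) (fun x => -φ x) ⊆ Ω \ S := fun z hz =>
    hdS z hz.1 ((hD' z).1 hz.2).ne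
  have o1 : IsOpen (B ∩ subgraph e φ) := Metric.isOpen_ball.inter (isOpen_subgraph he hφ)
  have o2 : IsOpen (B ∩ subgraph (-e) (fun x => -φ x)) :=
    Metric.isOpen_ball.inter (isOpen_subgraph he' hφ')
  have w : ∀ T, T ⊆ Ω \ S → ∀ δ, IsTest T δ → ∫ z in T, (f z * δ z + fderiv ℝ δ z (q z)) = 0 :=
    fun T hT δ' hδ' => by
      rw [← hδ'.setIntegral_eq hΩ.measurableSet (hT.trans sdiff_subset) inter_subset_left]
      exact h.weak δ' (hδ'.mono hT)
  have g1 := gauss_subgraph he hφ Metric.isOpen_ball (q := q) (qb := b) (f := f) (C := C)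
    ((h.cont.mono s1).aestronglyMeasurable o1.measurableSet)
    (h.meas.mono_measure (Measure.restrict_mono (s1.trans sdiff_subset) le_rfl))
    (fun z hz => h.bound z (s1 hz)) (fun z hz => h.bound' z (s1 hz))
    (fun z hz h0 => by
      rw [← hc.nhdsWithin_neg hz]
      exact (hab z ⟨(hc.mem_iff z hz).2 h0, hz⟩).2.1) (w _ s1) hδ
  have g2 := gauss_subgraph he' hφ' Metric.isOpen_ball (q := q) (qb := a) (f := f) (C := C)
    ((h.cont.mono s2).aestronglyMeasurable o2.measurableSet)
    (h.meas.mono_measure (Measure.restrict_mono (s2.trans sdiff_subset) le_rfl))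
    (fun z hz => h.bound z (s2 hz)) (fun z hz => h.bound' z (s2 hz))
    (fun z hz h0 => by
      rw [← hc.nhdsWithin_pos hz]
      rw [depth_neg, neg_eq_zero] at h0
      exact (hab z ⟨(hc.mem_iff z hz).2 h0, hz⟩).1) (w _ s2) hδ
  have hdisj : Disjoint (B ∩ subgraph e φ) (B ∩ subgraph (-e) (fun x => -φ x)) := by
    rw [disjoint_left]
    exact fun z hz hz' => lt_asymm ((hD z).1 hz.2) ((hD' z).1 hz'.2)
  have hi : IntegrableOn (fun z => f z * δ z + fderiv ℝ δ z (q z)) Ω :=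
    (h.integrableOn_volume hΩ hS hδ).1.add (h.integrableOn_volume hΩ hS hδ).2
  have hSm := hS.measurableSet hΩ
  have hBm : MeasurableSet (S ∩ B) := hSm.inter measurableSet_ball
  have hm : MeasurableSet {z | depth e φ z = 0} :=
    (isClosed_eq (lipschitzWith_depth he hφ).continuous continuous_const).measurableSet
  have hSB : ∀ F : Eu n → ℝ, (∫ z in {z | depth e φ z = 0}, δ z * F z ∂μHE[n - 1])
      = ∫ z in S ∩ B, δ z * F z ∂μHE[n - 1] := fun F => by
    refine setIntegral_eq_of_subset_of_forall_sdiff_eq_zero hm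
      (fun z hz => (hc.mem_iff z hz.2).1 hz.1) fun z hz => ?_
    rw [(hδ.eq_zero fun h' => hz.2 ⟨(hc.mem_iff z h').2 hz.1, h'⟩).1, zero_mul]
  have hd0 : ∀ z ∈ S ∩ B, g z = 0 ∧ DifferentiableAt ℝ g z ∧ fderiv ℝ g z ≠ 0 := fun z hz => by
    have hzV := hc.ball_subset hz.2
    exact ⟨(hg.mem_iff z hzV).1 hz.1, (hg.contDiffOn.differentiableOn one_ne_zero).differentiableAt
      (hg.isOpen.mem_nhds hzV), hg.fderiv_ne_zero z hzV⟩
  have n1 : ∀ z ∈ S ∩ B, outerNormal (subgraph e φ) z = gradNormal g z := fun z hz => by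
    obtain ⟨h0, h1, h2⟩ := hd0 z hz
    rw [← (isOuterUnitNormal_gradNormal h1 h2 h0).outerNormal_eq]
    refine outerNormal_congr ?_
    filter_upwards [Metric.isOpen_ball.mem_nhds hz.2] with y hy
    exact (hc.neg_iff y hy).symm
  have n2 : ∀ z ∈ S ∩ B, outerNormal (subgraph (-e) (fun x => -φ x)) z = -gradNormal g z :=
    fun z hz => by
      obtain ⟨h0, h1, h2⟩ := hd0 z hz
      have e1 : gradNormal (fun y => -g y) z = -gradNormal g z := by
        simp only [gradNormal, gradient, fderiv_fun_neg, map_neg, norm_neg, smul_neg]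
      rw [← e1, ← (isOuterUnitNormal_gradNormal (g := fun y => -g y) h1.fun_neg
        (by rw [fderiv_fun_neg]; exact neg_ne_zero.2 h2) (by rw [h0, neg_zero])).outerNormal_eq]
      refine outerNormal_congr ?_
      filter_upwards [Metric.isOpen_ball.mem_nhds hz.2] with y hy
      rw [← hc.pos_iff y hy]
      simp
  have hset : {z | depth (-e) (fun x => -φ x) z = 0} = {z | depth e φ z = 0} := by
    ext z
    rw [mem_ofPred_eq, mem_ofPred_eq, depth_neg, neg_eq_zero]
  rw [hset, hSB, setIntegral_congr_fun hBm (g := fun z => δ z * -⟪a z, gradNormal g z⟫)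
    (fun z hz => by beta_reduce; rw [n2 z hz, inner_neg_right])] at g2
  rw [hSB, setIntegral_congr_fun hBm (g := fun z => δ z * ⟪b z, gradNormal g z⟫)
    (fun z hz => by beta_reduce; rw [n1 z hz])] at g1
  obtain ⟨M, hM⟩ := exists_bound_of_hasCompactSupport hδ.lipschitz.choose_spec.continuous hδ.compact
  have hint : ∀ c : Eu n → Eu n, ContinuousOn c (S ∩ B) → (∀ z ∈ S ∩ B, ‖c z‖ ≤ C) →
      IntegrableOn (fun z => δ z * ⟪c z, gradNormal g z⟫) (S ∩ B) μHE[n - 1] := fun c hcc hcb => by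
    have cN := ContinuousOn.inner (𝕜 := ℝ) hcc
      ((continuousOn_gradNormal hg).mono fun z hz => hc.ball_subset hz.2)
    refine (integrableOn_const (C := M * C)
      ((measure_mono inter_subset_left).trans_lt hS.finite_area).ne).mono'
      ((hδ.lipschitz.choose_spec.continuous.continuousOn.mul cN).aestronglyMeasurable hBm) ?_
    filter_upwards [ae_restrict_mem hBm] with z hz
    rw [norm_mul]
    refine mul_le_mul (hM z) ((norm_inner_le_norm _ _).trans ?_) (norm_nonneg _) M.coe_nonneg
    rw [norm_gradNormal (hd0 z hz).2.2, mul_one]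
    exact hcb z hz
  rw [h.setIntegral_diff hΩ hS, hδ.setIntegral_eq (hS.isOpen_diff hΩ).measurableSet
    (union_subset s1 s2) (fun z hz => ?_), setIntegral_union hdisj o2.measurableSet
    (hi.mono_set (s1.trans sdiff_subset)) (hi.mono_set (s2.trans sdiff_subset)), g1, g2,
    ← integral_add (hint b cb fun z hz => (hab z hz).2.2.2.2), ← integral_neg]
  · rw [setIntegral_eq_of_subset_of_forall_sdiff_eq_zero hSm (s := S ∩ B) inter_subset_left]
    · refine setIntegral_congr_fun hBm fun z hz => ?_
      rw [(hab z hz).2.2.1, inner_sub_left]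
      ring
    · intro z hz
      rw [(hδ.eq_zero fun h' => hz.2 ⟨hz.1, h'⟩).1, zero_mul, neg_zero]
  · simp only [mul_neg]
    exact (hint a ca fun z hz => (hab z hz).2.2.2.1).neg
  · rcases lt_trichotomy (depth e φ z) 0 with h0 | h0 | h0
    · exact Or.inr ⟨hz.1, (hD' z).2 h0⟩
    · exact absurd ((hc.mem_iff z hz.1).2 h0) hz.2.2
    · exact Or.inl ⟨hz.1, (hD z).2 h0⟩

/-- Gauss's theorem away from an exceptional set. -/
theorem gauss_of_isTest (hΩ : IsOpen Ω) (hΩb : Bornology.IsBounded Ω) (hL : HasLipschitzBoundary Ω)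
    (hS : IsSurfaceIn Ω S) {δ : Eu n → ℝ} (hδ : IsTest (closure S ∩ frontier Ω)ᶜ δ) :
    ∫ z in Ω, (f z * δ z + fderiv ℝ δ z (q z))
      = (∫ x in frontier Ω, δ x * ⟪qb x, outerNormal Ω x⟫ ∂μHE[n - 1])
        - ∫ x in S, δ x * jmp x ∂μHE[n - 1] := by
  have hSz : ∀ {A : Set (Eu n)} {δ : Eu n → ℝ}, IsTest A δ → A ∩ S = ∅ →
      ∫ x in S, δ x * jmp x ∂μHE[n - 1] = 0 := fun {A δ} hδ hA => by
    refine setIntegral_eq_zero_of_forall_eq_zero fun z hz => ?_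
    rw [(hδ.eq_zero fun h' => (hA ▸ (⟨h', hz⟩ : z ∈ A ∩ S) : z ∈ (∅ : Set (Eu n)))).1, zero_mul]
  have hFz : ∀ {A : Set (Eu n)} {δ : Eu n → ℝ}, IsTest A δ → A ∩ frontier Ω = ∅ →
      ∫ x in frontier Ω, δ x * ⟪qb x, outerNormal Ω x⟫ ∂μHE[n - 1] = 0 := fun {A δ} hδ hA => by
    refine setIntegral_eq_zero_of_forall_eq_zero fun z hz => ?_
    rw [(hδ.eq_zero fun h' => (hA ▸ (⟨h', hz⟩ : z ∈ A ∩ frontier Ω) : z ∈ (∅ : Set (Eu n)))).1,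
      zero_mul]
  have hΩF : ∀ z ∈ Ω, z ∉ frontier Ω := fun z hz h' => by
    rw [hΩ.frontier_eq] at h'
    exact h'.2 hz
  refine IsTest.induction_local (P := fun δ => ∫ z in Ω, (f z * δ z + fderiv ℝ δ z (q z))
      = (∫ x in frontier Ω, δ x * ⟪qb x, outerNormal Ω x⟫ ∂μHE[n - 1])
        - ∫ x in S, δ x * jmp x ∂μHE[n - 1]) ?_ ?_ ?_ hδ
  · simp
  · intro δ₁ δ₂ h₁ h₂ e₁ e₂
    obtain ⟨i1, j1⟩ := h.integrableOn_volume hΩ hS h₁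
    obtain ⟨i2, j2⟩ := h.integrableOn_volume hΩ hS h₂
    have hb : ∀ {A : Set (Eu n)} {δ}, IsTest A δ → ∃ M : ℝ≥0, ∀ x, |δ x| ≤ M := fun hδ =>
      exists_bound_of_hasCompactSupport hδ.lipschitz.choose_spec.continuous hδ.compact
    have hc : ∀ {A : Set (Eu n)} {δ}, IsTest A δ → Continuous δ := fun hδ =>
      hδ.lipschitz.choose_spec.continuous
    have k1 : ∀ {A : Set (Eu n)} {δ}, IsTest A δ →
        IntegrableOn (fun x => δ x * ⟪qb x, outerNormal Ω x⟫) (frontier Ω) μHE[n - 1] := fun hδ =>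
      (h.integrableOn_boundary hΩb hL hS).bdd_mul (hc hδ).aestronglyMeasurable
        (ae_of_all _ (hb hδ).choose_spec)
    have k2 : ∀ {A : Set (Eu n)} {δ}, IsTest A δ →
        IntegrableOn (fun x => δ x * jmp x) S μHE[n - 1] := fun hδ =>
      (h.integrableOn_jump hΩ hS).bdd_mul (hc hδ).aestronglyMeasurable
        (ae_of_all _ (hb hδ).choose_spec)
    obtain ⟨L₁, hL₁⟩ := h₁.lipschitz
    obtain ⟨L₂, hL₂⟩ := h₂.lipschitz
    have i1' : IntegrableOn (fun z => f z * δ₁ z + fderiv ℝ δ₁ z (q z)) Ω := i1.add j1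
    have i2' : IntegrableOn (fun z => f z * δ₂ z + fderiv ℝ δ₂ z (q z)) Ω := i2.add j2
    simp only [add_mul]
    rw [integral_add (k1 h₁) (k1 h₂), integral_add (k2 h₁) (k2 h₂), add_sub_add_comm, ← e₁, ← e₂,
      ← integral_add i1' i2']
    refine integral_congr_ae (ae_restrict_of_ae ?_)
    filter_upwards [hL₁.ae_differentiableAt, hL₂.ae_differentiableAt] with z d1 d2
    rw [fderiv_fun_add d1 d2, _root_.add_apply]
    ring
  · intro x hx
    -- The point lies on S, in Ω \ S, on ∂Ω \ closure S, or outside closure Ω. In each case the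
    -- terms that belong to the other places vanish for tests supported near x.
    by_cases hxS : x ∈ S
    · obtain ⟨V, hV, hxV, hVΩ, hg⟩ := h.gauss_near_surface hΩ hS hxS
      refine ⟨V, hV, hxV, fun δ hδ => ?_⟩
      rw [hg δ (hδ.mono inter_subset_right), hFz (hδ.mono inter_subset_right), zero_sub]
      ext z
      exact ⟨fun hz => hΩF z (hVΩ hz.1) hz.2, fun h' => h'.elim⟩
    by_cases hxΩ : x ∈ Ω
    · refine ⟨Ω \ S, hS.isOpen_diff hΩ, ⟨hxΩ, hxS⟩, fun δ hδ => ?_⟩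
      have hδ' := hδ.mono inter_subset_right
      rw [h.weak δ hδ', hFz hδ', hSz hδ', sub_zero]
      · ext z
        exact ⟨fun hz => hz.1.2 hz.2, fun h' => h'.elim⟩
      · ext z
        exact ⟨fun hz => hΩF z hz.1.1 hz.2, fun h' => h'.elim⟩
    by_cases hxF : x ∈ frontier Ω
    · obtain ⟨V, hV, hxV, hVS, hg⟩ := h.gauss_near_boundary hΩ hL
        ⟨hxF, fun h' => hx ⟨h', hxF⟩⟩
      refine ⟨V, hV, hxV, fun δ hδ => ?_⟩
      rw [hg δ (hδ.mono inter_subset_right), hSz (hδ.mono inter_subset_right) hVS, sub_zero]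
    · have hxc : x ∈ (closure Ω)ᶜ := fun h' => by
        rw [hΩ.frontier_eq] at hxF
        exact hxF ⟨h', hxΩ⟩
      refine ⟨(closure Ω)ᶜ, isClosed_closure.isOpen_compl, hxc, fun δ hδ => ?_⟩
      have hδ' := hδ.mono inter_subset_right
      rw [hFz hδ', hSz hδ', sub_zero]
      · refine setIntegral_eq_zero_of_forall_eq_zero fun z hz => ?_
        obtain ⟨e1, e2⟩ := hδ'.eq_zero fun h' => h' (subset_closure hz)
        simp [e1, e2]
      · ext z
        exact ⟨fun hz => hz.1 (subset_closure (hS.subset hz.2)), fun h' => h'.elim⟩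
      · ext z
        exact ⟨fun hz => hz.1 (frontier_subset_closure hz.2), fun h' => h'.elim⟩

/-- Gauss's theorem for a vector field with a jump across a hypersurface. -/
theorem gauss (hn : 1 ≤ n) (hΩ : IsOpen Ω) (hΩb : Bornology.IsBounded Ω)
    (hL : HasLipschitzBoundary Ω) (hS : IsSurfaceIn Ω S) {δ : Eu n → ℝ} (hδ : IsTest univ δ) :
    ∫ z in Ω, (f z * δ z + fderiv ℝ δ z (q z))
      = (∫ x in frontier Ω, δ x * ⟪qb x, outerNormal Ω x⟫ ∂μHE[n - 1])
        - ∫ x in S, δ x * jmp x ∂μHE[n - 1] := by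
  have hE : IsCompact (closure S ∩ frontier Ω) :=
    (Metric.isCompact_of_isClosed_isBounded isClosed_frontier
      (hΩb.closure.subset frontier_subset_closure)).inter_left isClosed_closure
  -- The products δ χ_k avoid the exceptional set, so `gauss_of_isTest` applies to them and it
  -- remains to let k tend to infinity.
  obtain ⟨χ, χL, χI, χs, χ1, χ0⟩ := exists_cutoff hn hE hS.boundary_null
  have hδc : Continuous δ := hδ.lipschitz.choose_spec.continuous
  obtain ⟨M, hM⟩ := exists_bound_of_hasCompactSupport hδc hδ.compact
  have χb : ∀ k z, |χ k z| ≤ (1 : ℝ≥0) := fun k z => by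
    rw [abs_of_nonneg (χI k z).1]; exact (χI k z).2
  have χc : ∀ k, Continuous (χ k) := fun k => (χL k).choose_spec.continuous
  have ht : ∀ k, IsTest (closure S ∩ frontier Ω)ᶜ (fun z => δ z * χ k z) := fun k =>
    (hδ.mul (χL k) (χb k) (χs k)).mono inter_subset_right
  have hlim : ∀ z ∉ closure S ∩ frontier Ω, Tendsto (fun k => χ k z) atTop (𝓝 1) := fun z hz =>
    tendsto_const_nhds.congr' ((χ1 z hz).mono fun k hk => hk.symm)
  have gen : ∀ {μ : Measure (Eu n)} {F : Eu n → ℝ}, Integrable F μ →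
      (∀ᵐ z ∂μ, z ∉ closure S ∩ frontier Ω) →
      Tendsto (fun k => ∫ z, χ k z * F z ∂μ) atTop (𝓝 (∫ z, F z ∂μ)) := fun {μ F} hF hE' => by
    refine tendsto_integral_of_dominated_convergence (fun z => ‖F z‖) (fun k =>
      (χc k).aestronglyMeasurable.mul hF.aestronglyMeasurable) hF.norm (fun k => ae_of_all _
      fun z => ?_) ?_
    · rw [norm_mul]
      exact mul_le_of_le_one_left (norm_nonneg _) (χb k z)
    · filter_upwards [hE'] with z hz
      simpa using (hlim z hz).mul_const (F z)
  have hΩF : ∀ z ∈ Ω, z ∉ closure S ∩ frontier Ω := fun z hz h' => by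
    rw [hΩ.frontier_eq] at h'
    exact h'.2.2 hz
  obtain ⟨i1, j1⟩ := h.integrableOn_volume hΩ hS hδ
  have i3 : IntegrableOn (fun z => f z * δ z + fderiv ℝ δ z (q z)) Ω := i1.add j1
  have t1 := gen (μ := volume.restrict Ω) i3
    (by filter_upwards [ae_restrict_mem hΩ.measurableSet] with z hz using hΩF z hz)
  have t2 := gen (μ := (μHE[n - 1]).restrict (frontier Ω))
    ((h.integrableOn_boundary hΩb hL hS).bdd_mul (c := M) hδc.aestronglyMeasurable (ae_of_all _ hM))
    (ae_restrict_of_ae (measure_eq_zero_iff_ae_notMem.1 hS.boundary_null))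
  have t3 := gen (μ := (μHE[n - 1]).restrict S)
    ((h.integrableOn_jump hΩ hS).bdd_mul (c := M) hδc.aestronglyMeasurable (ae_of_all _ hM))
    (by filter_upwards [ae_restrict_mem (hS.measurableSet hΩ)] with z hz using hΩF z (hS.subset hz))
  have hΩS : ∀ᵐ z ∂volume.restrict Ω, z ∈ Ω \ S := by
    filter_upwards [ae_restrict_mem hΩ.measurableSet,
      ae_restrict_of_ae (measure_eq_zero_iff_ae_notMem.1 (hS.volume_eq_zero hΩ))] with z h1 h2
    exact ⟨h1, h2⟩
  -- The only new term carries ∇χ_k; it disappears because δ and q are bounded and ∇χ_k tends to 0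
  -- in L¹.
  have t4 : Tendsto (fun k => ∫ z in Ω, δ z * fderiv ℝ (χ k) z (q z)) atTop (𝓝 0) := by
    have u1 : Tendsto (fun k => (ENNReal.ofReal (M * C)
        * ∫⁻ z, ENNReal.ofReal ‖fderiv ℝ (χ k) z‖).toReal) atTop (𝓝 0) := by
      have := ENNReal.Tendsto.const_mul χ0 (Or.inr (ENNReal.ofReal_ne_top (r := M * C)))
      rw [mul_zero] at this
      exact (ENNReal.tendsto_toReal ENNReal.zero_ne_top).comp this
    have u2 : ∀ᶠ k in atTop, ENNReal.ofReal (M * C)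
        * ∫⁻ z, ENNReal.ofReal ‖fderiv ℝ (χ k) z‖ ≠ ⊤ := by
      filter_upwards [χ0.eventually (gt_mem_nhds ENNReal.zero_lt_top)] with k hk
      exact ENNReal.mul_ne_top ENNReal.ofReal_ne_top hk.ne
    refine squeeze_zero_norm' (u2.mono fun k hk => ?_) u1
    refine (norm_integral_le_lintegral_norm _).trans (ENNReal.toReal_mono hk ?_)
    rw [← lintegral_const_mul' _ _ ENNReal.ofReal_ne_top]
    refine (lintegral_mono_ae ?_).trans (setLIntegral_le_lintegral Ω _)
    filter_upwards [hΩS] with z hz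
    have hC0 : 0 ≤ C := (norm_nonneg _).trans (h.bound z hz)
    rw [← ENNReal.ofReal_mul (mul_nonneg M.coe_nonneg hC0)]
    refine ENNReal.ofReal_le_ofReal ?_
    rw [norm_mul]
    calc ‖δ z‖ * ‖fderiv ℝ (χ k) z (q z)‖ ≤ M * (‖fderiv ℝ (χ k) z‖ * C) := by
          gcongr
          · exact hM z
          · exact ((fderiv ℝ (χ k) z).le_opNorm _).trans
              (mul_le_mul_of_nonneg_left (h.bound z hz) (norm_nonneg _))
      _ = M * C * ‖fderiv ℝ (χ k) z‖ := by ring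
  have t5 : ∀ k, ∫ z in Ω, (f z * (δ z * χ k z) + fderiv ℝ (fun z => δ z * χ k z) z (q z))
      = (∫ z in Ω, χ k z * (f z * δ z + fderiv ℝ δ z (q z)))
        + ∫ z in Ω, δ z * fderiv ℝ (χ k) z (q z) := fun k => by
    obtain ⟨i2, j2⟩ := h.integrableOn_volume hΩ hS (ht k)
    have e1 : ∀ᵐ z ∂volume.restrict Ω, fderiv ℝ (fun z => δ z * χ k z) z (q z)
        = δ z * fderiv ℝ (χ k) z (q z) + χ k z * fderiv ℝ δ z (q z) := by
      refine ae_restrict_of_ae ?_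
      filter_upwards [hδ.lipschitz.choose_spec.ae_differentiableAt,
        (χL k).choose_spec.ae_differentiableAt] with z d1 d2
      rw [fderiv_fun_mul d1 d2]
      simp
    have i3 := i3.bdd_mul (c := 1) (χc k).aestronglyMeasurable (ae_of_all _ (χb k))
    have i4 : IntegrableOn (fun z => δ z * fderiv ℝ (χ k) z (q z)) Ω := by
      refine (j2.sub (j1.bdd_mul (c := 1) (χc k).aestronglyMeasurable (ae_of_all _ (χb k)))).congr ?_
      filter_upwards [e1] with z hz
      simp only [Pi.sub_apply]
      rw [hz]
      ring
    rw [← integral_add i3 i4]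
    refine integral_congr_ae ?_
    filter_upwards [e1] with z hz
    rw [hz]
    ring
  have t6 := fun k => h.gauss_of_isTest hΩ hΩb hL hS (ht k)
  have t7 := t1.add t4
  rw [add_zero] at t7
  refine tendsto_nhds_unique (t7.congr fun k => (t5 k).symm) ((t2.sub t3).congr fun k => ?_)
  rw [t6 k]
  congr 1 <;> exact integral_congr_ae (ae_of_all _ fun z => by beta_reduce; ring)

end FluxData

end GlobalGauss

/-! ### From smooth to Lipschitz test functions -/

section Mollification

open ContinuousLinearMap
open scoped Convolution

variable {n : ℕ}

theorem convolution_normed_apply (ρ : ContDiffBump (0 : Eu n)) (g : Eu n → ℝ) (x : Eu n) :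
    (ρ.normed volume ⋆[lsmul ℝ ℝ, volume] g) x = ∫ s, ρ.normed volume s * g (x - s) := rfl

theorem integrable_normed_mul (ρ : ContDiffBump (0 : Eu n)) {g : Eu n → ℝ} (hg : Continuous g) :
    Integrable (fun s => ρ.normed volume s * g s) :=
  (ρ.continuous_normed.mul hg).integrable_of_hasCompactSupport ρ.hasCompactSupport_normed.mul_right

theorem lipschitzWith_convolution_normed (ρ : ContDiffBump (0 : Eu n)) {δ : Eu n → ℝ} {L : ℝ≥0}
    (hδ : LipschitzWith L δ) :
    LipschitzWith L (ρ.normed volume ⋆[lsmul ℝ ℝ, volume] δ) := by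
  apply LipschitzWith.of_dist_le_mul
  intro x y
  have hi : ∀ x, Integrable (fun s => ρ.normed volume s * δ (x - s)) := fun x =>
    integrable_normed_mul ρ (hδ.continuous.comp (continuous_const.sub continuous_id))
  rw [convolution_normed_apply, convolution_normed_apply, dist_eq_norm,
    ← integral_sub (hi x) (hi y)]
  have h1 : ∀ s, ‖ρ.normed volume s * δ (x - s) - ρ.normed volume s * δ (y - s)‖
      ≤ ρ.normed volume s * (L * dist x y) := fun s => by
    rw [← mul_sub, norm_mul, Real.norm_of_nonneg (ρ.nonneg_normed s)]
    refine mul_le_mul_of_nonneg_left ?_ (ρ.nonneg_normed s)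
    have := hδ.dist_le_mul (x - s) (y - s)
    rwa [dist_sub_right, dist_eq_norm] at this
  refine (norm_integral_le_of_norm_le (ρ.integrable_normed.mul_const _) (ae_of_all _ h1)).trans ?_
  rw [integral_mul_const, ρ.integral_normed, one_mul]

/-- The derivative falls on the Lipschitz factor: its difference quotients are bounded by L‖v‖ and
converge almost everywhere by Rademacher's theorem, so differentiation under the integral is
allowed. -/
theorem fderiv_convolution_normed (ρ : ContDiffBump (0 : Eu n)) {δ : Eu n → ℝ} {L : ℝ≥0}
    (hδ : LipschitzWith L δ) (x v : Eu n) :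
    fderiv ℝ (ρ.normed volume ⋆[lsmul ℝ ℝ, volume] δ) x v
      = (ρ.normed volume ⋆[lsmul ℝ ℝ, volume] fun z => fderiv ℝ δ z v) x := by
  have hd : DifferentiableAt ℝ (ρ.normed volume ⋆[lsmul ℝ ℝ, volume] δ) x :=
    (ρ.hasCompactSupport_normed.contDiff_convolution_left (n := 1) _ ρ.contDiff_normed
      hδ.continuous.locallyIntegrable).differentiable one_ne_zero x
  have h1 : HasDerivAt (fun t : ℝ => (ρ.normed volume ⋆[lsmul ℝ ℝ, volume] δ) (x + t • v))
      (fderiv ℝ (ρ.normed volume ⋆[lsmul ℝ ℝ, volume] δ) x v) 0 := by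
    have := hd.hasFDerivAt.hasLineDerivAt v
    exact this
  refine h1.unique ?_
  simp only [convolution_normed_apply]
  have hcont : ∀ t : ℝ, Continuous fun s => δ (x + t • v - s) := fun t =>
    hδ.continuous.comp (continuous_const.sub continuous_id)
  refine (hasDerivAt_integral_of_dominated_loc_of_lip (s := univ)
    (F := fun t s => ρ.normed volume s * δ (x + t • v - s))
    (bound := fun s => ρ.normed volume s * (L * ‖v‖)) univ_mem
    (Eventually.of_forall fun t => (ρ.continuous_normed.mul (hcont t)).aestronglyMeasurable)
    (integrable_normed_mul ρ (hcont 0)) ?_ (ae_of_all _ fun s => ?_)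
    (ρ.integrable_normed.mul_const _) ?_).2
  · refine (ρ.continuous_normed.measurable.mul ?_).aestronglyMeasurable
    exact (measurable_fderiv_apply_const ℝ δ v).comp (measurable_const.sub measurable_id)
  · rw [lipschitzOnWith_univ]
    apply LipschitzWith.of_dist_le_mul
    intro t u
    have hn : 0 ≤ ρ.normed volume s * (L * ‖v‖) :=
      mul_nonneg (ρ.nonneg_normed s) (by positivity)
    rw [Real.coe_nnabs, abs_of_nonneg hn, Real.dist_eq, ← mul_sub, abs_mul,
      abs_of_nonneg (ρ.nonneg_normed s), mul_assoc]
    refine mul_le_mul_of_nonneg_left ?_ (ρ.nonneg_normed s)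
    have := hδ.dist_le_mul (x + t • v - s) (x + u • v - s)
    rw [dist_sub_right, dist_add_left, Real.dist_eq, dist_eq_norm, ← sub_smul, norm_smul] at this
    rw [Real.dist_eq]
    rw [Real.norm_eq_abs] at this
    linarith
  · have hq : Measure.QuasiMeasurePreserving (fun s : Eu n => x - s) volume volume :=
      quasiMeasurePreserving_sub_left volume x
    filter_upwards [hq.ae hδ.ae_differentiableAt] with s hs
    have h2 : HasDerivAt (fun t : ℝ => δ (x - s + t • v)) (fderiv ℝ δ (x - s) v) 0 :=
      hs.hasFDerivAt.hasLineDerivAt v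
    have h3 : (fun t : ℝ => δ (x + t • v - s)) = fun t : ℝ => δ (x - s + t • v) := by
      ext t
      rw [add_sub_right_comm]
    refine HasDerivAt.const_mul _ ?_
    rw [h3]
    exact h2

theorem fderiv_apply_eq_sum (ℓ : Eu n →L[ℝ] ℝ) (v : Eu n) :
    ℓ v = ∑ α, v α * ℓ (EuclideanSpace.single α 1) := by
  conv_lhs => rw [← (EuclideanSpace.basisFun (Fin n) ℝ).sum_repr v]
  simp

/-- A weak equation holds for Lipschitz test functions if it holds for smooth ones. -/
theorem weak_of_smooth {A : Set (Eu n)} (hA : IsOpen A) (hAb : Bornology.IsBounded A)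
    {q : Eu n → Eu n} {f : Eu n → ℝ} {C : ℝ} (hqm : AEStronglyMeasurable q (volume.restrict A))
    (hfm : AEStronglyMeasurable f (volume.restrict A))
    (hqb : ∀ᵐ z ∂volume.restrict A, ‖q z‖ ≤ C) (hfb : ∀ᵐ z ∂volume.restrict A, |f z| ≤ C)
    (hw : ∀ δ : Eu n → ℝ, ContDiff ℝ ∞ δ → HasCompactSupport δ → tsupport δ ⊆ A →
      ∫ z in A, (f z * δ z + fderiv ℝ δ z (q z)) = 0) {δ : Eu n → ℝ} (hδ : IsTest A δ) :
    ∫ z in A, (f z * δ z + fderiv ℝ δ z (q z)) = 0 := by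
  obtain ⟨L, hL⟩ := hδ.lipschitz
  obtain ⟨M, hM⟩ := exists_bound_of_hasCompactSupport hL.continuous hδ.compact
  -- The ratio of outer to inner radius stays equal to 2, as required for the almost everywhere
  -- convergence of the mollified derivatives.
  let ρ : ℕ → ContDiffBump (0 : Eu n) := fun k =>
    ⟨1 / (k + 1) / 2, 1 / (k + 1), by positivity, half_lt_self (by positivity)⟩
  have hρ0 : Tendsto (fun k => (ρ k).rOut) atTop (𝓝 0) := tendsto_one_div_add_atTop_nhds_zero_nat
  set η : ℕ → Eu n → ℝ := fun k => (ρ k).normed volume ⋆[lsmul ℝ ℝ, volume] δ with hη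
  have hηL : ∀ k, LipschitzWith L (η k) := fun k => lipschitzWith_convolution_normed (ρ k) hL
  have hηM : ∀ k z, |η k z| ≤ M := fun k z => by
    have h1 : ∀ s, ‖(ρ k).normed volume s * δ (z - s)‖ ≤ (ρ k).normed volume s * M := fun s => by
      rw [norm_mul, Real.norm_of_nonneg ((ρ k).nonneg_normed s)]
      exact mul_le_mul_of_nonneg_left (hM _) ((ρ k).nonneg_normed s)
    have h2 := norm_integral_le_of_norm_le ((ρ k).integrable_normed.mul_const _) (ae_of_all _ h1)
    rwa [integral_mul_const, (ρ k).integral_normed, one_mul] at h2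
  have hηs : ∀ k, ContDiff ℝ ∞ (η k) := fun k =>
    (ρ k).hasCompactSupport_normed.contDiff_convolution_left (n := ⊤) _ (ρ k).contDiff_normed
      hL.continuous.locallyIntegrable
  have hsupp : ∀ᶠ k in atTop, HasCompactSupport (η k) ∧ tsupport (η k) ⊆ A := by
    obtain ⟨r, hr, hrA⟩ := hδ.compact.exists_cthickening_subset_open hA hδ.subset
    filter_upwards [hρ0.eventually (gt_mem_nhds hr)] with k hk
    have h1 : tsupport (η k) ⊆ Metric.cthickening r (tsupport δ) := by
      refine closure_minimal (fun z hz => ?_) Metric.isClosed_cthickening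
      obtain ⟨a, ha, b, hb, rfl⟩ := support_convolution_subset (lsmul ℝ ℝ) hz
      rw [(ρ k).support_normed_eq, mem_ball_zero_iff] at ha
      refine Metric.mem_cthickening_of_dist_le _ b r _ (subset_tsupport _ hb) ?_
      rw [dist_eq_norm, add_sub_cancel_right]
      exact (ha.trans hk).le
    exact ⟨HasCompactSupport.of_support_subset_isCompact
      (hδ.compact.isCompact.cthickening) ((subset_tsupport _).trans h1), h1.trans hrA⟩
  have t1 : ∀ z, Tendsto (fun k => η k z) atTop (𝓝 (δ z)) := fun z =>
    ContDiffBump.convolution_tendsto_right_of_continuous hρ0 hL.continuous z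
  have t2 : ∀ᵐ z, ∀ α, Tendsto (fun k => fderiv ℝ (η k) z (EuclideanSpace.single α 1)) atTop
      (𝓝 (fderiv ℝ δ z (EuclideanSpace.single α 1))) := by
    rw [ae_all_iff]
    intro α
    have hloc : LocallyIntegrable (fun z => fderiv ℝ δ z (EuclideanSpace.single α 1)) := by
      have hb : ∀ z, ‖fderiv ℝ δ z (EuclideanSpace.single α 1)‖
          ≤ L * ‖(EuclideanSpace.single α 1 : Eu n)‖ := fun z =>
        ((fderiv ℝ δ z).le_opNorm _).trans (mul_le_mul_of_nonneg_right
          (norm_fderiv_le_of_lipschitz ℝ hL) (norm_nonneg _))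
      exact (locallyIntegrable_const (L * ‖(EuclideanSpace.single α 1 : Eu n)‖)).mono
        (measurable_fderiv_apply_const ℝ δ _).aestronglyMeasurable
        (ae_of_all _ fun z => (hb z).trans (le_abs_self _))
    filter_upwards [ContDiffBump.ae_convolution_tendsto_right_of_locallyIntegrable (φ := ρ)
      (K := 2) hρ0 (Eventually.of_forall fun k => by
        show (1 : ℝ) / (k + 1) ≤ 2 * (1 / (k + 1) / 2)
        linarith) hloc] with z hz
    simp only [hη, fderiv_convolution_normed _ hL]
    exact hz
  have : IsFiniteMeasure (volume.restrict A) := ⟨by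
    rw [Measure.restrict_apply_univ]
    exact hAb.measure_lt_top⟩
  -- The mollified gradients need not converge uniformly, but they are bounded by L and converge
  -- almost everywhere, which is enough on a set of finite measure.
  have lim := tendsto_integral_of_dominated_convergence (μ := volume.restrict A)
    (F := fun k z => f z * η k z + fderiv ℝ (η k) z (q z))
    (f := fun z => f z * δ z + fderiv ℝ δ z (q z)) (fun _ => C * M + L * C)
    (fun k => (hfm.mul (hηL k).continuous.aestronglyMeasurable).add
      (aestronglyMeasurable_fderiv_apply _ hqm)) (integrable_const _) (fun k => ?_) ?_
  · refine tendsto_nhds_unique lim (tendsto_const_nhds.congr' ?_)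
    filter_upwards [hsupp] with k hk
    exact (hw (η k) (hηs k) hk.1 hk.2).symm
  · filter_upwards [hqb, hfb] with z h1 h2
    have hC : 0 ≤ C := (norm_nonneg _).trans h1
    refine (norm_add_le _ _).trans (add_le_add ?_ ?_)
    · rw [norm_mul]
      exact mul_le_mul h2 (hηM k z) (norm_nonneg _) hC
    · exact ((fderiv ℝ (η k) z).le_opNorm _).trans (mul_le_mul
        (norm_fderiv_le_of_lipschitz ℝ (hηL k)) h1 (norm_nonneg _) L.coe_nonneg)
  · filter_upwards [ae_restrict_of_ae t2] with z hz
    refine ((t1 z).const_mul _).add ?_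
    simp only [fderiv_apply_eq_sum _ (q z)]
    exact tendsto_finsetSum _ fun α _ => (hz α).const_mul _

end Mollification

/-! ### Algebra of the Piola and Eshelby tensors -/

section Tensors

variable {n m : ℕ} {W : Jet n m → ℝ} {j : Jet n m}

theorem grad_eq_sum (G : Grad n m) : G = ∑ i, ∑ α, gradMatrix G i α • unitGrad i α := by
  ext v k
  have h1 : (G v) k = ∑ α, v α * gradMatrix G k α :=
    fderiv_apply_eq_sum ((EuclideanSpace.proj k : Eu m →L[ℝ] ℝ).comp G) v
  rw [h1]
  simp [unitGrad, Finset.sum_apply, Pi.single_apply, mul_comm]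

theorem frob_eq_sum {k l : ℕ} (A B : Matrix (Fin k) (Fin l) ℝ) :
    frob A B = ∑ i, ∑ α, A i α * B i α := by
  rw [frob, Matrix.trace, Finset.sum_comm]
  rfl

theorem fderiv_grad_eq_frob (G : Grad n m) :
    fderiv ℝ W j (0, 0, G) = frob (piola W j) (gradMatrix G) := by
  set T := (fderiv ℝ W j).comp
    ((ContinuousLinearMap.inr ℝ (Eu n) (Eu m × Grad n m)).comp
      (ContinuousLinearMap.inr ℝ (Eu m) (Grad n m)))
  change T G = _
  rw [frob_eq_sum]
  conv_lhs => rw [grad_eq_sum G]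
  simp only [map_sum, map_smul, smul_eq_mul]
  refine Finset.sum_congr rfl fun i _ => Finset.sum_congr rfl fun α _ => ?_
  rw [mul_comm]
  rfl

theorem frob_gradMatrix_smulRight {k l : ℕ} (M : Matrix (Fin k) (Fin l) ℝ) (ℓ : Eu l →L[ℝ] ℝ)
    (a : Eu k) : frob M (gradMatrix (ℓ.smulRight a)) = ℓ (Matrix.toEuclideanLin Mᵀ a) := by
  rw [fderiv_apply_eq_sum ℓ, frob_eq_sum, Finset.sum_comm]
  refine Finset.sum_congr rfl fun α _ => ?_
  simp only [gradMatrix, Matrix.of_apply, ContinuousLinearMap.smulRight_apply, PiLp.smul_apply,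
    smul_eq_mul, Matrix.toLpLin_apply, Matrix.mulVec, dotProduct, Matrix.transpose_apply,
    Finset.sum_mul]
  exact Finset.sum_congr rfl fun i _ => by ring

theorem inner_toEuclideanLin {k l : ℕ} (M : Matrix (Fin k) (Fin l) ℝ) (v : Eu l) (a : Eu k) :
    ⟪Matrix.toEuclideanLin M v, a⟫ = ⟪Matrix.toEuclideanLin Mᵀ a, v⟫ := by
  simp only [PiLp.inner_apply, Matrix.toLpLin_apply, Matrix.mulVec, dotProduct,
    Matrix.transpose_apply, RCLike.inner_apply, conj_trivial, Finset.mul_sum]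
  rw [Finset.sum_comm]
  exact Finset.sum_congr rfl fun i _ => Finset.sum_congr rfl fun i _ => by ring

theorem fderiv_split (u : Eu n) (v : Eu m) (G : Grad n m) :
    fderiv ℝ W j (u, v, G)
      = fderiv ℝ W j (u, 0, 0) + fderiv ℝ W j (0, v, 0) + fderiv ℝ W j (0, 0, G) := by
  rw [← map_add, ← map_add]
  simp

theorem sum_fderiv_vec (a : Eu m) :
    ∑ i, a i * fderiv ℝ W j (0, EuclideanSpace.single i 1, 0) = fderiv ℝ W j (0, a, 0) := by
  set T := (fderiv ℝ W j).comp
    ((ContinuousLinearMap.inr ℝ (Eu n) (Eu m × Grad n m)).comp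
      (ContinuousLinearMap.inl ℝ (Eu m) (Grad n m)))
  change ∑ i, a i * T (EuclideanSpace.single i 1) = T a
  exact (fderiv_apply_eq_sum T a).symm

theorem sum_fderiv_grad (G : Grad n m) :
    ∑ i, fderiv ℝ W j (0, 0, ((EuclideanSpace.proj i : Eu m →L[ℝ] ℝ).comp G).smulRight
      (EuclideanSpace.single i 1 : Eu m)) = fderiv ℝ W j (0, 0, G) := by
  set T := (fderiv ℝ W j).comp
    ((ContinuousLinearMap.inr ℝ (Eu n) (Eu m × Grad n m)).comp
      (ContinuousLinearMap.inr ℝ (Eu m) (Grad n m)))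
  change ∑ i, T _ = T G
  rw [← map_sum]
  congr 1
  ext v k
  simp [Finset.sum_apply, Pi.single_apply]

/-- The vector `Pᵀ a`. -/
def piolaT (W : Jet n m → ℝ) (j : Jet n m) (a : Eu m) : Eu n :=
  Matrix.toEuclideanLin (piola W j)ᵀ a

/-- The vector `P*ᵀ v = W v - Pᵀ F v`. -/
def eshelbyT (W : Jet n m → ℝ) (j : Jet n m) (v : Eu n) : Eu n :=
  W j • v - piolaT W j (j.2.2 v)

/-- With ℓ = ∇δ this identifies ∇δ·Pᵀa with the derivative of W in the direction ∇(δ a). It turns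
the tensor equations into scalar equations, one for each constant vector a. -/
theorem apply_piolaT (ℓ : Eu n →L[ℝ] ℝ) (a : Eu m) :
    ℓ (piolaT W j a) = fderiv ℝ W j (0, 0, ℓ.smulRight a) := by
  rw [fderiv_grad_eq_frob, frob_gradMatrix_smulRight, piolaT]

theorem piolaT_eq_sum (a : Eu m) :
    piolaT W j a = ∑ i, a i • piolaT W j (EuclideanSpace.single i 1) := by
  unfold piolaT
  conv_lhs => rw [← (EuclideanSpace.basisFun (Fin m) ℝ).sum_repr a]
  simp

theorem toEuclideanLin_gradMatrix (F : Grad n m) (v : Eu n) :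
    Matrix.toEuclideanLin (gradMatrix F) v = F v := by
  ext i
  have h1 : (F v) i = ∑ α, v α * gradMatrix F i α :=
    fderiv_apply_eq_sum ((EuclideanSpace.proj i : Eu m →L[ℝ] ℝ).comp F) v
  rw [h1]
  simp [Matrix.toLpLin_apply, Matrix.mulVec, dotProduct, mul_comm]

theorem toEuclideanLin_eshelby (v : Eu n) :
    Matrix.toEuclideanLin (eshelby W j)ᵀ v = eshelbyT W j v := by
  rw [eshelby, eshelbyT, piolaT, ← toEuclideanLin_gradMatrix j.2.2 v]
  ext i
  simp [Matrix.toLpLin_apply]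

theorem inner_piola (a : Eu m) (v : Eu n) :
    ⟪Matrix.toEuclideanLin (piola W j) v, a⟫ = ⟪piolaT W j a, v⟫ := inner_toEuclideanLin _ _ _

theorem inner_eshelby (u v : Eu n) :
    ⟪Matrix.toEuclideanLin (eshelby W j) v, u⟫ = ⟪eshelbyT W j u, v⟫ := by
  rw [inner_toEuclideanLin, toEuclideanLin_eshelby]

theorem frob_eshelby_smulRight (ℓ : Eu n →L[ℝ] ℝ) (v : Eu n) :
    frob (eshelby W j) (gradMatrix (ℓ.smulRight v)) = ℓ (eshelbyT W j v) := by
  rw [frob_gradMatrix_smulRight, toEuclideanLin_eshelby]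

theorem continuousOn_fderiv_energy {U : Set (Jet n m)} (hU : IsOpen U) (hW : ContDiffOn ℝ 1 W U) :
    ContinuousOn (fderiv ℝ W) U := hW.continuousOn_fderiv_of_isOpen hU le_rfl

theorem continuousOn_piolaT {U : Set (Jet n m)} (hU : IsOpen U) (hW : ContDiffOn ℝ 1 W U)
    {X : Type*} [TopologicalSpace X] {A : Set X} {p : X → Jet n m} {a : X → Eu m}
    (hp : ContinuousOn p A) (ha : ContinuousOn a A) (hpU : ∀ x ∈ A, p x ∈ U) :
    ContinuousOn (fun x => piolaT W (p x) (a x)) A := by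
  have h1 : ∀ x, piolaT W (p x) (a x) = ∑ α, (fderiv ℝ W (p x) (0, 0,
      (EuclideanSpace.proj α : Eu n →L[ℝ] ℝ).smulRight (a x)))
        • (EuclideanSpace.single α 1 : Eu n) := fun x => by
    conv_lhs => rw [← (EuclideanSpace.basisFun (Fin n) ℝ).sum_repr (piolaT W (p x) (a x))]
    refine Finset.sum_congr rfl fun α _ => ?_
    rw [← apply_piolaT]
    simp
  simp only [h1]
  refine continuousOn_finsetSum _ fun α _ => ContinuousOn.fun_smul ?_ continuousOn_const
  refine ((continuousOn_fderiv_energy hU hW).comp hp hpU).clm_apply ?_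
  refine continuousOn_const.prodMk (continuousOn_const.prodMk ?_)
  exact ((ContinuousLinearMap.smulRightL ℝ (Eu n) (Eu m)
    (EuclideanSpace.proj α)).continuous.comp_continuousOn ha)

theorem continuousOn_eshelbyT {U : Set (Jet n m)} (hU : IsOpen U) (hW : ContDiffOn ℝ 1 W U)
    {X : Type*} [TopologicalSpace X] {A : Set X} {p : X → Jet n m} {v : X → Eu n}
    (hp : ContinuousOn p A) (hv : ContinuousOn v A) (hpU : ∀ x ∈ A, p x ∈ U) :
    ContinuousOn (fun x => eshelbyT W (p x) (v x)) A :=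
  ((hW.continuousOn.comp hp hpU).smul hv).sub
    (continuousOn_piolaT hU hW hp ((continuous_snd.comp continuous_snd).comp_continuousOn hp |>.clm_apply
      hv) hpU)

end Tensors

/-! ### Weak equations satisfied by the rows of P and P* -/

section Configuration

variable {n m : ℕ}

/-- A test function stays one after multiplication by a function of class `C¹`. -/
theorem IsTest.mul_contDiffOn {A : Set (Eu n)} {δ : Eu n → ℝ} (hδ : IsTest A δ) (hA : IsOpen A)
    {h : Eu n → ℝ} (hh : ContDiffOn ℝ 1 h A) : IsTest A (fun z => δ z * h z) := by
  obtain ⟨K, hK, hδK, hKA⟩ := exists_compact_between hδ.compact hA hδ.subset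
  obtain ⟨χ, h1, h0, -⟩ := exists_contMDiffMap_one_nhds_of_subset_interior (n := 1)
    (modelWithCornersSelf ℝ (Eu n)) (isClosed_tsupport δ) hδK
  have hχ : ContDiff ℝ 1 χ := contMDiff_iff_contDiff.1 χ.contMDiff
  have hsK : tsupport χ ⊆ K :=
    closure_minimal (fun z hz => by_contra fun h' => hz (h0 z h')) hK.isClosed
  have hs : tsupport (fun z => χ z * h z) ⊆ A := tsupport_mul_subset_left.trans (hsK.trans hKA)
  have hc : HasCompactSupport (fun z => χ z * h z) :=
    HasCompactSupport.of_support_subset_isCompact hK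
      ((subset_tsupport _).trans (tsupport_mul_subset_left.trans hsK))
  have hd : ContDiff ℝ 1 (fun z => χ z * h z) := by
    rw [contDiff_iff_contDiffAt]
    intro z
    by_cases hz : z ∈ A
    · exact hχ.contDiffAt.mul (hh.contDiffAt (hA.mem_nhds hz))
    · have : (fun z => χ z * h z) =ᶠ[𝓝 z] 0 :=
        notMem_tsupport_iff_eventuallyEq.1 fun h' => hz (hs h')
      exact contDiffAt_const.congr_of_eventuallyEq this
  obtain ⟨M, hM⟩ := exists_bound_of_hasCompactSupport hd.continuous hc
  have := (hδ.mul (ContDiff.lipschitzWith_of_hasCompactSupport hc hd one_ne_zero) hM hs).mono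
    inter_subset_left
  convert this using 2 with z
  by_cases hz : z ∈ tsupport δ
  · rw [h1.self_of_nhdsSet z hz, one_mul]
  · rw [image_eq_zero_of_notMem_tsupport hz, zero_mul, zero_mul]

theorem IsTest.integral_fderiv_eq_zero {A : Set (Eu n)} {δ : Eu n → ℝ} (hδ : IsTest A δ)
    (v : Eu n) : ∫ z, fderiv ℝ δ z v = 0 := by
  obtain ⟨L, hL⟩ := hδ.lipschitz
  have := LipschitzWith.integral_lineDeriv_mul_eq (μ := volume) (LipschitzWith.const (1 : ℝ))
    hL hδ.compact (-v)
  simp only [neg_neg, mul_one] at this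
  rw [← integral_congr_ae (f := fun z => lineDeriv ℝ δ z v), ← this]
  · simp [lineDeriv]
  · filter_upwards [hL.ae_differentiableAt] with z hz
    exact hz.lineDeriv_eq_fderiv

/-- The data of a piecewise `C²` Lipschitz configuration and an energy density around it. -/
structure IsConfiguration (Ω S : Set (Eu n)) (y : Eu n → Eu m) (W : Jet n m → ℝ)
    (U : Set (Jet n m)) : Prop where
  isOpen : IsOpen Ω
  isBounded : Bornology.IsBounded Ω
  surface : IsSurfaceIn Ω S
  lipschitz : ∃ K : ℝ≥0, LipschitzOnWith K y (closure Ω)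
  piecewise : IsPiecewiseC2 Ω S y
  isOpen_jets : IsOpen U
  energy : ContDiffOn ℝ 1 W U
  subset : closure (jet y '' (Ω \ S)) ⊆ U

namespace IsConfiguration

variable {Ω S : Set (Eu n)} {y : Eu n → Eu m} {W : Jet n m → ℝ} {U : Set (Jet n m)}
  (h : IsConfiguration Ω S y W U)
include h

theorem isOpen_diff : IsOpen (Ω \ S) := h.surface.isOpen_diff h.isOpen

theorem contDiffOn_fderiv : ContDiffOn ℝ 1 (fderiv ℝ y) (Ω \ S) :=
  h.piecewise.contDiffOn.fderiv_of_isOpen h.isOpen_diff (by norm_num)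

theorem contDiffOn_jet : ContDiffOn ℝ 1 (jet y) (Ω \ S) :=
  contDiffOn_id.prodMk ((h.piecewise.contDiffOn.of_le (by norm_num)).prodMk h.contDiffOn_fderiv)

theorem jet_mem {x : Eu n} (hx : x ∈ Ω \ S) : jet y x ∈ U :=
  h.subset (subset_closure (mem_image_of_mem _ hx))

/-- The Lipschitz constant of y bounds ∇y, so all jets stay in a bounded set. This is the source of
the uniform bounds on W and its derivatives. -/
theorem isCompact_jets : IsCompact (closure (jet y '' (Ω \ S))) := by
  obtain ⟨K, hK⟩ := h.lipschitz
  refine Bornology.IsBounded.isCompact_closure ?_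
  have h1 : Bornology.IsBounded (y '' Ω) :=
    (h.isBounded.isCompact_closure.image_of_continuousOn hK.continuousOn).isBounded.subset
      (image_mono subset_closure)
  refine (h.isBounded.prod (h1.prod (Metric.isBounded_closedBall (x := (0 : Grad n m))
    (r := K)))).subset ?_
  rintro _ ⟨x, hx, rfl⟩
  refine ⟨hx.1, mem_image_of_mem _ hx.1, ?_⟩
  rw [mem_closedBall_zero_iff]
  exact norm_fderiv_le_of_lipschitzOn ℝ (h.isOpen.mem_nhds hx.1) (hK.mono subset_closure)

theorem exists_bound {E : Type*} [NormedAddCommGroup E] {G : Jet n m → E} (hG : ContinuousOn G U) :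
    ∃ C, ∀ z ∈ Ω \ S, ‖G (jet y z)‖ ≤ C := by
  obtain ⟨C, hC⟩ := h.isCompact_jets.exists_bound_of_continuousOn (hG.mono h.subset)
  exact ⟨C, fun z hz => hC _ (subset_closure (mem_image_of_mem _ hz))⟩

theorem continuousOn_comp_jet {E : Type*} [TopologicalSpace E] {G : Jet n m → E}
    (hG : ContinuousOn G U) : ContinuousOn (fun z => G (jet y z)) (Ω \ S) :=
  hG.comp h.contDiffOn_jet.continuousOn fun _ hz => h.jet_mem hz

theorem ae_mem_diff : ∀ᵐ z ∂volume.restrict Ω, z ∈ Ω \ S := by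
  filter_upwards [ae_restrict_mem h.isOpen.measurableSet,
    ae_restrict_of_ae (measure_eq_zero_iff_ae_notMem.1 (h.surface.volume_eq_zero h.isOpen))]
    with z h1 h2
  exact ⟨h1, h2⟩

theorem aestronglyMeasurable {E : Type*} [TopologicalSpace E] [TopologicalSpace.PseudoMetrizableSpace E]
    [SecondCountableTopology E] {F : Eu n → E}
    (hF : ContinuousOn F (Ω \ S)) : AEStronglyMeasurable F (volume.restrict Ω) := by
  have h1 := hF.aestronglyMeasurable (μ := volume) h.isOpen_diff.measurableSet
  rwa [Measure.restrict_congr_set (sdiff_null_ae_eq_self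
    (h.surface.volume_eq_zero h.isOpen))] at h1

theorem continuousOn_dir (u : Eu n) (v : Eu m) (F : Grad n m) :
    ContinuousOn (fun j => fderiv ℝ W j (u, v, F)) U :=
  (continuousOn_fderiv_energy h.isOpen_jets h.energy).clm_apply continuousOn_const

theorem continuousOn_row (a : Eu m) : ContinuousOn (fun j => piolaT W j a) U :=
  continuousOn_piolaT h.isOpen_jets h.energy (p := fun j => j) continuousOn_id
    continuousOn_const fun _ hx => hx

theorem continuousOn_row' (v : Eu n) : ContinuousOn (fun j => eshelbyT W j v) U :=
  continuousOn_eshelbyT h.isOpen_jets h.energy (p := fun j => j) continuousOn_id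
    continuousOn_const fun _ hx => hx

/-- Test the Euler–Lagrange equation with δ a for smooth δ, then pass to Lipschitz δ by
`weak_of_smooth`. -/
theorem extremal_weak (hext : IsExtremal W Ω y) (a : Eu m) {δ : Eu n → ℝ} (hδ : IsTest Ω δ) :
    ∫ z in Ω, (fderiv ℝ W (jet y z) (0, a, 0) * δ z + fderiv ℝ δ z (piolaT W (jet y z) a)) = 0 := by
  have c1 := h.continuousOn_row a
  have c2 := h.continuousOn_dir 0 a 0
  obtain ⟨C₁, hC₁⟩ := h.exists_bound c1
  obtain ⟨C₂, hC₂⟩ := h.exists_bound c2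
  refine weak_of_smooth h.isOpen h.isBounded (C := max C₁ C₂)
    (h.aestronglyMeasurable (h.continuousOn_comp_jet c1))
    (h.aestronglyMeasurable (h.continuousOn_comp_jet c2)) ?_ ?_ (fun δ h1 h2 h3 => ?_) hδ
  · filter_upwards [h.ae_mem_diff] with z hz using (hC₁ z hz).trans (le_max_left _ _)
  · filter_upwards [h.ae_mem_diff] with z hz using (hC₂ z hz).trans (le_max_right _ _)
  · have := hext (fun z => δ z • a) (h1.smul contDiff_const) h2.smul_right
      ((tsupport_smul_subset_left _ _).trans h3)
    rw [← this]
    refine integral_congr_ae (ae_of_all _ fun z => ?_)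
    have h4 : fderiv ℝ (fun z => δ z • a) z = (fderiv ℝ δ z).smulRight a := by
      rw [fderiv_smul_const (h1.differentiable (by simp) z)]
    have h5 : ((0, δ z • a, 0) : Jet n m) = δ z • (0, a, 0) :=
      Prod.ext (smul_zero _).symm (Prod.ext rfl (smul_zero (A := Grad n m) (δ z)).symm)
    beta_reduce
    rw [h4, ← fderiv_grad_eq_frob, ← apply_piolaT, h5, map_smul, smul_eq_mul, mul_comm]

theorem stationary_weak (hst : IsStationary W Ω y) (v : Eu n) {δ : Eu n → ℝ} (hδ : IsTest Ω δ) :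
    ∫ z in Ω, (fderiv ℝ W (jet y z) (v, 0, 0) * δ z + fderiv ℝ δ z (eshelbyT W (jet y z) v)) = 0 := by
  have c1 := h.continuousOn_row' v
  have c2 := h.continuousOn_dir v 0 0
  obtain ⟨C₁, hC₁⟩ := h.exists_bound c1
  obtain ⟨C₂, hC₂⟩ := h.exists_bound c2
  refine weak_of_smooth h.isOpen h.isBounded (C := max C₁ C₂)
    (h.aestronglyMeasurable (h.continuousOn_comp_jet c1))
    (h.aestronglyMeasurable (h.continuousOn_comp_jet c2)) ?_ ?_ (fun δ h1 h2 h3 => ?_) hδ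
  · filter_upwards [h.ae_mem_diff] with z hz using (hC₁ z hz).trans (le_max_left _ _)
  · filter_upwards [h.ae_mem_diff] with z hz using (hC₂ z hz).trans (le_max_right _ _)
  · have := hst.2 (fun z => δ z • v) (h1.smul contDiff_const) h2.smul_right
      ((tsupport_smul_subset_left _ _).trans h3)
    rw [← this]
    refine integral_congr_ae (ae_of_all _ fun z => ?_)
    have h4 : fderiv ℝ (fun z => δ z • v) z = (fderiv ℝ δ z).smulRight v := by
      rw [fderiv_smul_const (h1.differentiable (by simp) z)]
    have h5 : ((δ z • v, 0, 0) : Jet n m) = δ z • (v, 0, 0) :=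
      Prod.ext rfl (Prod.ext (smul_zero _).symm (smul_zero (A := Grad n m) (δ z)).symm)
    beta_reduce
    rw [h4, frob_eshelby_smulRight, h5, map_smul, smul_eq_mul, mul_comm]

theorem integrableOn_pairing {G : Jet n m → Eu n} {H : Jet n m → ℝ} (hG : ContinuousOn G U)
    (hH : ContinuousOn H U) {A : Set (Eu n)} {δ : Eu n → ℝ} (hδ : IsTest A δ) :
    IntegrableOn (fun z => H (jet y z) * δ z + fderiv ℝ δ z (G (jet y z))) Ω := by
  obtain ⟨C₁, hC₁⟩ := h.exists_bound hG
  obtain ⟨C₂, hC₂⟩ := h.exists_bound hH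
  have hm := h.isOpen_diff.measurableSet
  have := GenNoether.integrableOn_pairing hm (C := max C₁ C₂)
    ((h.continuousOn_comp_jet hG).aestronglyMeasurable hm)
    ((h.continuousOn_comp_jet hH).aestronglyMeasurable hm)
    (fun z hz => (hC₁ z hz).trans (le_max_left _ _))
    (fun z hz => (hC₂ z hz).trans (le_max_right _ _)) hδ.lipschitz hδ.compact
  rw [← integrableOn_congr_set_ae (sdiff_null_ae_eq_self (h.surface.volume_eq_zero h.isOpen))]
  exact this.1.add this.2

/-- Noether's identity off the surface: an extremal of class `C²` is stationary. -/
theorem noether_weak (hext : IsExtremal W Ω y) (v : Eu n) {δ : Eu n → ℝ}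
    (hδ : IsTest (Ω \ S) δ) :
    ∫ z in Ω, (fderiv ℝ W (jet y z) (v, 0, 0) * δ z + fderiv ℝ δ z (eshelbyT W (jet y z) v)) = 0 := by
  set e : Fin m → Eu m := fun i => EuclideanSpace.single i 1
  have hF : ∀ i, ContDiffOn ℝ 1 (fun z => (fderiv ℝ y z v) i) (Ω \ S) := fun i =>
    ((EuclideanSpace.proj i : Eu m →L[ℝ] ℝ).contDiff.comp_contDiffOn
      (h.contDiffOn_fderiv.clm_apply contDiffOn_const))
  -- The variation that moves the configuration along itself is ψ = δ ∂_v y. Its components are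
  -- Lipschitz because y is C² off S.
  have hψ : ∀ i, IsTest (Ω \ S) (fun z => δ z * (fderiv ℝ y z v) i) := fun i =>
    hδ.mul_contDiffOn h.isOpen_diff (hF i)
  have hWj : ContDiffOn ℝ 1 (fun z => W (jet y z)) (Ω \ S) :=
    h.energy.comp h.contDiffOn_jet fun z hz => h.jet_mem hz
  have hη := hδ.mul_contDiffOn h.isOpen_diff hWj
  have I1 : ∀ i, IntegrableOn (fun z => fderiv ℝ W (jet y z) (0, e i, 0) * (δ z * (fderiv ℝ y z v) i)
      + fderiv ℝ (fun z => δ z * (fderiv ℝ y z v) i) z (piolaT W (jet y z) (e i))) Ω := fun i =>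
    h.integrableOn_pairing (h.continuousOn_row (e i)) (h.continuousOn_dir 0 (e i) 0) (hψ i)
  have I2 : IntegrableOn (fun z => 0 * (δ z * W (jet y z))
      + fderiv ℝ (fun z => δ z * W (jet y z)) z v) Ω :=
    h.integrableOn_pairing (G := fun _ => v) (H := fun _ => 0) continuousOn_const
      continuousOn_const hη
  simp only [zero_mul, zero_add] at I2
  have E1 : ∑ i, ∫ z in Ω, (fderiv ℝ W (jet y z) (0, e i, 0) * (δ z * (fderiv ℝ y z v) i)
      + fderiv ℝ (fun z => δ z * (fderiv ℝ y z v) i) z (piolaT W (jet y z) (e i))) = 0 :=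
    Finset.sum_eq_zero fun i _ => h.extremal_weak hext (e i) ((hψ i).mono sdiff_subset)
  -- The total derivative ∂_v (δ W(jet)) has compact support in Ω \ S, so its integral vanishes.
  -- Subtracting the equation tested with ψ leaves the claim.
  have E2 : ∫ z in Ω, fderiv ℝ (fun z => δ z * W (jet y z)) z v = 0 := by
    rw [setIntegral_eq_integral_of_forall_compl_eq_zero, hη.integral_fderiv_eq_zero v]
    intro z hz
    rw [(hη.eq_zero fun h' => hz h'.1).2]
    rfl
  rw [← integral_finsetSum _ fun i _ => I1 i] at E1
  have E3 := congrArg₂ (· - ·) E2 E1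
  beta_reduce at E3
  rw [← integral_sub I2 (integrable_finsetSum _ fun i _ => I1 i), sub_zero] at E3
  rw [← E3]
  obtain ⟨L, hL⟩ := hδ.lipschitz
  refine integral_congr_ae ?_
  filter_upwards [h.ae_mem_diff, ae_restrict_of_ae hL.ae_differentiableAt] with z hz hd
  have hzn := h.isOpen_diff.mem_nhds hz
  have hUn := h.isOpen_jets.mem_nhds (h.jet_mem hz)
  set D := fderiv ℝ (fderiv ℝ y) z
  have dF : HasFDerivAt (fderiv ℝ y) D z :=
    ((h.contDiffOn_fderiv.differentiableOn one_ne_zero).differentiableAt hzn).hasFDerivAt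
  have dy : HasFDerivAt y (fderiv ℝ y z) z :=
    ((h.piecewise.contDiffOn.differentiableOn two_ne_zero).differentiableAt hzn).hasFDerivAt
  have dW : HasFDerivAt W (fderiv ℝ W (jet y z)) (jet y z) :=
    ((h.energy.differentiableOn one_ne_zero).differentiableAt hUn).hasFDerivAt
  have dj : HasFDerivAt (jet y) _ z := (hasFDerivAt_id z).prodMk (dy.prodMk dF)
  have dWj : HasFDerivAt (fun z => W (jet y z)) _ z := dW.comp z dj
  -- Symmetry of the second derivative turns ∇(∂_v y) into ∂_v(∇y), so the terms with second
  -- derivatives of y cancel.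
  have hsym : ∀ w, D w v = D v w := fun w =>
    ((h.piecewise.contDiffOn.contDiffAt hzn).isSymmSndFDerivAt (by simp)).eq w v
  have dFi : ∀ i, HasFDerivAt (fun z => (fderiv ℝ y z v) i)
      ((EuclideanSpace.proj i : Eu m →L[ℝ] ℝ).comp (D v)) z := fun i => by
    have h1 := (EuclideanSpace.proj i : Eu m →L[ℝ] ℝ).hasFDerivAt.comp z
      (dF.clm_apply (hasFDerivAt_const v z))
    convert! h1 using 1
    ext w
    simp [hsym]
  have e1 : fderiv ℝ (fun z => δ z * W (jet y z)) z v
      = δ z * fderiv ℝ W (jet y z) (v, fderiv ℝ y z v, D v) + W (jet y z) * fderiv ℝ δ z v := by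
    rw [(hd.hasFDerivAt.fun_mul dWj).fderiv]
    rfl
  have e2 : ∀ i, fderiv ℝ (fun z => δ z * (fderiv ℝ y z v) i) z (piolaT W (jet y z) (e i))
      = δ z * fderiv ℝ W (jet y z) (0, 0, ((EuclideanSpace.proj i : Eu m →L[ℝ] ℝ).comp (D v)).smulRight
          (e i)) + (fderiv ℝ y z v) i * fderiv ℝ δ z (piolaT W (jet y z) (e i)) := fun i => by
    rw [(hd.hasFDerivAt.fun_mul (dFi i)).fderiv, ← apply_piolaT]
    rfl
  have e3 : ∑ i, fderiv ℝ W (jet y z) (0, 0, ((EuclideanSpace.proj i : Eu m →L[ℝ] ℝ).comp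
      (D v)).smulRight (e i)) = fderiv ℝ W (jet y z) (0, 0, D v) := by
    rw [← sum_fderiv_grad (D v)]
  have e4 : ∑ i, fderiv ℝ W (jet y z) (0, e i, 0) * (fderiv ℝ y z v) i
      = fderiv ℝ W (jet y z) (0, fderiv ℝ y z v, 0) := by
    rw [← sum_fderiv_vec (fderiv ℝ y z v)]
    exact Finset.sum_congr rfl fun i _ => mul_comm _ _
  have e5 : ∑ i, (fderiv ℝ y z v) i * fderiv ℝ δ z (piolaT W (jet y z) (e i))
      = fderiv ℝ δ z (piolaT W (jet y z) (fderiv ℝ y z v)) := by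
    rw [piolaT_eq_sum (fderiv ℝ y z v), map_sum]
    simp only [map_smul, smul_eq_mul]
    rfl
  have e6 : ∑ i, (fderiv ℝ W (jet y z) (0, e i, 0) * (δ z * (fderiv ℝ y z v) i)
      + fderiv ℝ (fun z => δ z * (fderiv ℝ y z v) i) z (piolaT W (jet y z) (e i)))
      = δ z * fderiv ℝ W (jet y z) (0, fderiv ℝ y z v, 0) + δ z * fderiv ℝ W (jet y z) (0, 0, D v)
        + fderiv ℝ δ z (piolaT W (jet y z) (fderiv ℝ y z v)) := by
    rw [← e3, ← e4, ← e5, Finset.mul_sum, Finset.mul_sum, ← Finset.sum_add_distrib,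
      ← Finset.sum_add_distrib]
    exact Finset.sum_congr rfl fun i _ => by rw [e2]; ring
  have e7 : fderiv ℝ δ z (eshelbyT W (jet y z) v) = W (jet y z) * fderiv ℝ δ z v
      - fderiv ℝ δ z (piolaT W (jet y z) (fderiv ℝ y z v)) := by
    rw [eshelbyT, map_sub, map_smul, smul_eq_mul]
    rfl
  rw [e1, e6, e7, fderiv_split v (fderiv ℝ y z v) (D v)]
  ring

end IsConfiguration

end Configuration

/-! ### Unit normals of the surface and the fundamental lemma on it -/

section Sides

variable {n m : ℕ} {Ω S V : Set (Eu n)} {g : Eu n → ℝ} {x : Eu n}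

theorem eventually_pos_of_hasDerivAt {f : ℝ → ℝ} {c : ℝ} (hf : HasDerivAt f c 0) (hc : 0 < c)
    (h0 : f 0 = 0) : ∀ᶠ t in 𝓝[>] 0, 0 < f t := by
  have h1 : Tendsto (_root_.slope f 0) (𝓝[>] 0) (𝓝 c) :=
    (hasDerivAt_iff_tendsto_slope.1 hf).mono_left (nhdsWithin_mono _ fun t ht => ne_of_gt ht)
  filter_upwards [h1.eventually (lt_mem_nhds hc), self_mem_nhdsWithin] with t ht ht0
  rw [slope_def_field, h0, sub_zero, sub_zero] at ht
  exact (div_pos_iff_of_pos_right ht0).1 ht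

theorem IsLocalDefiningFunction.neg (hg : IsLocalDefiningFunction S V g) :
    IsLocalDefiningFunction S V (fun z => -g z) where
  isOpen := hg.isOpen
  contDiffOn := hg.contDiffOn.neg
  fderiv_ne_zero z hz := by
    rw [fderiv_fun_neg]
    exact neg_ne_zero.2 (hg.fderiv_ne_zero z hz)
  mem_iff z hz := by rw [hg.mem_iff z hz, neg_eq_zero]

theorem gradNormal_neg (g : Eu n → ℝ) (x : Eu n) :
    gradNormal (fun z => -g z) x = -gradNormal g x := by
  simp only [gradNormal, gradient, fderiv_fun_neg, map_neg, norm_neg, smul_neg]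

theorem IsLocalDefiningFunction.hasDerivAt_line (hg : IsLocalDefiningFunction S V g)
    (hx : x ∈ V) (v : Eu n) :
    HasDerivAt (fun t : ℝ => g (x + t • v)) (‖fderiv ℝ g x‖ * ⟪gradNormal g x, v⟫) 0 := by
  rw [← fderiv_eq_inner_gradNormal (hg.fderiv_ne_zero x hx)]
  exact ((hg.contDiffOn.differentiableOn one_ne_zero).differentiableAt
    (hg.isOpen.mem_nhds hx)).hasFDerivAt.hasLineDerivAt v

theorem tendsto_line (x v : Eu n) : Tendsto (fun t : ℝ => x + t • v) (𝓝 0) (𝓝 x) := by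
  have : Continuous fun t : ℝ => x + t • v := by fun_prop
  simpa using this.tendsto 0

theorem IsLocalDefiningFunction.tendsto_side (hg : IsLocalDefiningFunction S V g)
    (hx : x ∈ S ∩ V) {v : Eu n} (hv : 0 < ⟪gradNormal g x, v⟫) :
    Tendsto (fun t : ℝ => x + t • v) (𝓝[>] 0) (𝓝[{z | z ∈ V ∧ 0 < g z}] x) := by
  refine tendsto_nhdsWithin_iff.2 ⟨(tendsto_line x v).mono_left nhdsWithin_le_nhds, ?_⟩
  have h1 := eventually_pos_of_hasDerivAt (hg.hasDerivAt_line hx.2 v)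
    (mul_pos (norm_pos_iff.2 (hg.fderiv_ne_zero x hx.2)) hv)
    (by rw [zero_smul, add_zero]; exact (hg.mem_iff x hx.2).1 hx.1)
  filter_upwards [h1, ((tendsto_line x v).mono_left nhdsWithin_le_nhds).eventually
    (hg.isOpen.mem_nhds hx.2)] with t h2 h3
  exact ⟨h3, h2⟩

/-- For a tangent direction w and any c > 0, the intermediate value theorem gives surface points x +
t(w + s N) with |s| ≤ c for small t > 0. The defining condition on v at these points makes ⟪v, w⟫ of
order c, hence zero, so v is parallel to N. -/
theorem IsLocalDefiningFunction.isUnitNormal_iff (hg : IsLocalDefiningFunction S V g)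
    (hx : x ∈ S ∩ V) {v : Eu n} (hv : IsUnitNormal S x v) :
    v = gradNormal g x ∨ v = -gradNormal g x := by
  set N := gradNormal g x
  have hN : ‖N‖ = 1 := norm_gradNormal (hg.fderiv_ne_zero x hx.2)
  have hgN : 0 < ‖fderiv ℝ g x‖ := norm_pos_iff.2 (hg.fderiv_ne_zero x hx.2)
  have hg0 : g x = 0 := (hg.mem_iff x hx.2).1 hx.1
  have hort : ∀ w : Eu n, ⟪N, w⟫ = 0 → ⟪v, w⟫ = 0 := by
    intro w hw
    have key : ∀ c : ℝ, 0 < c → |⟪v, w⟫| ≤ c * (1 + ‖w‖ + c) := by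
      intro c hc
      have hp : ∀ᶠ t : ℝ in 𝓝[>] 0, 0 < g (x + t • (w + c • N)) :=
        eventually_pos_of_hasDerivAt (hg.hasDerivAt_line hx.2 _) (by
          rw [inner_add_right, hw, inner_smul_right, real_inner_self_eq_norm_sq, hN]
          have := mul_pos hgN hc
          simpa using this) (by simpa using hg0)
      have hm : ∀ᶠ t : ℝ in 𝓝[>] 0, 0 < -g (x + t • (w + (-c) • N)) :=
        eventually_pos_of_hasDerivAt ((hg.hasDerivAt_line hx.2 (w + (-c) • N)).neg) (by
          rw [inner_add_right, hw, inner_smul_right, real_inner_self_eq_norm_sq, hN]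
          have := mul_pos hgN hc
          simpa using this) (by simpa using hg0)
      have hsm := (Asymptotics.isLittleO_iff.1 hv.2) hc
      rw [eventually_nhdsWithin_iff, Metric.eventually_nhds_iff_ball] at hsm
      obtain ⟨r, hr, hsm⟩ := hsm
      obtain ⟨r', hr', hrV⟩ := Metric.isOpen_iff.1 hg.isOpen x hx.2
      have hB : 0 < ‖w‖ + c := by positivity
      have hsmall : ∀ᶠ t : ℝ in 𝓝[>] 0, t * (‖w‖ + c) < min r r' := by
        have : Tendsto (fun t : ℝ => t * (‖w‖ + c)) (𝓝[>] 0) (𝓝 0) := by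
          have h1 : Continuous fun t : ℝ => t * (‖w‖ + c) := by fun_prop
          simpa using (h1.tendsto 0).mono_left nhdsWithin_le_nhds
        exact this.eventually (gt_mem_nhds (lt_min hr hr'))
      obtain ⟨t, ht⟩ := (hp.and (hm.and (hsmall.and self_mem_nhdsWithin))).exists
      obtain ⟨h1, h2, h3, h4⟩ := ht
      have ht0 : (0 : ℝ) < t := h4
      have hz : ∀ s ∈ Icc (-c) c, ‖x + t • (w + s • N) - x‖ ≤ t * (‖w‖ + c) := fun s hs => by
        rw [add_sub_cancel_left, norm_smul, Real.norm_of_nonneg ht0.le]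
        refine mul_le_mul_of_nonneg_left ((norm_add_le _ _).trans ?_) ht0.le
        rw [norm_smul, hN, mul_one, Real.norm_eq_abs]
        exact add_le_add le_rfl (abs_le.2 hs)
      have hcont : ContinuousOn (fun s : ℝ => g (x + t • (w + s • N))) (Icc (-c) c) := by
        refine hg.contDiffOn.continuousOn.comp (by fun_prop) fun s hs => hrV ?_
        rw [mem_ball_iff_norm]
        exact ((hz s hs).trans_lt h3).trans_le (min_le_right _ _)
      obtain ⟨s, hs, hs0⟩ := intermediate_value_Icc (neg_le_self hc.le) hcont
        (show (0 : ℝ) ∈ Icc _ _ from ⟨(neg_pos.1 h2).le, h1.le⟩)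
      have hzb : x + t • (w + s • N) ∈ Metric.ball x r := by
        rw [mem_ball_iff_norm]
        exact ((hz s hs).trans_lt h3).trans_le (min_le_left _ _)
      have hzV : x + t • (w + s • N) ∈ V := hrV (by
        rw [mem_ball_iff_norm]
        exact ((hz s hs).trans_lt h3).trans_le (min_le_right _ _))
      have h5 := hsm _ hzb ((hg.mem_iff _ hzV).2 hs0)
      have h6 : ⟪v, x + t • (w + s • N) - x⟫ = t * (⟪v, w⟫ + s * ⟪v, N⟫) := by
        rw [add_sub_cancel_left, inner_smul_right, inner_add_right, inner_smul_right]
      rw [h6, norm_mul, Real.norm_of_nonneg ht0.le, Real.norm_eq_abs] at h5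
      have h7 : |⟪v, w⟫ + s * ⟪v, N⟫| ≤ c * (‖w‖ + c) := by
        have := h5.trans (mul_le_mul_of_nonneg_left (hz s hs) hc.le)
        rw [mul_left_comm] at this
        exact le_of_mul_le_mul_left this ht0
      have h8 : |s * ⟪v, N⟫| ≤ c := by
        rw [abs_mul]
        have h9 : |⟪v, N⟫| ≤ 1 := by
          simpa [hv.1, hN] using abs_real_inner_le_norm v N
        exact (mul_le_of_le_one_right (abs_nonneg _) h9).trans (abs_le.2 hs)
      have h9 : ⟪v, w⟫ = (⟪v, w⟫ + s * ⟪v, N⟫) - s * ⟪v, N⟫ := by ring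
      rw [h9]
      refine (abs_sub _ _).trans ?_
      linarith
    have hlim : Tendsto (fun c : ℝ => c * (1 + ‖w‖ + c)) (𝓝[>] 0) (𝓝 0) := by
      have h1 : Continuous fun c : ℝ => c * (1 + ‖w‖ + c) := by fun_prop
      simpa using (h1.tendsto 0).mono_left nhdsWithin_le_nhds
    have := ge_of_tendsto hlim (by
      filter_upwards [self_mem_nhdsWithin] with c hc using key c hc)
    exact abs_eq_zero.1 (le_antisymm this (abs_nonneg _))
  have h1 : v = ⟪N, v⟫ • N := by
    have h2 := hort (v - ⟪N, v⟫ • N) (by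
      rw [inner_sub_right, inner_smul_right, real_inner_self_eq_norm_sq, hN]; ring)
    have h3 : ⟪v - ⟪N, v⟫ • N, v - ⟪N, v⟫ • N⟫ = 0 := by
      rw [inner_sub_left, h2, inner_smul_left, inner_sub_right, inner_smul_right,
        real_inner_self_eq_norm_sq, hN]
      simp
    exact sub_eq_zero.1 (inner_self_eq_zero.1 h3)
  have h2 : |⟪N, v⟫| = 1 := by
    have := congrArg norm h1
    rwa [norm_smul, hN, hv.1, mul_one, Real.norm_eq_abs, eq_comm] at this
  rcases (abs_eq zero_le_one).1 h2 with h3 | h3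
  · left; rw [h1, h3, one_smul]
  · right; rw [h1, h3, neg_one_smul]

/-- The area of a graph over a nonempty open set is at least the Lebesgue measure of that set,
because the area element is at least 1. -/
theorem IsSurfaceIn.measure_inter_ball_pos (hS : IsSurfaceIn Ω S) (hΩ : IsOpen Ω) (hx : x ∈ S)
    {ρ : ℝ} (hρ : 0 < ρ) : 0 < μHE[n - 1] (S ∩ Metric.ball x ρ) := by
  obtain ⟨V, g, r, e, φ, -, -, -, h⟩ := hS.exists_chart hΩ hx
  have hx0 : depth e φ x = 0 := (h.mem_iff x (Metric.mem_ball_self h.pos)).1 hx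
  set T := graphMap e φ ⁻¹' Metric.ball x (min r ρ)
  have hT : IsOpen T := Metric.isOpen_ball.preimage (continuous_graphMap h.lipschitz)
  have hxT : hproj h.norm_eq x ∈ T := by
    rw [mem_preimage, graphMap_hproj h.norm_eq hx0]
    exact Metric.mem_ball_self (lt_min h.pos hρ)
  have h1 : graphMap e φ '' T ⊆ S ∩ Metric.ball x ρ := by
    rintro _ ⟨w, hw, rfl⟩
    refine ⟨(h.mem_iff _ (Metric.ball_subset_ball (min_le_left _ _) hw)).2
      (depth_graphMap h.norm_eq w), Metric.ball_subset_ball (min_le_right _ _) hw⟩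
  refine lt_of_lt_of_le ?_ (measure_mono h1)
  rw [euclideanHausdorffMeasure_image_graphMap h.norm_eq h.lipschitz hT.measurableSet]
  refine lt_of_lt_of_le (hT.measure_pos volume ⟨_, hxT⟩) ?_
  rw [← setLIntegral_one]
  refine lintegral_mono fun w => ?_
  rw [← ENNReal.ofReal_one]
  exact ENNReal.ofReal_le_ofReal (one_le_areaElement w)

/-- The fundamental lemma on a surface. -/
theorem IsSurfaceIn.eq_zero_of_integral_eq_zero (hS : IsSurfaceIn Ω S) (hΩ : IsOpen Ω)
    {J : Eu n → ℝ} (hJ : ContinuousOn J S) (hi : IntegrableOn J S μHE[n - 1])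
    (h : ∀ δ, IsTest Ω δ → ∫ x in S, δ x * J x ∂μHE[n - 1] = 0) : ∀ x ∈ S, J x = 0 := by
  have key : ∀ J : Eu n → ℝ, ContinuousOn J S → IntegrableOn J S μHE[n - 1] →
      (∀ δ, IsTest Ω δ → ∫ x in S, δ x * J x ∂μHE[n - 1] = 0) → ∀ x ∈ S, J x ≤ 0 := by
    intro J hJ hi h x hx
    by_contra! hpos
    obtain ⟨ε, hε, hball⟩ := Metric.continuousOn_iff.1 hJ x hx (J x / 2) (half_pos hpos)
    obtain ⟨ε', hε', hΩb⟩ := Metric.nhds_basis_closedBall.mem_iff.1 (hΩ.mem_nhds (hS.subset hx))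
    -- The bump equals 1 on the ball of radius ρ and vanishes beyond 2ρ. The quarter keeps 2ρ below
    -- ε, where J exceeds J x / 2, and below ε', inside Ω.
    set ρ : ℝ≥0 := (min ε ε' / 4).toNNReal with hρ
    have hmin : 0 < min ε ε' := lt_min hε hε'
    have hρc : (ρ : ℝ) = min ε ε' / 4 := Real.coe_toNNReal _ (by positivity)
    have hρ0 : 0 < ρ := Real.toNNReal_pos.2 (by positivity)
    have hρ0' : (0 : ℝ) < ρ := hρ0
    have hmε : min ε ε' ≤ ε := min_le_left _ _
    have hmε' : min ε ε' ≤ ε' := min_le_right _ _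
    set δ : Eu n → ℝ := fun z => 1 - ballCut x ρ z with hδdef
    have hδ1 : ∀ z ∈ Metric.ball x ρ, δ z = 1 := fun z hz => by
      rw [hδdef]
      beta_reduce
      rw [ballCut_eq_zero hρ0' (Metric.mem_ball.1 hz).le, sub_zero]
    have hδ0 : ∀ z, 2 * (ρ : ℝ) ≤ dist z x → δ z = 0 := fun z hz => by
      rw [hδdef]
      beta_reduce
      rw [ballCut_eq_one hρ0' hz, sub_self]
    have hδn : ∀ z, 0 ≤ δ z ∧ δ z ≤ 1 := fun z => by
      obtain ⟨h1, h2⟩ := ballCut_mem x z ρ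
      exact ⟨sub_nonneg.2 h2, sub_le_self _ h1⟩
    have hsup : tsupport δ ⊆ Metric.closedBall x (2 * ρ) :=
      closure_minimal (fun z hz => by
        by_contra h'
        exact hz (hδ0 z (by simpa using (not_le.1 h').le))) Metric.isClosed_closedBall
    have hδt : IsTest Ω δ := ⟨⟨_, (LipschitzWith.const 1).sub (lipschitzWith_ballCut x hρ0)⟩,
      HasCompactSupport.of_support_subset_isCompact (isCompact_closedBall x (2 * ρ))
        ((subset_tsupport _).trans hsup),
      hsup.trans ((Metric.closedBall_subset_closedBall (by rw [hρc]; linarith)).trans hΩb)⟩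
    have hJx : ∀ z ∈ S, dist z x < 2 * ρ → J x / 2 ≤ J z := fun z hz hd => by
      have := hball z hz (by rw [hρc] at hd; linarith)
      rw [Real.dist_eq] at this
      linarith [(abs_lt.1 this).1]
    have hSm := hS.measurableSet hΩ
    have hnn : ∀ z ∈ S, 0 ≤ δ z * J z := fun z hz => by
      by_cases hd : dist z x < 2 * ρ
      · exact mul_nonneg (hδn z).1 ((half_pos hpos).le.trans (hJx z hz hd))
      · rw [hδ0 z (not_lt.1 hd), zero_mul]
    have hint : IntegrableOn (fun z => δ z * J z) S μHE[n - 1] :=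
      hi.bdd_mul (c := 1) hδt.lipschitz.choose_spec.continuous.aestronglyMeasurable
        (ae_of_all _ fun z => by
          rw [Real.norm_of_nonneg (hδn z).1]; exact (hδn z).2)
    have h1 : ∫ z in S ∩ Metric.ball x ρ, J x / 2 ∂μHE[n - 1] ≤ 0 := by
      rw [← h δ hδt]
      refine le_trans ?_ (setIntegral_mono_set hint
        (by filter_upwards [ae_restrict_mem hSm] with z hz using hnn z hz)
        (inter_subset_left (t := Metric.ball x ρ)).eventuallyLE)
      have hfin : μHE[n - 1] (S ∩ Metric.ball x ρ) ≠ ⊤ :=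
        ((measure_mono inter_subset_left).trans_lt hS.finite_area).ne
      refine setIntegral_mono_on (integrableOn_const hfin) (hint.mono_set inter_subset_left)
        (hSm.inter measurableSet_ball) fun z hz => ?_
      rw [hδ1 z hz.2, one_mul]
      have := Metric.mem_ball.1 hz.2
      exact hJx z hz.1 (by linarith)
    rw [setIntegral_const, smul_eq_mul] at h1
    have h2 : 0 < (μHE[n - 1]).real (S ∩ Metric.ball x ρ) :=
      ENNReal.toReal_pos (hS.measure_inter_ball_pos hΩ hx hρ0').ne'
        ((measure_mono inter_subset_left).trans_lt hS.finite_area).ne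
    exact absurd h1 (not_le.2 (mul_pos h2 (half_pos hpos)))
  intro x hx
  refine le_antisymm (key J hJ hi h x hx) (neg_nonpos.1 ?_)
  refine key (fun z => -J z) hJ.neg hi.neg (fun δ hδ => ?_) x hx
  simp only [mul_neg]
  rw [integral_neg, h δ hδ, neg_zero]

end Sides

/-! ### One-sided values of the jets and Hadamard's rank-one condition -/

section Jumps

variable {n m : ℕ} {Ω S : Set (Eu n)}

/-- A Lipschitz function on the closure of a bounded set extends to a test function. -/
theorem exists_isTest_eqOn (hΩb : Bornology.IsBounded Ω) {δ : Eu n → ℝ}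
    (hδ : ∃ L : ℝ≥0, LipschitzOnWith L δ (closure Ω)) :
    ∃ δ', IsTest univ δ' ∧ EqOn δ' δ (closure Ω) := by
  classical
  obtain ⟨L, hL⟩ := hδ
  obtain ⟨R, hR⟩ := (Metric.isBounded_iff_subset_ball (0 : Eu n)).1 hΩb.closure
  obtain ⟨M, hM⟩ := hΩb.isCompact_closure.exists_bound_of_continuousOn hL.continuousOn
  -- Prescribe δ on closure Ω and 0 on B. The two sets are at distance at least 1, so the combined
  -- function is Lipschitz, and any Lipschitz extension has compact support.
  set B : Set (Eu n) := {z | R + 1 ≤ ‖z‖} with hB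
  have hdisj : ∀ z ∈ closure Ω, z ∉ B := fun z hz hz' => by
    have := mem_ball_zero_iff.1 (hR hz)
    have h2 : R + 1 ≤ ‖z‖ := hz'
    linarith
  have hMnn : ∀ z ∈ closure Ω, ‖δ z‖ ≤ M.toNNReal := fun z hz =>
    (hM z hz).trans (Real.le_coe_toNNReal M)
  have hlip : LipschitzOnWith (max L M.toNNReal) ((closure Ω).indicator δ) (closure Ω ∪ B) := by
    apply LipschitzOnWith.of_dist_le_mul
    have far : ∀ z ∈ closure Ω, ∀ w ∈ B, 1 ≤ dist z w := fun z hz w hw => by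
      have h1 := mem_ball_zero_iff.1 (hR hz)
      have h2 : R + 1 ≤ ‖w‖ := hw
      have h3 := norm_sub_norm_le w z
      rw [dist_comm, dist_eq_norm]
      linarith
    rintro z (hz | hz) w (hw | hw)
    · rw [indicator_of_mem hz, indicator_of_mem hw]
      refine (hL.dist_le_mul z hz w hw).trans (mul_le_mul_of_nonneg_right ?_ dist_nonneg)
      exact_mod_cast le_max_left _ _
    · rw [indicator_of_mem hz, indicator_of_notMem fun h => hdisj w h hw, dist_zero_right]
      refine (hMnn z hz).trans ((le_mul_of_one_le_right (NNReal.coe_nonneg _) (far z hz w hw)).trans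
        (mul_le_mul_of_nonneg_right ?_ dist_nonneg))
      exact_mod_cast le_max_right _ _
    · rw [indicator_of_mem hw, indicator_of_notMem fun h => hdisj z h hz, dist_zero_left, dist_comm]
      refine (hMnn w hw).trans ((le_mul_of_one_le_right (NNReal.coe_nonneg _) (far w hw z hz)).trans
        (mul_le_mul_of_nonneg_right ?_ dist_nonneg))
      exact_mod_cast le_max_right _ _
    · rw [indicator_of_notMem fun h => hdisj z h hz, indicator_of_notMem fun h => hdisj w h hw,
        dist_self]
      positivity
  obtain ⟨δ', h1, h2⟩ := hlip.extend_real
  refine ⟨δ', ⟨⟨_, h1⟩, ?_, subset_univ _⟩, fun z hz => ?_⟩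
  · refine HasCompactSupport.of_support_subset_isCompact (isCompact_closedBall 0 (R + 1)) ?_
    intro z hz
    by_contra h'
    rw [mem_closedBall_zero_iff, not_le] at h'
    refine hz ?_
    rw [← h2 (Or.inr h'.le), indicator_of_notMem fun h => hdisj z h h'.le]
  · rw [← h2 (Or.inl hz), indicator_of_mem hz]

namespace IsConfiguration

variable {y : Eu n → Eu m} {W : Jet n m → ℝ} {U : Set (Jet n m)}
  (h : IsConfiguration Ω S y W U)
include h

theorem tendsto_jet {x : Eu n} {F : Grad n m} {l : Filter (Eu n)} [l.NeBot] (hx : x ∈ closure Ω)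
    (hl : l ≤ 𝓝[Ω \ S] x) (hF : Tendsto (fderiv ℝ y) l (𝓝 F)) :
    Tendsto (jet y) l (𝓝 (x, y x, F)) ∧ ((x, y x, F) : Jet n m) ∈ U := by
  obtain ⟨K, hK⟩ := h.lipschitz
  have h1 : Tendsto y l (𝓝 (y x)) := ((hK.continuousOn x hx).mono_left
    (nhdsWithin_mono x (sdiff_subset.trans subset_closure))).mono_left hl
  have h2 : Tendsto (jet y) l (𝓝 (x, y x, F)) :=
    (tendsto_id.mono_left (hl.trans nhdsWithin_le_nhds)).prodMk_nhds (h1.prodMk_nhds hF)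
  refine ⟨h2, h.subset (mem_closure_of_tendsto h2 ?_)⟩
  filter_upwards [hl self_mem_nhdsWithin] with z hz using mem_image_of_mem _ hz

theorem neBot_boundary {x : Eu n} (hx : x ∈ frontier Ω \ closure S) : (𝓝[Ω \ S] x).NeBot := by
  have : 𝓝[Ω \ S] x = 𝓝[Ω] x := by
    rw [nhdsWithin_eq_iff_eventuallyEq]
    filter_upwards [isClosed_closure.isOpen_compl.mem_nhds hx.2] with z hz
    exact propext ⟨fun h' => h'.1, fun h' => ⟨h', fun h'' => hz (subset_closure h'')⟩⟩
  rw [this, ← mem_closure_iff_nhdsWithin_neBot]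
  exact frontier_subset_closure hx.1

theorem tendsto_jet_boundary {x : Eu n} (hx : x ∈ frontier Ω \ closure S) :
    Tendsto (jet y) (𝓝[Ω \ S] x) (𝓝 (boundaryJet Ω S y x)) ∧ boundaryJet Ω S y x ∈ U := by
  have := h.neBot_boundary hx
  obtain ⟨F, hF⟩ := h.piecewise.boundary_limit x hx
  rw [boundaryJet, hF.limUnder_eq]
  exact h.tendsto_jet (frontier_subset_closure hx.1) le_rfl hF

/-- The ray along `gradNormal` enters {g > 0}, so the limit along the ray that defines `sideGrad` is
the full limit from that side. -/
theorem tendsto_jet_side {V : Set (Eu n)} {g : Eu n → ℝ} {x : Eu n} (hV : V ⊆ Ω)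
    (hg : IsLocalDefiningFunction S V g) (hx : x ∈ S ∩ V) :
    Tendsto (jet y) (𝓝[{z | z ∈ V ∧ 0 < g z}] x) (𝓝 (sideJet y x (gradNormal g x))) ∧
      sideJet y x (gradNormal g x) ∈ U := by
  have hN : ‖gradNormal g x‖ = 1 := norm_gradNormal (hg.fderiv_ne_zero x hx.2)
  have hs := hg.tendsto_side hx (v := gradNormal g x) (by
    rw [real_inner_self_eq_norm_sq, hN]; norm_num)
  have hne : (𝓝[{z | z ∈ V ∧ 0 < g z}] x).NeBot := hs.neBot
  obtain ⟨F, hF⟩ := (h.piecewise.side_limits V g hV hg x hx).1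
  rw [sideJet, show sideGrad y x (gradNormal g x) = F from (hF.comp hs).limUnder_eq]
  refine h.tendsto_jet (subset_closure (hV hx.2)) (nhdsWithin_mono x fun z hz => ⟨hV hz.1, ?_⟩) hF
  exact fun h' => hz.2.ne' ((hg.mem_iff z hz.1).1 h')

theorem tendsto_jet_side_neg {V : Set (Eu n)} {g : Eu n → ℝ} {x : Eu n} (hV : V ⊆ Ω)
    (hg : IsLocalDefiningFunction S V g) (hx : x ∈ S ∩ V) :
    Tendsto (jet y) (𝓝[{z | z ∈ V ∧ g z < 0}] x) (𝓝 (sideJet y x (-gradNormal g x))) ∧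
      sideJet y x (-gradNormal g x) ∈ U := by
  have := h.tendsto_jet_side hV hg.neg hx
  simpa only [gradNormal_neg, neg_pos] using this

/-- Fields depending on the jet of `y` have boundary values and jumps. -/
theorem exists_fluxData {G : Jet n m → Eu n} {H : Jet n m → ℝ} (hG : ContinuousOn G U)
    (hH : ContinuousOn H U) {ν : Eu n → Eu n} (hν : ∀ x ∈ S, IsUnitNormal S x (ν x))
    (hw : ∀ δ, IsTest (Ω \ S) δ →
      ∫ z in Ω, (H (jet y z) * δ z + fderiv ℝ δ z (G (jet y z))) = 0) :
    ∃ C, FluxData Ω S (fun z => G (jet y z)) (fun x => G (boundaryJet Ω S y x))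
      (fun z => H (jet y z)) (fun x => ⟪G (sideJet y x (ν x)) - G (sideJet y x (-ν x)), ν x⟫) C := by
  obtain ⟨C₁, hC₁⟩ := h.exists_bound hG
  obtain ⟨C₂, hC₂⟩ := h.exists_bound hH
  refine ⟨max C₁ C₂, h.continuousOn_comp_jet hG, h.aestronglyMeasurable (h.continuousOn_comp_jet hH),
    fun z hz => (hC₁ z hz).trans (le_max_left _ _), fun z hz => (hC₂ z hz).trans (le_max_right _ _),
    fun x hx => ?_, fun V g hV hg x hx => ?_, hw⟩
  · obtain ⟨h1, h2⟩ := h.tendsto_jet_boundary hx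
    exact (hG.continuousAt (h.isOpen_jets.mem_nhds h2)).tendsto.comp h1
  · obtain ⟨h1, h2⟩ := h.tendsto_jet_side hV hg hx
    obtain ⟨h3, h4⟩ := h.tendsto_jet_side_neg hV hg hx
    refine ⟨_, _, (hG.continuousAt (h.isOpen_jets.mem_nhds h2)).tendsto.comp h1,
      (hG.continuousAt (h.isOpen_jets.mem_nhds h4)).tendsto.comp h3, ?_⟩
    rcases hg.isUnitNormal_iff hx (hν x hx.1) with h5 | h5 <;> rw [h5]
    rw [neg_neg, inner_neg_right, ← inner_neg_left, neg_sub]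

/-- The directional derivative of `y` at a point of the surface towards the positive side. -/
theorem hasDerivWithinAt_side {V : Set (Eu n)} {g : Eu n → ℝ} {x : Eu n} (hV : V ⊆ Ω)
    (hg : IsLocalDefiningFunction S V g) (hx : x ∈ S ∩ V) {v : Eu n}
    (hv : 0 < ⟪gradNormal g x, v⟫) :
    HasDerivWithinAt (fun t : ℝ => y (x + t • v)) (sideGrad y x (gradNormal g x) v) (Ici 0) 0 := by
  obtain ⟨K, hK⟩ := h.lipschitz
  have hs := hg.tendsto_side hx hv
  have hF : Tendsto (fderiv ℝ y) (𝓝[{z | z ∈ V ∧ 0 < g z}] x)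
      (𝓝 (sideGrad y x (gradNormal g x))) :=
    ((continuous_snd.comp continuous_snd).tendsto _).comp (h.tendsto_jet_side hV hg hx).1
  have hmem : ∀ᶠ t : ℝ in 𝓝[>] 0, x + t • v ∈ Ω \ S := by
    filter_upwards [hs self_mem_nhdsWithin] with t ht
    exact ⟨hV ht.1, fun h' => ht.2.ne' ((hg.mem_iff _ ht.1).1 h')⟩
  have hder : ∀ t : ℝ, x + t • v ∈ Ω \ S →
      HasDerivAt (fun t : ℝ => y (x + t • v)) (fderiv ℝ y (x + t • v) v) t := fun t ht => by
    have h1 : HasFDerivAt y (fderiv ℝ y (x + t • v)) (x + t • v) :=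
      ((h.piecewise.contDiffOn.differentiableOn two_ne_zero).differentiableAt
        (h.isOpen_diff.mem_nhds ht)).hasFDerivAt
    have h2 : HasDerivAt (fun t : ℝ => x + t • v) v t := by
      simpa using ((hasDerivAt_id t).smul_const v).const_add x
    exact h1.comp_hasDerivAt t h2
  -- Along the ray y is continuous up to t = 0 and its derivative has a limit there, so by the mean
  -- value inequality the one-sided derivative exists and equals that limit.
  refine hasDerivWithinAt_Ici_of_tendsto_deriv (s := {t | x + t • v ∈ Ω \ S})
    (fun t ht => (hder t ht).differentiableAt.differentiableWithinAt) ?_ hmem ?_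
  · have h1 : ContinuousAt y (x + (0 : ℝ) • v) := by
      rw [zero_smul, add_zero]
      exact (hK.continuousOn.mono subset_closure).continuousAt (h.isOpen.mem_nhds (hV hx.2))
    exact (ContinuousAt.comp (f := fun t : ℝ => x + t • v) h1 (by fun_prop)).continuousWithinAt
  · refine Tendsto.congr' (f₁ := fun t => fderiv ℝ y (x + t • v) v) ?_ ?_
    · filter_upwards [hmem] with t ht
      exact (hder t ht).deriv.symm
    · exact ((ContinuousLinearMap.apply ℝ (Eu m) v).continuous.tendsto _).comp (hF.comp hs)

/-- The tangential derivatives of `y` from the two sides agree. -/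
theorem sideGrad_apply_eq {V : Set (Eu n)} {g : Eu n → ℝ} {x : Eu n} (hV : V ⊆ Ω)
    (hg : IsLocalDefiningFunction S V g) (hx : x ∈ S ∩ V) {w : Eu n}
    (hw : ⟪gradNormal g x, w⟫ = 0) :
    sideGrad y x (gradNormal g x) w = sideGrad y x (-gradNormal g x) w := by
  obtain ⟨K, hK⟩ := h.lipschitz
  set N := gradNormal g x with hNdef
  have hN : ‖N‖ = 1 := norm_gradNormal (hg.fderiv_ne_zero x hx.2)
  set Fp := sideGrad y x N
  set Fm := sideGrad y x (-N)
  -- A tangential ray need not stay on one side, so w is tilted to w ± cN. The two rays enter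
  -- opposite sides and separate at speed 2c, and the Lipschitz bound on y gives 2Kc, which tends to
  -- 0 with c.
  have key : ∀ c : ℝ, 0 < c → ‖Fp (w + c • N) - Fm (w + (-c) • N)‖ ≤ K * (2 * c) := by
    intro c hc
    have d1 := h.hasDerivWithinAt_side hV hg hx (v := w + c • N) (by
      rw [← hNdef, inner_add_right, hw, inner_smul_right, real_inner_self_eq_norm_sq, hN]
      simpa using hc)
    have d2 := h.hasDerivWithinAt_side hV hg.neg hx (v := w + (-c) • N) (by
      rw [gradNormal_neg, ← hNdef, inner_add_right, inner_neg_left, hw, inner_smul_right,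
        inner_neg_left, real_inner_self_eq_norm_sq, hN]
      simpa using hc)
    rw [gradNormal_neg] at d2
    have d3 := (hasDerivWithinAt_iff_tendsto_slope.1 (d1.sub d2))
    rw [Ici_sdiff_left] at d3
    refine le_of_tendsto d3.norm ?_
    have hin : ∀ v : Eu n, ∀ᶠ t : ℝ in 𝓝[>] 0, x + t • v ∈ Ω := fun v =>
      ((tendsto_line x v).mono_left nhdsWithin_le_nhds).eventually (h.isOpen.mem_nhds (hV hx.2))
    filter_upwards [hin (w + c • N), hin (w + (-c) • N), self_mem_nhdsWithin] with t h1 h2 ht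
    have ht0 : (0 : ℝ) < t := ht
    have h3 := hK.dist_le_mul _ (subset_closure h1) _ (subset_closure h2)
    rw [dist_add_left, dist_eq_norm, dist_eq_norm, ← smul_sub, add_sub_add_left_eq_sub, ← sub_smul,
      norm_smul, norm_smul, hN, sub_neg_eq_add, ← two_mul, Real.norm_of_nonneg ht0.le,
      Real.norm_of_nonneg (by positivity : (0 : ℝ) ≤ 2 * c), mul_one] at h3
    rw [_root_.slope, norm_smul]
    simp only [vsub_eq_sub, sub_zero, Pi.sub_apply, zero_smul, add_zero, sub_self]
    rw [norm_inv, Real.norm_of_nonneg ht0.le, inv_mul_le_iff₀ ht0]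
    linarith
  have hlim1 : Tendsto (fun c : ℝ => ‖Fp (w + c • N) - Fm (w + (-c) • N)‖) (𝓝[>] 0)
      (𝓝 ‖Fp w - Fm w‖) := by
    have h1 : Continuous fun c : ℝ => ‖Fp (w + c • N) - Fm (w + (-c) • N)‖ := by fun_prop
    simpa using (h1.tendsto 0).mono_left nhdsWithin_le_nhds
  have hlim2 : Tendsto (fun c : ℝ => (K : ℝ) * (2 * c)) (𝓝[>] 0) (𝓝 0) := by
    have h1 : Continuous fun c : ℝ => (K : ℝ) * (2 * c) := by fun_prop
    simpa using (h1.tendsto 0).mono_left nhdsWithin_le_nhds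
  have := le_of_tendsto_of_tendsto hlim1 hlim2 (by
    filter_upwards [self_mem_nhdsWithin] with c hc using key c hc)
  exact sub_eq_zero.1 (norm_le_zero_iff.1 this)

/-- Hadamard's compatibility condition: the jump of the gradient has rank one. -/
theorem sideGrad_sub {ν : Eu n → Eu n} (hν : ∀ x ∈ S, IsUnitNormal S x (ν x)) {x : Eu n}
    (hx : x ∈ S) : sideGrad y x (ν x) - sideGrad y x (-ν x)
      = (innerSL ℝ (ν x)).smulRight ((sideGrad y x (ν x) - sideGrad y x (-ν x)) (ν x)) := by
  obtain ⟨V, g, r, e, φ, hV, hxV, hg, -⟩ := h.surface.exists_chart h.isOpen hx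
  have hw : ∀ w, ⟪ν x, w⟫ = 0 → (sideGrad y x (ν x) - sideGrad y x (-ν x)) w = 0 := by
    intro w hw
    rw [_root_.sub_apply, sub_eq_zero]
    rcases hg.isUnitNormal_iff ⟨hx, hxV⟩ (hν x hx) with h3 | h3
    · rw [h3] at hw ⊢
      exact h.sideGrad_apply_eq hV hg ⟨hx, hxV⟩ hw
    · rw [h3] at hw ⊢
      rw [inner_neg_left, neg_eq_zero] at hw
      rw [neg_neg]
      exact (h.sideGrad_apply_eq hV hg ⟨hx, hxV⟩ hw).symm
  ext1 w
  have h1 : w = ⟪ν x, w⟫ • ν x + (w - ⟪ν x, w⟫ • ν x) := by abel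
  have h2 := hw (w - ⟪ν x, w⟫ • ν x) (by
    rw [inner_sub_right, inner_smul_right, real_inner_self_eq_norm_sq, (hν x hx).1]; ring)
  conv_lhs => rw [h1, map_add, h2, add_zero, map_smul]
  rfl

end IsConfiguration

end Jumps

/-! ### Jump conditions for P and P* -/

section JumpConditions

variable {n m : ℕ} {Ω S : Set (Eu n)}

/-- When the weak equation also holds across S, Gauss's theorem for tests supported in Ω leaves only
the surface integral, and the fundamental lemma applies. -/
theorem FluxData.jump_eq_zero {q qb : Eu n → Eu n} {f jmp : Eu n → ℝ} {C : ℝ}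
    (h : FluxData Ω S q qb f jmp C) (hn : 1 ≤ n) (hΩ : IsOpen Ω) (hΩb : Bornology.IsBounded Ω)
    (hL : HasLipschitzBoundary Ω) (hS : IsSurfaceIn Ω S)
    (hw : ∀ δ, IsTest Ω δ → ∫ z in Ω, (f z * δ z + fderiv ℝ δ z (q z)) = 0) :
    ∀ x ∈ S, jmp x = 0 := by
  refine hS.eq_zero_of_integral_eq_zero hΩ (h.continuousOn_jump hΩ hS) (h.integrableOn_jump hΩ hS)
    fun δ hδ => ?_
  have h1 := h.gauss hn hΩ hΩb hL hS (hδ.mono (subset_univ _))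
  have h2 : ∫ x in frontier Ω, δ x * ⟪qb x, outerNormal Ω x⟫ ∂μHE[n - 1] = 0 := by
    refine setIntegral_eq_zero_of_forall_eq_zero fun z hz => ?_
    rw [hΩ.frontier_eq] at hz
    rw [(hδ.eq_zero hz.2).1, zero_mul]
  rw [hw δ hδ, h2] at h1
  linarith

namespace IsConfiguration

variable {y : Eu n → Eu m} {W : Jet n m → ℝ} {U : Set (Jet n m)}
  (h : IsConfiguration Ω S y W U)
include h

/-- The Weierstrass–Erdmann condition [P]n = 0, paired with the vector a. -/
theorem jump_piola (hn : 1 ≤ n) (hL : HasLipschitzBoundary Ω) (hext : IsExtremal W Ω y)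
    {ν : Eu n → Eu n} (hν : ∀ x ∈ S, IsUnitNormal S x (ν x)) (a : Eu m) {x : Eu n} (hx : x ∈ S) :
    ⟪piolaT W (sideJet y x (ν x)) a, ν x⟫ = ⟪piolaT W (sideJet y x (-ν x)) a, ν x⟫ := by
  obtain ⟨C, hC⟩ := h.exists_fluxData (h.continuousOn_row a) (h.continuousOn_dir 0 a 0) hν
    fun δ hδ => h.extremal_weak hext a (hδ.mono sdiff_subset)
  have := hC.jump_eq_zero hn h.isOpen h.isBounded hL h.surface
    (fun δ hδ => h.extremal_weak hext a hδ) x hx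
  rwa [inner_sub_left, sub_eq_zero] at this

/-- Since [F] = a ⊗ n, the product with any Piola tensor is Pn·a; equality of the two tractions then
gives part (a). -/
theorem frob_jumpGrad {ν : Eu n → Eu n} (hν : ∀ x ∈ S, IsUnitNormal S x (ν x)) {x : Eu n}
    (hx : x ∈ S) (j : Jet n m) : frob (piola W j) (jumpGrad y x (ν x))
      = ⟪piolaT W j ((sideGrad y x (ν x) - sideGrad y x (-ν x)) (ν x)), ν x⟫ := by
  rw [jumpGrad, h.sideGrad_sub hν hx, ← fderiv_grad_eq_frob, ← apply_piolaT, innerSL_apply_apply,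
    real_inner_comm]
  congr 2
  rw [ContinuousLinearMap.smulRight_apply, innerSL_apply_apply, real_inner_self_eq_norm_sq,
    (hν x hx).1]
  simp

theorem frob_jumpGrad_eq (hn : 1 ≤ n) (hL : HasLipschitzBoundary Ω) (hext : IsExtremal W Ω y)
    {ν : Eu n → Eu n} (hν : ∀ x ∈ S, IsUnitNormal S x (ν x)) {x : Eu n} (hx : x ∈ S) :
    frob (piola W (sideJet y x (ν x))) (jumpGrad y x (ν x))
      = frob (piola W (sideJet y x (-ν x))) (jumpGrad y x (ν x)) := by
  rw [h.frob_jumpGrad hν hx, h.frob_jumpGrad hν hx, h.jump_piola hn hL hext hν _ hx]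

/-- Write F₊v = F₋v + ⟨n, v⟩a. By continuity of the traction Pn the common part F₋v cancels, and
[W]⟨n, v⟩ - ⟨n, v⟩ P₊n·a remains: the jump of P*n is purely normal. -/
theorem jump_eshelby (hn : 1 ≤ n) (hL : HasLipschitzBoundary Ω) (hext : IsExtremal W Ω y)
    {ν : Eu n → Eu n} (hν : ∀ x ∈ S, IsUnitNormal S x (ν x)) (v : Eu n) {x : Eu n} (hx : x ∈ S) :
    ⟪eshelbyT W (sideJet y x (ν x)) v - eshelbyT W (sideJet y x (-ν x)) v, ν x⟫
      = pStar W y x (ν x) * ⟪ν x, v⟫ := by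
  have h1 : (sideGrad y x (ν x)) v = (sideGrad y x (-ν x)) v
      + ⟪ν x, v⟫ • (sideGrad y x (ν x) - sideGrad y x (-ν x)) (ν x) := by
    have := congrArg (fun G : Grad n m => G v) (h.sideGrad_sub hν hx)
    rw [← sub_eq_iff_eq_add']
    exact this
  have h2 : ⟪piolaT W (sideJet y x (ν x)) ((sideGrad y x (ν x)) v), ν x⟫
      = ⟪piolaT W (sideJet y x (-ν x)) ((sideGrad y x (-ν x)) v), ν x⟫
        + ⟪ν x, v⟫ * frob (piola W (sideJet y x (ν x))) (jumpGrad y x (ν x)) := by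
    rw [h1, piolaT, map_add, map_smul, inner_add_left, inner_smul_left, ← piolaT, ← piolaT,
      h.jump_piola hn hL hext hν ((sideGrad y x (-ν x)) v) hx, h.frob_jumpGrad hν hx]
    rfl
  rw [inner_sub_left, eshelbyT, eshelbyT, inner_sub_left, inner_sub_left, inner_smul_left,
    inner_smul_left, real_inner_comm (ν x) v]
  change _ * _ - ⟪piolaT W (sideJet y x (ν x)) ((sideGrad y x (ν x)) v), ν x⟫ - (_ * _ -
    ⟪piolaT W (sideJet y x (-ν x)) ((sideGrad y x (-ν x)) v), ν x⟫) = _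
  rw [h2, pStar]
  simp only [conj_trivial]
  ring

/-- The row of P* is taken along the constant vector ν x, frozen at the point considered; its normal
jump at x is p* itself. -/
theorem pStar_eq_zero (hn : 1 ≤ n) (hL : HasLipschitzBoundary Ω) (hst : IsStationary W Ω y)
    {ν : Eu n → Eu n} (hν : ∀ x ∈ S, IsUnitNormal S x (ν x)) {x : Eu n} (hx : x ∈ S) :
    pStar W y x (ν x) = 0 := by
  obtain ⟨C, hC⟩ := h.exists_fluxData (h.continuousOn_row' (ν x)) (h.continuousOn_dir (ν x) 0 0) hν
    fun δ hδ => h.stationary_weak hst (ν x) (hδ.mono sdiff_subset)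
  have := hC.jump_eq_zero hn h.isOpen h.isBounded hL h.surface
    (fun δ hδ => h.stationary_weak hst (ν x) hδ) x hx
  beta_reduce at this
  rw [h.jump_eshelby hn hL hst.1 hν (ν x) hx, real_inner_self_eq_norm_sq, (hν x hx).1] at this
  simpa using this

end IsConfiguration

end JumpConditions

/-! ### The first variation as a boundary integral and a surface integral -/

section Variation

variable {n m : ℕ} {Ω S : Set (Eu n)}

/-- The components of δx and δy are Lipschitz only on closure Ω. They are extended to test
functions, which changes none of the integrands. -/
theorem FluxData.gauss_of_lipschitzOn {q qb : Eu n → Eu n} {f jmp : Eu n → ℝ} {C : ℝ}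
    (h : FluxData Ω S q qb f jmp C) (hn : 1 ≤ n) (hΩ : IsOpen Ω) (hΩb : Bornology.IsBounded Ω)
    (hL : HasLipschitzBoundary Ω) (hS : IsSurfaceIn Ω S) {δ : Eu n → ℝ}
    (hδ : ∃ L : ℝ≥0, LipschitzOnWith L δ (closure Ω)) :
    IntegrableOn (fun z => f z * δ z + fderiv ℝ δ z (q z)) Ω ∧
    IntegrableOn (fun x => δ x * ⟪qb x, outerNormal Ω x⟫) (frontier Ω) μHE[n - 1] ∧
    IntegrableOn (fun x => δ x * jmp x) S μHE[n - 1] ∧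
    ∫ z in Ω, (f z * δ z + fderiv ℝ δ z (q z))
      = (∫ x in frontier Ω, δ x * ⟪qb x, outerNormal Ω x⟫ ∂μHE[n - 1])
        - ∫ x in S, δ x * jmp x ∂μHE[n - 1] := by
  obtain ⟨δ', ht, he⟩ := exists_isTest_eqOn hΩb hδ
  have hc := ht.lipschitz.choose_spec.continuous
  obtain ⟨M, hM⟩ := exists_bound_of_hasCompactSupport hc ht.compact
  have e1 : EqOn (fun z => f z * δ' z + fderiv ℝ δ' z (q z))
      (fun z => f z * δ z + fderiv ℝ δ z (q z)) Ω := fun z hz => by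
    have h1 : δ' =ᶠ[𝓝 z] δ := by
      filter_upwards [hΩ.mem_nhds hz] with w hw using he (subset_closure hw)
    beta_reduce
    rw [h1.fderiv_eq, h1.eq_of_nhds]
  have e2 : EqOn (fun x => δ' x * ⟪qb x, outerNormal Ω x⟫) (fun x => δ x * ⟪qb x, outerNormal Ω x⟫)
      (frontier Ω) := fun z hz => by
    beta_reduce
    rw [he (frontier_subset_closure hz)]
  have e3 : EqOn (fun x => δ' x * jmp x) (fun x => δ x * jmp x) S := fun z hz => by
    beta_reduce
    rw [he (subset_closure (hS.subset hz))]
  have i1 : IntegrableOn (fun z => f z * δ' z + fderiv ℝ δ' z (q z)) Ω :=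
    (h.integrableOn_volume hΩ hS ht).1.add (h.integrableOn_volume hΩ hS ht).2
  refine ⟨(integrableOn_congr_fun e1 hΩ.measurableSet).1 i1,
    (integrableOn_congr_fun e2 isClosed_frontier.measurableSet).1
      ((h.integrableOn_boundary hΩb hL hS).bdd_mul (c := M) hc.aestronglyMeasurable (ae_of_all _ hM)),
    (integrableOn_congr_fun e3 (hS.measurableSet hΩ)).1
      ((h.integrableOn_jump hΩ hS).bdd_mul (c := M) hc.aestronglyMeasurable (ae_of_all _ hM)), ?_⟩
  rw [← setIntegral_congr_fun hΩ.measurableSet e1,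
    ← setIntegral_congr_fun isClosed_frontier.measurableSet e2,
    ← setIntegral_congr_fun (hS.measurableSet hΩ) e3]
  exact h.gauss hn hΩ hΩb hL hS ht

/-- The integrand of the first variation. -/
def variationDensity (W : Jet n m → ℝ) (y : Eu n → Eu m) (dx : Eu n → Eu n) (dy : Eu n → Eu m)
    (z : Eu n) : ℝ :=
  fderiv ℝ W (jet y z) (dx z, dy z, fderiv ℝ dy z - (fderiv ℝ y z).comp (fderiv ℝ dx z))
    + W (jet y z) * LinearMap.trace ℝ (Eu n) (fderiv ℝ dx z)

theorem trace_eq_sum (A : Eu n →L[ℝ] Eu n) :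
    LinearMap.trace ℝ (Eu n) A = ∑ β, (A (EuclideanSpace.single β 1)) β := by
  rw [LinearMap.trace_eq_matrix_trace ℝ (EuclideanSpace.basisFun (Fin n) ℝ).toBasis, Matrix.trace]
  refine Finset.sum_congr rfl fun β _ => ?_
  simp [LinearMap.toMatrix_apply]

theorem sum_fderiv_comp {W : Jet n m → ℝ} {j : Jet n m} (F : Grad n m) (A : Eu n →L[ℝ] Eu n) :
    ∑ β, fderiv ℝ W j (0, 0, ((EuclideanSpace.proj β : Eu n →L[ℝ] ℝ).comp A).smulRight
      (F (EuclideanSpace.single β 1))) = fderiv ℝ W j (0, 0, F.comp A) := by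
  set T := (fderiv ℝ W j).comp
    ((ContinuousLinearMap.inr ℝ (Eu n) (Eu m × Grad n m)).comp
      (ContinuousLinearMap.inr ℝ (Eu m) (Grad n m)))
  change ∑ i, T _ = T (F.comp A)
  rw [← map_sum]
  congr 1
  ext v k
  have h1 : (F (A v)) k = ∑ α, (A v) α * (F (EuclideanSpace.single α 1)) k :=
    fderiv_apply_eq_sum ((EuclideanSpace.proj k : Eu m →L[ℝ] ℝ).comp F) (A v)
  simp [h1]

theorem sum_fderiv_vec_left {W : Jet n m → ℝ} {j : Jet n m} (a : Eu n) :
    ∑ i, a i * fderiv ℝ W j (EuclideanSpace.single i 1, 0, 0) = fderiv ℝ W j (a, 0, 0) := by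
  set T := (fderiv ℝ W j).comp (ContinuousLinearMap.inl ℝ (Eu n) (Eu m × Grad n m))
  change ∑ i, a i * T (EuclideanSpace.single i 1) = T a
  exact (fderiv_apply_eq_sum T a).symm

/-- Because P* = W I - FᵀP, the terms -⟨P, F∇δx⟩ + W tr ∇δx are ⟨P*, ∇δx⟩. Components then split the
density into scalar pairings, to each of which Gauss's theorem applies. -/
theorem variationDensity_eq {W : Jet n m → ℝ} {y : Eu n → Eu m} {dx : Eu n → Eu n}
    {dy : Eu n → Eu m} {z : Eu n} (hdx : DifferentiableAt ℝ dx z) (hdy : DifferentiableAt ℝ dy z) :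
    variationDensity W y dx dy z
      = ∑ i, (fderiv ℝ W (jet y z) (0, EuclideanSpace.single i 1, 0) * dy z i
          + fderiv ℝ (fun x => dy x i) z (piolaT W (jet y z) (EuclideanSpace.single i 1)))
        + ∑ β, (fderiv ℝ W (jet y z) (EuclideanSpace.single β 1, 0, 0) * dx z β
          + fderiv ℝ (fun x => dx x β) z (eshelbyT W (jet y z) (EuclideanSpace.single β 1))) := by
  have d1 : ∀ i, fderiv ℝ (fun x => dy x i) z
      = (EuclideanSpace.proj i : Eu m →L[ℝ] ℝ).comp (fderiv ℝ dy z) := fun i =>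
    ((EuclideanSpace.proj i : Eu m →L[ℝ] ℝ).hasFDerivAt.comp z hdy.hasFDerivAt).fderiv
  have d2 : ∀ i, fderiv ℝ (fun x => dx x i) z
      = (EuclideanSpace.proj i : Eu n →L[ℝ] ℝ).comp (fderiv ℝ dx z) := fun i =>
    ((EuclideanSpace.proj i : Eu n →L[ℝ] ℝ).hasFDerivAt.comp z hdx.hasFDerivAt).fderiv
  have e1 : ∀ β : Fin n, fderiv ℝ (fun x => dx x β) z
      (eshelbyT W (jet y z) (EuclideanSpace.single β 1))
      = W (jet y z) * (fderiv ℝ dx z (EuclideanSpace.single β 1)) β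
        - fderiv ℝ W (jet y z) (0, 0, ((EuclideanSpace.proj β : Eu n →L[ℝ] ℝ).comp
          (fderiv ℝ dx z)).smulRight (fderiv ℝ y z (EuclideanSpace.single β 1))) := fun β => by
    rw [eshelbyT, map_sub, map_smul, apply_piolaT, d2]
    rfl
  have e2 : fderiv ℝ W (jet y z) (0, 0, fderiv ℝ dy z - (fderiv ℝ y z).comp (fderiv ℝ dx z))
      = fderiv ℝ W (jet y z) (0, 0, fderiv ℝ dy z)
        - fderiv ℝ W (jet y z) (0, 0, (fderiv ℝ y z).comp (fderiv ℝ dx z)) := by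
    rw [← map_sub]
    simp
  simp only [e1, apply_piolaT]
  simp only [d1]
  rw [variationDensity, fderiv_split, e2, trace_eq_sum, Finset.mul_sum, Finset.sum_add_distrib,
    Finset.sum_add_distrib, Finset.sum_sub_distrib, sum_fderiv_comp, sum_fderiv_grad,
    ← sum_fderiv_vec_left, ← sum_fderiv_vec]
  simp only [mul_comm]
  ring

namespace IsConfiguration

variable {y : Eu n → Eu m} {W : Jet n m → ℝ} {U : Set (Jet n m)}
  (h : IsConfiguration Ω S y W U)
include h

/-- The generalized Noether formula in terms of the vector fields `δx` and `δy`. -/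
theorem integral_variationDensity (hn : 1 ≤ n) (hL : HasLipschitzBoundary Ω)
    (hext : IsExtremal W Ω y) {ν : Eu n → Eu n} (hν : ∀ x ∈ S, IsUnitNormal S x (ν x))
    {dx : Eu n → Eu n} {dy : Eu n → Eu m} (hdx : ∃ L : ℝ≥0, LipschitzOnWith L dx (closure Ω))
    (hdy : ∃ L : ℝ≥0, LipschitzOnWith L dy (closure Ω)) :
    IntegrableOn (variationDensity W y dx dy) Ω ∧
    IntegrableOn (fun x => ⟪Matrix.toEuclideanLin (piola W (boundaryJet Ω S y x)) (outerNormal Ω x),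
      dy x⟫ + ⟪Matrix.toEuclideanLin (eshelby W (boundaryJet Ω S y x)) (outerNormal Ω x), dx x⟫)
      (frontier Ω) μHE[n - 1] ∧
    IntegrableOn (fun x => pStar W y x (ν x) * ⟪ν x, dx x⟫) S μHE[n - 1] ∧
    ∫ z in Ω, variationDensity W y dx dy z
      = (∫ x in frontier Ω, (⟪Matrix.toEuclideanLin (piola W (boundaryJet Ω S y x))
        (outerNormal Ω x), dy x⟫ + ⟪Matrix.toEuclideanLin (eshelby W (boundaryJet Ω S y x))
        (outerNormal Ω x), dx x⟫) ∂μHE[n - 1])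
        - ∫ x in S, pStar W y x (ν x) * ⟪ν x, dx x⟫ ∂μHE[n - 1] := by
  obtain ⟨L, hLx⟩ := hdx
  obtain ⟨M, hMy⟩ := hdy
  have lx : ∀ β, ∃ L : ℝ≥0, LipschitzOnWith L (fun x => dx x β) (closure Ω) := fun β =>
    ⟨_, ((EuclideanSpace.proj β : Eu n →L[ℝ] ℝ).lipschitz).comp_lipschitzOnWith hLx⟩
  have ly : ∀ i, ∃ L : ℝ≥0, LipschitzOnWith L (fun x => dy x i) (closure Ω) := fun i =>
    ⟨_, ((EuclideanSpace.proj i : Eu m →L[ℝ] ℝ).lipschitz).comp_lipschitzOnWith hMy⟩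
  have A := fun i : Fin m =>
    (h.exists_fluxData (h.continuousOn_row (EuclideanSpace.single i 1))
      (h.continuousOn_dir 0 (EuclideanSpace.single i 1) 0) hν
      fun δ hδ => h.extremal_weak hext _ (hδ.mono sdiff_subset)).choose_spec.gauss_of_lipschitzOn
      hn h.isOpen h.isBounded hL h.surface (ly i)
  -- The rows of P* satisfy their equation only off S (`noether_weak`), which is why a surface term
  -- can survive.
  have B := fun β : Fin n =>
    (h.exists_fluxData (h.continuousOn_row' (EuclideanSpace.single β 1))
      (h.continuousOn_dir (EuclideanSpace.single β 1) 0 0) hν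
      fun δ hδ => h.noether_weak hext _ hδ).choose_spec.gauss_of_lipschitzOn
      hn h.isOpen h.isBounded hL h.surface (lx β)
  have hSm := h.surface.measurableSet h.isOpen
  have hb : ∀ x, ⟪Matrix.toEuclideanLin (piola W (boundaryJet Ω S y x)) (outerNormal Ω x), dy x⟫
      + ⟪Matrix.toEuclideanLin (eshelby W (boundaryJet Ω S y x)) (outerNormal Ω x), dx x⟫
      = ∑ i, dy x i * ⟪piolaT W (boundaryJet Ω S y x) (EuclideanSpace.single i 1), outerNormal Ω x⟫
        + ∑ β, dx x β * ⟪eshelbyT W (boundaryJet Ω S y x) (EuclideanSpace.single β 1),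
          outerNormal Ω x⟫ := fun x => by
    simp only [← inner_piola, ← inner_eshelby]
    congr 1
    · exact fderiv_apply_eq_sum (innerSL ℝ (Matrix.toEuclideanLin (piola W (boundaryJet Ω S y x))
        (outerNormal Ω x))) (dy x)
    · exact fderiv_apply_eq_sum (innerSL ℝ (Matrix.toEuclideanLin (eshelby W (boundaryJet Ω S y x))
        (outerNormal Ω x))) (dx x)
  -- On S the rows of P contribute nothing, since the traction is continuous, and the rows of P*
  -- contribute p* times the normal component of δx.
  have hs : EqOn (fun x => ∑ i, dy x i * ⟪piolaT W (sideJet y x (ν x)) (EuclideanSpace.single i 1)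
        - piolaT W (sideJet y x (-ν x)) (EuclideanSpace.single i 1), ν x⟫
      + ∑ β, dx x β * ⟪eshelbyT W (sideJet y x (ν x)) (EuclideanSpace.single β 1)
        - eshelbyT W (sideJet y x (-ν x)) (EuclideanSpace.single β 1), ν x⟫)
      (fun x => pStar W y x (ν x) * ⟪ν x, dx x⟫) S := fun x hx => by
    beta_reduce
    rw [Finset.sum_eq_zero fun i _ => by
      rw [inner_sub_left, h.jump_piola hn hL hext hν _ hx, sub_self, mul_zero], zero_add]
    simp only [h.jump_eshelby hn hL hext hν _ hx]
    rw [← innerSL_apply_apply ℝ (ν x) (dx x), fderiv_apply_eq_sum (innerSL ℝ (ν x)) (dx x),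
      Finset.mul_sum]
    exact Finset.sum_congr rfl fun β _ => by rw [innerSL_apply_apply]; ring
  simp only [hb]
  have dX := (hLx.mono subset_closure).ae_differentiableWithinAt (μ := volume) h.isOpen.measurableSet
  have dY := (hMy.mono subset_closure).ae_differentiableWithinAt (μ := volume) h.isOpen.measurableSet
  have hvd : variationDensity W y dx dy =ᵐ[volume.restrict Ω] fun z =>
      ∑ i, (fderiv ℝ W (jet y z) (0, EuclideanSpace.single i 1, 0) * dy z i
          + fderiv ℝ (fun x => dy x i) z (piolaT W (jet y z) (EuclideanSpace.single i 1)))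
        + ∑ β, (fderiv ℝ W (jet y z) (EuclideanSpace.single β 1, 0, 0) * dx z β
          + fderiv ℝ (fun x => dx x β) z (eshelbyT W (jet y z) (EuclideanSpace.single β 1))) := by
    filter_upwards [dX, dY, ae_restrict_mem h.isOpen.measurableSet] with z h1 h2 hz
    exact variationDensity_eq (h1.differentiableAt (h.isOpen.mem_nhds hz))
      (h2.differentiableAt (h.isOpen.mem_nhds hz))
  have hvi := (integrable_finsetSum Finset.univ fun i _ => (A i).1).add
    (integrable_finsetSum Finset.univ fun β _ => (B β).1)
  refine ⟨hvi.congr hvd.symm, (integrable_finsetSum _ fun i _ => (A i).2.1).add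
    (integrable_finsetSum _ fun β _ => (B β).2.1), (integrableOn_congr_fun hs hSm).1
    ((integrable_finsetSum _ fun i _ => (A i).2.2.1).add
      (integrable_finsetSum _ fun β _ => (B β).2.2.1)), ?_⟩
  rw [← setIntegral_congr_fun hSm hs,
    integral_add (integrable_finsetSum _ fun i _ => (A i).2.1)
      (integrable_finsetSum _ fun β _ => (B β).2.1),
    integral_add (integrable_finsetSum _ fun i _ => (A i).2.2.1)
      (integrable_finsetSum _ fun β _ => (B β).2.2.1),
    integral_finsetSum _ fun i _ => (A i).2.1, integral_finsetSum _ fun i _ => (B i).2.1,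
    integral_finsetSum _ fun i _ => (A i).2.2.1, integral_finsetSum _ fun i _ => (B i).2.2.1,
    add_sub_add_comm, ← Finset.sum_sub_distrib, ← Finset.sum_sub_distrib,
    ← Finset.sum_congr rfl fun i _ => (A i).2.2.2, ← Finset.sum_congr rfl fun i _ => (B i).2.2.2,
    ← integral_finsetSum _ fun i _ => (A i).1, ← integral_finsetSum _ fun i _ => (B i).1,
    ← integral_add (integrable_finsetSum _ fun i _ => (A i).1)
      (integrable_finsetSum _ fun β _ => (B β).1)]
  exact integral_congr_ae hvd

end IsConfiguration

end Variation

/-! ### First-order expansions of the determinant, of C¹ functions and of the family -/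

section Expansions

variable {n m : ℕ}

theorem det_eq_matrix_det (A : Eu n →L[ℝ] Eu n) : A.det = (gradMatrix A).det := by
  rw [ContinuousLinearMap.det,
    ← LinearMap.det_toMatrix (EuclideanSpace.basisFun (Fin n) ℝ).toBasis]
  congr 1

theorem differentiable_det : Differentiable ℝ (fun A : Eu n →L[ℝ] Eu n => A.det) := by
  have h1 : ∀ i j, Differentiable ℝ fun A : Eu n →L[ℝ] Eu n => gradMatrix A i j := fun i j =>
    ((EuclideanSpace.proj i : Eu n →L[ℝ] ℝ).comp
      (ContinuousLinearMap.apply ℝ (Eu n) (EuclideanSpace.single j (1 : ℝ)))).differentiable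
  simp only [det_eq_matrix_det, Matrix.det_apply]
  refine Differentiable.fun_sum fun σ _ => Differentiable.const_smul ?_ _
  exact fun A => (HasFDerivAt.finsetProd fun i _ => (h1 (σ i) i A).hasFDerivAt).differentiableAt

theorem fderiv_det_one (M : Eu n →L[ℝ] Eu n) :
    fderiv ℝ (fun A : Eu n →L[ℝ] Eu n => A.det) 1 M = LinearMap.trace ℝ (Eu n) M := by
  have h1 : HasDerivAt (fun t : ℝ => (1 + t • M : Eu n →L[ℝ] Eu n).det)
      (fderiv ℝ (fun A : Eu n →L[ℝ] Eu n => A.det) 1 M) 0 :=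
    (differentiable_det 1).hasFDerivAt.hasLineDerivAt M
  refine h1.unique ?_
  have h2 : ∀ t : ℝ, (1 + t • M : Eu n →L[ℝ] Eu n).det = (1 + t • gradMatrix M).det := fun t => by
    rw [det_eq_matrix_det]
    congr 1
    ext i j
    simp [gradMatrix, Matrix.one_apply]
  have h3 : (gradMatrix M).trace = LinearMap.trace ℝ (Eu n) M := by
    rw [trace_eq_sum]
    rfl
  have h4 : HasDerivAt (fun t : ℝ => 1 + LinearMap.trace ℝ (Eu n) M * t)
      (LinearMap.trace ℝ (Eu n) M) 0 := by
    simpa using ((hasDerivAt_id (0 : ℝ)).const_mul (LinearMap.trace ℝ (Eu n) M)).const_add 1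
  have h5 : HasDerivAt (fun t : ℝ => Polynomial.eval t (Matrix.det (1 + (Polynomial.X : Polynomial ℝ)
      • (gradMatrix M).map Polynomial.C)).divX.divX * t ^ 2) 0 0 := by
    have := (Polynomial.hasDerivAt (Matrix.det (1 + (Polynomial.X : Polynomial ℝ)
      • (gradMatrix M).map Polynomial.C)).divX.divX (0 : ℝ)).fun_mul (hasDerivAt_pow 2 (0 : ℝ))
    simpa only [add_zero, mul_zero, zero_pow two_ne_zero, ne_eq, Nat.cast_ofNat, Nat.reduceSub,
      pow_one] using this
  have h6 := h4.fun_add h5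
  rw [add_zero] at h6
  refine h6.congr_of_eventuallyEq (.of_forall fun t => ?_)
  beta_reduce
  rw [h2, Matrix.det_one_add_smul, h3]

/-- A function of class `C¹` is uniformly differentiable on compact sets. -/
theorem exists_uniform_differentiability {E : Type*} [NormedAddCommGroup E] [NormedSpace ℝ E]
    {f : E → ℝ} {U K : Set E} (hU : IsOpen U) (hf : ContDiffOn ℝ 1 f U) (hK : IsCompact K)
    (hKU : K ⊆ U) {η : ℝ} (hη : 0 < η) :
    ∃ ρ, 0 < ρ ∧ ∀ p ∈ K, ∀ q, ‖q - p‖ < ρ →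
      q ∈ U ∧ ‖f q - f p - fderiv ℝ f p (q - p)‖ ≤ η * ‖q - p‖ := by
  -- Strict differentiability at p costs η/2 and replacing f'(p) by f'(p') another η/2. The doubled
  -- radius for q lets a finite cover by r-balls yield one common ρ.
  have hloc : ∀ p ∈ K, ∃ r, 0 < r ∧ ∀ p' ∈ Metric.ball p r, ∀ q ∈ Metric.ball p (2 * r),
      q ∈ U ∧ ‖f q - f p' - fderiv ℝ f p' (q - p')‖ ≤ η * ‖q - p'‖ := by
    intro p hp
    have h1 := (hf.contDiffAt (hU.mem_nhds (hKU hp))).hasStrictFDerivAt one_ne_zero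
    have h2 := (hf.continuousOn_fderiv_of_isOpen hU le_rfl).continuousAt (hU.mem_nhds (hKU hp))
    have h3 := (Asymptotics.isLittleO_iff.1 h1.isLittleO) (half_pos hη)
    rw [nhds_prod_eq, (Metric.nhds_basis_ball.prod_self).eventually_iff] at h3
    obtain ⟨r₁, hr₁, h3⟩ := h3
    obtain ⟨r₂, hr₂, h4⟩ := Metric.continuousAt_iff.1 h2 (η / 2) (half_pos hη)
    obtain ⟨r₃, hr₃, h5⟩ := Metric.isOpen_iff.1 hU p (hKU hp)
    have hm : 0 < min r₁ (min r₂ r₃) := lt_min hr₁ (lt_min hr₂ hr₃)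
    have m1 : min r₁ (min r₂ r₃) ≤ r₁ := min_le_left _ _
    have m2 : min r₁ (min r₂ r₃) ≤ r₂ := (min_le_right _ _).trans (min_le_left _ _)
    have m3 : min r₁ (min r₂ r₃) ≤ r₃ := (min_le_right _ _).trans (min_le_right _ _)
    refine ⟨min r₁ (min r₂ r₃) / 2, half_pos hm, fun p' hp' q hq => ?_⟩
    rw [mul_div_cancel₀ _ two_ne_zero] at hq
    rw [Metric.mem_ball] at hp' hq
    refine ⟨h5 (hq.trans_le m3), ?_⟩
    have e1 := h3 (x := (q, p')) ⟨Metric.mem_ball.2 (hq.trans_le m1), Metric.mem_ball.2 (by linarith)⟩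
    have e2 := (h4 (x := p') (by linarith)).le
    rw [dist_eq_norm] at e2
    have e3 := ((fderiv ℝ f p' - fderiv ℝ f p).le_opNorm (q - p')).trans
      (mul_le_mul_of_nonneg_right e2 (norm_nonneg _))
    have e4 : f q - f p' - fderiv ℝ f p' (q - p')
        = (f q - f p' - fderiv ℝ f p (q - p')) - (fderiv ℝ f p' - fderiv ℝ f p) (q - p') := by
      rw [_root_.sub_apply]; ring
    rw [e4]
    refine (norm_sub_le _ _).trans ?_
    have e1' : ‖f q - f p' - fderiv ℝ f p (q - p')‖ ≤ η / 2 * ‖q - p'‖ := e1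
    linarith
  choose! r hr h using hloc
  obtain ⟨t, ht, hcov⟩ := hK.elim_nhds_subcover (fun p => Metric.ball p (r p))
    fun p hp => Metric.ball_mem_nhds p (hr p hp)
  rcases t.eq_empty_or_nonempty with rfl | hne
  · refine ⟨1, one_pos, fun p hp => ?_⟩
    simpa using hcov hp
  obtain ⟨p₀, hp₀, hmin⟩ := t.exists_min_image r hne
  refine ⟨r p₀, hr p₀ (ht p₀ hp₀), fun p hp q hq => ?_⟩
  obtain ⟨p₁, hp₁, hpp⟩ := mem_iUnion₂.1 (hcov hp)
  refine h p₁ (ht p₁ hp₁) p hpp q ?_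
  have h1 := hmin p₁ hp₁
  have h2 := dist_triangle q p p₁
  rw [Metric.mem_ball] at hpp ⊢
  rw [← dist_eq_norm] at hq
  linarith

/-- The mean value inequality in ε, applied to Φ_ε(p) - Φ_ε(q), turns continuity of the velocity in
the Lipschitz seminorm into a remainder that is o(ε) in this seminorm. The uniform bound follows
from it and from differentiability in ε at the single point p = 0. -/
theorem IsC1Family.expansion {Φ : ℝ → Eu n × Eu m → Eu n × Eu m} {ε₀ : ℝ} (h : IsC1Family Φ ε₀)
    {R : ℝ} (hR : 0 < R) {η : ℝ≥0} (hη : 0 < η) :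
    ∀ᶠ ε in 𝓝 (0 : ℝ),
      LipschitzOnWith (η * ‖ε‖₊) (fun p => Φ ε p - p - ε • velocity Φ 0 p) (Metric.ball 0 R) ∧
      ∀ p ∈ Metric.ball (0 : Eu n × Eu m) R, ‖Φ ε p - p - ε • velocity Φ 0 p‖ ≤ η * |ε| := by
  have h0 : (0 : ℝ) ∈ Ioo (-ε₀) ε₀ := ⟨neg_lt_zero.2 h.pos, h.pos⟩
  have hd : ∀ p, ∀ s ∈ Ioo (-ε₀) ε₀, HasDerivAt (fun s => Φ s p) (velocity Φ s p) s :=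
    fun p s hs => (((h.contDiffOn p).differentiableOn one_ne_zero).differentiableAt
      (isOpen_Ioo.mem_nhds hs)).hasDerivAt
  have key : ∀ η : ℝ≥0, 0 < η → ∀ᶠ ε in 𝓝 (0 : ℝ),
      LipschitzOnWith (η * ‖ε‖₊) (fun p => Φ ε p - p - ε • velocity Φ 0 p) (Metric.ball 0 R) := by
    intro η hη
    obtain ⟨τ, hτ, hball⟩ := Metric.eventually_nhds_iff_ball.1
      ((h.velocity_continuous R 0 h0 η hη).and (isOpen_Ioo.eventually_mem h0))
    filter_upwards [Metric.ball_mem_nhds (0 : ℝ) hτ] with ε hε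
    apply LipschitzOnWith.of_dist_le_mul
    intro p hp q hq
    have h1 : ∀ s ∈ Metric.ball (0 : ℝ) τ, HasDerivWithinAt
        (fun s => (Φ s p - Φ s q) - s • (velocity Φ 0 p - velocity Φ 0 q))
        ((velocity Φ s p - velocity Φ s q) - (velocity Φ 0 p - velocity Φ 0 q))
        (Metric.ball 0 τ) s := fun s hs => by
      have hs' := (hball s hs).2
      have := (((hd p s hs').fun_sub (hd q s hs')).fun_sub
        ((hasDerivAt_id s).smul_const (velocity Φ 0 p - velocity Φ 0 q))).hasDerivWithinAt
        (s := Metric.ball 0 τ)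
      rw [one_smul] at this
      exact this
    have h2 : ∀ s ∈ Metric.ball (0 : ℝ) τ,
        ‖(velocity Φ s p - velocity Φ s q) - (velocity Φ 0 p - velocity Φ 0 q)‖ ≤ η * dist p q :=
      fun s hs => by
        have := (hball s hs).1.dist_le_mul p hp q hq
        rwa [dist_eq_norm, sub_sub_sub_comm] at this
    have h3 := (convex_ball (0 : ℝ) τ).norm_image_sub_le_of_norm_hasDerivWithin_le h1 h2
      (Metric.mem_ball_self hτ) hε
    rw [h.zero, h.zero, zero_smul, sub_zero, sub_zero] at h3
    rw [dist_eq_norm]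
    have e1 : Φ ε p - p - ε • velocity Φ 0 p - (Φ ε q - q - ε • velocity Φ 0 q)
        = Φ ε p - Φ ε q - ε • (velocity Φ 0 p - velocity Φ 0 q) - (p - q) := by
      rw [smul_sub]; abel
    rw [e1]
    refine h3.trans (le_of_eq ?_)
    push_cast
    ring
  -- The point 0 contributes κ|ε| and the Lipschitz seminorm at most κR|ε|, in total η|ε|.
  set κ : ℝ≥0 := η / (1 + R.toNNReal) with hκ
  have hκ0 : 0 < κ := div_pos hη (by positivity)
  have hbase : ∀ᶠ ε in 𝓝 (0 : ℝ), ‖Φ ε 0 - 0 - ε • velocity Φ 0 0‖ ≤ κ * |ε| := by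
    have := hasDerivAt_iff_isLittleO_nhds_zero.1 (hd 0 0 h0)
    have := (Asymptotics.isLittleO_iff.1 this) (c := (κ : ℝ)) hκ0
    filter_upwards [this] with ε hε
    rwa [zero_add, h.zero] at hε
  filter_upwards [key η hη, key κ hκ0, hbase] with ε h1 h2 h3
  refine ⟨h1, fun p hp => ?_⟩
  have h4 := h2.dist_le_mul p hp 0 (Metric.mem_ball_self hR)
  rw [dist_eq_norm, dist_zero_right] at h4
  have h5 : ‖Φ ε p - p - ε • velocity Φ 0 p‖
      ≤ ‖Φ ε p - p - ε • velocity Φ 0 p - (Φ ε 0 - 0 - ε • velocity Φ 0 0)‖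
        + ‖Φ ε 0 - 0 - ε • velocity Φ 0 0‖ := by
    have := norm_add_le (Φ ε p - p - ε • velocity Φ 0 p - (Φ ε 0 - 0 - ε • velocity Φ 0 0))
      (Φ ε 0 - 0 - ε • velocity Φ 0 0)
    rwa [sub_add_cancel] at this
  have h6 : ‖p‖ ≤ R := (mem_ball_zero_iff.1 hp).le
  have h7 : (κ : ℝ) * (1 + R) = η := by
    rw [hκ]
    push_cast
    rw [Real.coe_toNNReal R hR.le, div_mul_cancel₀]
    positivity
  refine h5.trans ((add_le_add h4 h3).trans ?_)
  push_cast
  rw [← h7, Real.norm_eq_abs]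
  have : (κ : ℝ) * |ε| * ‖p‖ ≤ κ * |ε| * R := by gcongr
  linarith

end Expansions

/-! ### A calculus of uniform first-order expansions -/

section FirstOrder

variable {ι E F G : Type*} [NormedAddCommGroup E] [NormedSpace ℝ E] [NormedAddCommGroup F]
  [NormedSpace ℝ F] [NormedAddCommGroup G] [NormedSpace ℝ G] {l : Filter ι} {ε : ι → ℝ}

/-- `u = u₀ + ε u₁ + o(ε)`, with bounded `u₀` and `u₁`. -/
structure FirstOrder (l : Filter ι) (ε : ι → ℝ) (u u₀ u₁ : ι → E) : Prop where
  base : u₀ =O[l] fun _ => (1 : ℝ)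
  slope : u₁ =O[l] fun _ => (1 : ℝ)
  rest : (fun i => u i - u₀ i - ε i • u₁ i) =o[l] ε

theorem FirstOrder.sub_isBigO {u u₀ u₁ : ι → E} (h : FirstOrder l ε u u₀ u₁) :
    (fun i => u i - u₀ i) =O[l] ε := by
  have h1 : (fun i => ε i • u₁ i) =O[l] ε := by
    simpa using (Asymptotics.isBigO_refl ε l).smul h.slope
  simpa using h.rest.isBigO.add h1

theorem FirstOrder.prodMk {u u₀ u₁ : ι → E} {v v₀ v₁ : ι → F} (hu : FirstOrder l ε u u₀ u₁)
    (hv : FirstOrder l ε v v₀ v₁) :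
    FirstOrder l ε (fun i => (u i, v i)) (fun i => (u₀ i, v₀ i)) (fun i => (u₁ i, v₁ i)) :=
  ⟨hu.base.prod_left hv.base, hu.slope.prod_left hv.slope, hu.rest.prod_left hv.rest⟩

theorem FirstOrder.bilinear (hε : Tendsto ε l (𝓝 0)) (L : E →L[ℝ] F →L[ℝ] G)
    {u u₀ u₁ : ι → E} {v v₀ v₁ : ι → F} (hu : FirstOrder l ε u u₀ u₁)
    (hv : FirstOrder l ε v v₀ v₁) :
    FirstOrder l ε (fun i => L (u i) (v i)) (fun i => L (u₀ i) (v₀ i))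
      (fun i => L (u₀ i) (v₁ i) + L (u₁ i) (v₀ i)) := by
  have hε1 : ε =O[l] fun _ => (1 : ℝ) := hε.isBigO_one ℝ
  have hb : ∀ {p : ι → E} {q : ι → F} {a b : ι → ℝ}, p =O[l] a → q =O[l] b →
      (fun i => L (p i) (q i)) =O[l] fun i => a i * b i := fun hp hq =>
    L.isBoundedBilinearMap.isBigO_comp.trans (hp.norm_left.mul hq.norm_left)
  have b1 : ∀ {p : ι → E} {q : ι → F}, p =O[l] (fun _ => (1 : ℝ)) → q =O[l] (fun _ => (1 : ℝ)) →
      (fun i => L (p i) (q i)) =O[l] fun _ => (1 : ℝ) := fun hp hq => by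
    simpa using hb hp hq
  refine ⟨b1 hu.base hv.base, (b1 hu.base hv.slope).add (b1 hu.slope hv.base), ?_⟩
  have hvO : v =O[l] fun _ => (1 : ℝ) := by
    simpa using (hv.sub_isBigO.trans hε1).add hv.base
  have huO : (fun i => u₀ i + ε i • u₁ i) =O[l] fun _ => (1 : ℝ) :=
    hu.base.add (by simpa using hε1.smul hu.slope)
  have t1 : (fun i => L (u i - u₀ i - ε i • u₁ i) (v i)) =o[l] ε := by
    have := (L.isBoundedBilinearMap.isBigO_comp (g := fun i => u i - u₀ i - ε i • u₁ i)
      (h := v)).trans_isLittleO (hu.rest.norm_left.mul_isBigO hvO.norm_left)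
    simpa using this
  have t2 : (fun i => L (u₀ i + ε i • u₁ i) (v i - v₀ i - ε i • v₁ i)) =o[l] ε := by
    have := (L.isBoundedBilinearMap.isBigO_comp (g := fun i => u₀ i + ε i • u₁ i)
      (h := fun i => v i - v₀ i - ε i • v₁ i)).trans_isLittleO
      (huO.norm_left.mul_isLittleO hv.rest.norm_left)
    simpa using this
  have t3 : (fun i => ε i • ε i • L (u₁ i) (v₁ i)) =o[l] ε := by
    have h1 : (fun i => ε i • L (u₁ i) (v₁ i)) =o[l] fun _ => (1 : ℝ) := by
      simpa using ((Asymptotics.isLittleO_one_iff ℝ).2 hε).smul_isBigO (b1 hu.slope hv.slope)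
    simpa using (Asymptotics.isBigO_refl ε l).smul_isLittleO h1
  refine ((t1.add t2).add t3).congr_left fun i => ?_
  simp only [map_sub, map_add, map_smul, _root_.sub_apply, _root_.add_apply,
    _root_.smul_apply, smul_add]
  abel

/-- The base points u₀ i vary with i, so f must be differentiable uniformly on a set K that contains
them; pointwise differentiability would not suffice. -/
theorem FirstOrder.comp {f : E → ℝ} {f' : E → E →L[ℝ] ℝ} {K : Set E}
    (hf : ∀ η : ℝ, 0 < η → ∃ ρ, 0 < ρ ∧ ∀ p ∈ K, ∀ q, ‖q - p‖ < ρ →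
      ‖f q - f p - f' p (q - p)‖ ≤ η * ‖q - p‖)
    (hb : ∃ C, ∀ p ∈ K, ‖f p‖ ≤ C) (hb' : ∃ C, ∀ p ∈ K, ‖f' p‖ ≤ C)
    (hε : Tendsto ε l (𝓝 0)) {u u₀ u₁ : ι → E} (hu : FirstOrder l ε u u₀ u₁)
    (hK : ∀ᶠ i in l, u₀ i ∈ K) :
    FirstOrder l ε (fun i => f (u i)) (fun i => f (u₀ i)) (fun i => f' (u₀ i) (u₁ i)) := by
  obtain ⟨C, hC⟩ := hb
  obtain ⟨C', hC'⟩ := hb'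
  have hL : ∀ {p : ι → E} {a : ι → ℝ}, p =O[l] a → (fun i => f' (u₀ i) (p i)) =O[l] a :=
    fun {p a} hp => by
    refine .trans (.of_bound C' ?_) hp
    filter_upwards [hK] with i hi
    exact ((f' (u₀ i)).le_opNorm _).trans (by gcongr; exact hC' _ hi)
  refine ⟨.of_bound C ?_, hL hu.slope, ?_⟩
  · filter_upwards [hK] with i hi
    simpa using hC _ hi
  have t1 : (fun i => f (u i) - f (u₀ i) - f' (u₀ i) (u i - u₀ i)) =o[l] ε := by
    refine Asymptotics.IsLittleO.trans_isBigO ?_ hu.sub_isBigO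
    rw [Asymptotics.isLittleO_iff]
    intro η hη
    obtain ⟨ρ, hρ, h⟩ := hf η hη
    have h0 : Tendsto (fun i => u i - u₀ i) l (𝓝 0) := hu.sub_isBigO.trans_tendsto hε
    filter_upwards [hK, h0.eventually (Metric.ball_mem_nhds 0 hρ)] with i hi h1
    exact h _ hi _ (mem_ball_zero_iff.1 h1)
  have t2 : (fun i => f' (u₀ i) (u i - u₀ i - ε i • u₁ i)) =o[l] ε := by
    exact (hL (p := fun i => u i - u₀ i - ε i • u₁ i) (a := fun i => ‖u i - u₀ i - ε i • u₁ i‖)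
      (Asymptotics.isBigO_refl _ _).norm_right).trans_isLittleO hu.rest.norm_left
  refine (t1.add t2).congr_left fun i => ?_
  simp only [map_sub, map_smul, smul_eq_mul]
  ring

theorem FirstOrder.comp_hasFDerivAt {f : E → F} {f' : E →L[ℝ] F} {p : E} (hf : HasFDerivAt f f' p)
    (hε : Tendsto ε l (𝓝 0)) {u u₁ : ι → E} (hu : FirstOrder l ε u (fun _ => p) u₁) :
    FirstOrder l ε (fun i => f (u i)) (fun _ => f p) (fun i => f' (u₁ i)) := by
  refine ⟨Asymptotics.isBigO_const_const _ one_ne_zero _, (f'.isBigO_comp _ _).trans hu.slope, ?_⟩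
  have h0 : Tendsto u l (𝓝 p) := by
    simpa using (hu.sub_isBigO.trans_tendsto hε).add_const p
  have t1 := (hf.isLittleO.comp_tendsto h0).trans_isBigO hu.sub_isBigO
  have t2 : (fun i => f' (u i - p - ε i • u₁ i)) =o[l] ε :=
    (f'.isBigO_comp _ _).trans_isLittleO hu.rest
  refine (t1.add t2).congr_left fun i => ?_
  simp only [Function.comp_apply, map_sub, map_smul]
  abel

end FirstOrder

/-! ### Expansion of the pulled-back energy density -/

section Density

variable {ι : Type*} {n m : ℕ} {l : Filter ι} {ε : ι → ℝ}

/-- First-order expansion of the energy density of a transformed graph. -/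
theorem FirstOrder.density {W : Jet n m → ℝ} {U K : Set (Jet n m)} (hU : IsOpen U)
    (hW : ContDiffOn ℝ 1 W U) (hK : IsCompact K) (hKU : K ⊆ U) (hε : Tendsto ε l (𝓝 0))
    {X x dx : ι → Eu n} {Y y dy : ι → Eu m} {A a : ι → Eu n →L[ℝ] Eu n} {B F b : ι → Grad n m}
    (hX : FirstOrder l ε X x dx) (hY : FirstOrder l ε Y y dy)
    (hA : FirstOrder l ε A (fun _ => 1) a) (hB : FirstOrder l ε B F b)
    (hj : ∀ᶠ i in l, (x i, y i, F i) ∈ K) :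
    FirstOrder l ε (fun i => |(A i).det| * W (X i, Y i, (B i).comp (Ring.inverse (A i))))
      (fun i => W (x i, y i, F i))
      (fun i => fderiv ℝ W (x i, y i, F i) (dx i, dy i, b i - (F i).comp (a i))
        + W (x i, y i, F i) * LinearMap.trace ℝ (Eu n) (a i)) ∧
    (∀ᶠ i in l, (X i, Y i, (B i).comp (Ring.inverse (A i))) ∈ U) ∧
    (fun i => W (X i, Y i, (B i).comp (Ring.inverse (A i)))) =O[l] fun _ => (1 : ℝ) := by
  -- The transformed gradient is B A⁻¹. The derivative of inversion at the identity is a ↦ -a, so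
  -- its first-order term is b - F a.
  have hinv : FirstOrder l ε (fun i => Ring.inverse (A i)) (fun _ => 1) (fun i => -a i) := by
    have := hA.comp_hasFDerivAt (hasFDerivAt_ringInverse (𝕜 := ℝ) (1 : (Eu n →L[ℝ] Eu n)ˣ)) hε
    simpa using this
  have hdet : FirstOrder l ε (fun i => (A i).det) (fun _ => 1)
      (fun i => LinearMap.trace ℝ (Eu n) (a i)) := by
    have := hA.comp_hasFDerivAt (differentiable_det 1).hasFDerivAt hε
    have h1 : (1 : Eu n →L[ℝ] Eu n).det = 1 := by
      simp [ContinuousLinearMap.det]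
    simpa only [h1, fderiv_det_one] using this
  -- The determinant is near 1, so the absolute value in the Jacobian may be dropped.
  have hpos : ∀ᶠ i in l, 0 < (A i).det := by
    have h1 : Tendsto (fun i => (A i).det) l (𝓝 1) := by
      simpa using (hdet.sub_isBigO.trans_tendsto hε).add_const 1
    exact h1.eventually (lt_mem_nhds one_pos)
  have hG : FirstOrder l ε (fun i => (B i).comp (Ring.inverse (A i))) F
      (fun i => b i - (F i).comp (a i)) := by
    have := hB.bilinear hε (ContinuousLinearMap.compL ℝ (Eu n) (Eu n) (Eu m)) hinv
    simpa [ContinuousLinearMap.one_def, neg_add_eq_sub] using this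
  have hJ := hX.prodMk (hY.prodMk hG)
  have hWK := fun η (hη : (0 : ℝ) < η) => exists_uniform_differentiability hU hW hK hKU hη
  have hWJ := hJ.comp (f := W) (f' := fderiv ℝ W) (K := K)
    (fun η hη => let ⟨ρ, hρ, h⟩ := hWK η hη; ⟨ρ, hρ, fun p hp q hq => (h p hp q hq).2⟩)
    (hK.exists_bound_of_continuousOn (hW.continuousOn.mono hKU))
    (hK.exists_bound_of_continuousOn ((hW.continuousOn_fderiv_of_isOpen hU le_rfl).mono hKU)) hε hj
  have hD := hdet.bilinear hε (ContinuousLinearMap.mul ℝ ℝ) hWJ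
  refine ⟨⟨hWJ.base, ?_, ?_⟩, ?_, ?_⟩
  · simpa [mul_comm] using hD.slope
  · refine hD.rest.congr' ?_ .rfl
    filter_upwards [hpos] with i hi
    rw [abs_of_pos hi]
    simp only [ContinuousLinearMap.mul_apply', one_mul, mul_comm]
  · obtain ⟨ρ, hρ, h⟩ := hWK 1 one_pos
    have h0 := hJ.sub_isBigO.trans_tendsto hε
    filter_upwards [hj, h0.eventually (Metric.ball_mem_nhds 0 hρ)] with i hi h1
    exact (h _ hi _ (mem_ball_zero_iff.1 h1)).1
  · simpa using (hWJ.sub_isBigO.trans (hε.isBigO_one ℝ)).add hWJ.base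

end Density

/-! ### Graphs transformed by a map close to the identity -/

section GraphTransform

variable {n m : ℕ} {Ω : Set (Eu n)} {X : Eu n → Eu n} {Y : Eu n → Eu m} {L : ℝ≥0}

theorem approximatesLinearOn_id (hX : LipschitzOnWith 2⁻¹ (fun z => X z - z) Ω) :
    ApproximatesLinearOn X
      (ContinuousLinearEquiv.refl ℝ (Eu n) : Eu n →L[ℝ] Eu n) Ω 2⁻¹ := by
  rw [ApproximatesLinearOn.approximatesLinearOn_iff_lipschitzOnWith]
  exact hX

theorem norm_sub_le_of_lipschitzOnWith_sub (hX : LipschitzOnWith 2⁻¹ (fun z => X z - z) Ω)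
    {z w : Eu n} (hz : z ∈ Ω) (hw : w ∈ Ω) : dist z w ≤ 2 * dist (X z) (X w) := by
  have h1 := hX.dist_le_mul z hz w hw
  rw [dist_eq_norm] at h1
  have h2 := norm_sub_norm_le (z - w) (X z - X w)
  rw [dist_eq_norm, dist_eq_norm] at *
  have h3 : ‖z - w - (X z - X w)‖ = ‖X z - z - (X w - w)‖ := by
    rw [← norm_neg]; congr 1; abel
  rw [h3] at h2
  push_cast at h1
  linarith

theorem injOn_of_lipschitzOnWith_sub (hX : LipschitzOnWith 2⁻¹ (fun z => X z - z) Ω) :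
    InjOn X Ω := fun z hz w hw h => by
  have := norm_sub_le_of_lipschitzOnWith_sub hX hz hw
  rw [h, dist_self, mul_zero] at this
  exact dist_le_zero.1 this

theorem isOpen_image_of_lipschitzOnWith_sub (hΩ : IsOpen Ω)
    (hX : LipschitzOnWith 2⁻¹ (fun z => X z - z) Ω) : IsOpen (X '' Ω) := by
  -- In dimension zero the identity has norm 0 and the inequality 2⁻¹ < ‖id‖⁻¹ fails, but every set
  -- is open.
  rcases subsingleton_or_nontrivial (Eu n) with hs | hs
  · exact isOpen_discrete _
  · refine (approximatesLinearOn_id hX).open_image (ContinuousLinearEquiv.refl ℝ (Eu n)).toNonlinearRightInverse hΩ ?_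
    refine .inr ?_
    change 2⁻¹ < ‖ContinuousLinearMap.id ℝ (Eu n)‖₊⁻¹
    rw [ContinuousLinearMap.nnnorm_id, inv_one]
    exact inv_lt_one_of_one_lt₀ (by norm_num)

theorem lipschitzOnWith_of_sub (hX : LipschitzOnWith 2⁻¹ (fun z => X z - z) Ω) :
    LipschitzOnWith 2 X Ω := by
  have := hX.add (LipschitzWith.id.lipschitzOnWith (s := Ω))
  simp only [id, sub_add_cancel] at this
  refine this.weaken ?_
  rw [← one_add_one_eq_two]
  gcongr
  exact inv_le_one_of_one_le₀ (by norm_num)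

theorem volume_image_le {s : Set (Eu n)} (hX : LipschitzOnWith L X s) :
    volume (X '' s) ≤ (L : ℝ≥0∞) ^ n * volume s := by
  have := euclideanHausdorffMeasure_image_le_of_lipschitzOnWith hX n
  have e : ∀ k, k = Module.finrank ℝ (Eu n) → (μHE[k] : Measure (Eu n)) = volume := by
    rintro _ rfl
    exact InnerProductSpace.euclideanHausdorffMeasure_eq_volume
  rwa [e n finrank_euclideanSpace_fin.symm] at this

theorem graphDomain_image : graphDomain ((fun z => (X z, Y z)) '' Ω) = X '' Ω := by
  rw [graphDomain, image_image]

theorem graphFun_apply (hX : InjOn X Ω) {z : Eu n} (hz : z ∈ Ω) :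
    graphFun ((fun z => (X z, Y z)) '' Ω) (X z) = Y z := by
  have h : ∃ v, (X z, v) ∈ (fun z => (X z, Y z)) '' Ω := ⟨Y z, z, hz, rfl⟩
  rw [graphFun, dif_pos h]
  obtain ⟨w, hw, e⟩ := h.choose_spec
  have e1 : X w = X z := congrArg Prod.fst e
  have e2 : Y w = h.choose := congrArg Prod.snd e
  rw [← e2, hX hw hz e1]

theorem lipschitzOnWith_graphFun (hX : LipschitzOnWith 2⁻¹ (fun z => X z - z) Ω)
    (hY : LipschitzOnWith L Y Ω) :
    LipschitzOnWith (L * 2) (graphFun ((fun z => (X z, Y z)) '' Ω)) (X '' Ω) := by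
  have hi := injOn_of_lipschitzOnWith_sub hX
  refine LipschitzOnWith.of_dist_le_mul ?_
  rintro _ ⟨z, hz, rfl⟩ _ ⟨w, hw, rfl⟩
  rw [graphFun_apply hi hz, graphFun_apply hi hw]
  refine (hY.dist_le_mul z hz w hw).trans ?_
  push_cast
  rw [mul_assoc]
  gcongr
  exact norm_sub_le_of_lipschitzOnWith_sub hX hz hw

theorem isLipschitzGraph_image (hΩ : IsOpen Ω) (hX : LipschitzOnWith 2⁻¹ (fun z => X z - z) Ω)
    (hY : LipschitzOnWith L Y Ω) : IsLipschitzGraph ((fun z => (X z, Y z)) '' Ω) := by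
  refine ⟨X '' Ω, _, _, isOpen_image_of_lipschitzOnWith_sub hΩ hX,
    lipschitzOnWith_graphFun hX hY, ?_⟩
  rw [graphOn, image_image]
  exact image_congr fun z hz => by
    rw [graphFun_apply (injOn_of_lipschitzOnWith_sub hX) hz]

/-- On the image the function is Y ∘ X⁻¹. The derivative A is within 1/2 of the identity, hence
invertible by a Neumann series. As X⁻¹ is Lipschitz, it is differentiable at X z as soon as X is
differentiable at z. -/
theorem hasFDerivAt_graphFun (hΩ : IsOpen Ω) (hX : LipschitzOnWith 2⁻¹ (fun z => X z - z) Ω)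
    {A : Eu n →L[ℝ] Eu n} {B : Grad n m} {z : Eu n} (hz : z ∈ Ω) (hA : HasFDerivAt X A z)
    (hB : HasFDerivAt Y B z) :
    HasFDerivAt (graphFun ((fun z => (X z, Y z)) '' Ω)) (B.comp (Ring.inverse A)) (X z) := by
  have hi := injOn_of_lipschitzOnWith_sub hX
  have h1 : ‖A - ContinuousLinearMap.id ℝ (Eu n)‖ ≤ (2⁻¹ : ℝ≥0) :=
    (hA.fun_sub (hasFDerivAt_id z)).le_of_lipschitzOn (hΩ.mem_nhds hz) hX
  have h2 : IsUnit A := by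
    have h3 : ‖1 - A‖ < 1 := by
      rw [← norm_neg, neg_sub]
      refine h1.trans_lt ?_
      norm_num
    simpa using isUnit_one_sub_of_norm_lt_one h3
  obtain ⟨u, rfl⟩ := h2
  rw [Ring.inverse_unit]
  set ψ := Function.invFunOn X Ω
  have hψ : ∀ w ∈ Ω, ψ (X w) = w := fun w hw => hi.leftInvOn_invFunOn hw
  have hO := isOpen_image_of_lipschitzOnWith_sub hΩ hX
  have hψL : LipschitzOnWith 2 ψ (X '' Ω) := by
    refine LipschitzOnWith.of_dist_le_mul ?_
    rintro _ ⟨v, hv, rfl⟩ _ ⟨w, hw, rfl⟩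
    rw [hψ v hv, hψ w hw]
    exact norm_sub_le_of_lipschitzOnWith_sub hX hv hw
  have hmem : X '' Ω ∈ 𝓝 (X z) := hO.mem_nhds (mem_image_of_mem _ hz)
  have hψd : HasFDerivAt ψ ((ContinuousLinearEquiv.ofUnit u).symm : Eu n →L[ℝ] Eu n) (X z) := by
    refine HasFDerivAt.of_local_left_inverse (f := X) (hψL.continuousOn.continuousAt hmem) ?_ ?_
    · rw [hψ z hz]
      exact hA
    · filter_upwards [hmem]
      rintro _ ⟨w, hw, rfl⟩
      rw [hψ w hw]
  have hB' : HasFDerivAt Y B (ψ (X z)) := by rwa [hψ z hz]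
  refine (hB'.comp (X z) hψd).congr_of_eventuallyEq ?_
  filter_upwards [hmem]
  rintro _ ⟨w, hw, rfl⟩
  rw [graphFun_apply hi hw, Function.comp_apply, hψ w hw]

end GraphTransform

/-! ### Differentiation of the energy in ε -/

section Variation

variable {n m : ℕ} {Ω S : Set (Eu n)} {y : Eu n → Eu m}

/-- `u = u₀ + ε u₁ + o(ε)` on `Ω`, uniformly and in the Lipschitz seminorm, where `u₁` is
Lipschitz. -/
structure IsVariationOn {k : ℕ} (Ω : Set (Eu n)) (u : ℝ → Eu n → Eu k) (u₀ u₁ : Eu n → Eu k) :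
    Prop where
  lipschitz : ∃ L : ℝ≥0, LipschitzOnWith L u₁ (closure Ω)
  rest_lipschitz : ∀ η : ℝ≥0, 0 < η → ∀ᶠ ε in 𝓝 (0 : ℝ),
    LipschitzOnWith (η * ‖ε‖₊) (fun z => u ε z - u₀ z - ε • u₁ z) Ω
  rest_le : ∀ η : ℝ≥0, 0 < η → ∀ᶠ ε in 𝓝 (0 : ℝ),
    ∀ z ∈ Ω, ‖u ε z - u₀ z - ε • u₁ z‖ ≤ η * |ε|

theorem IsVariationOn.lipschitz_sub {k : ℕ} {u : ℝ → Eu n → Eu k} {u₀ u₁ : Eu n → Eu k}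
    (h : IsVariationOn Ω u u₀ u₁) {κ : ℝ≥0} (hκ : 0 < κ) :
    ∀ᶠ ε in 𝓝 (0 : ℝ), LipschitzOnWith κ (fun z => u ε z - u₀ z) Ω := by
  obtain ⟨L, hL⟩ := h.lipschitz
  have h1 : ∀ᶠ ε in 𝓝 (0 : ℝ), 1 * ‖ε‖₊ + ‖ε‖₊ * L < κ := by
    have : Tendsto (fun ε : ℝ => 1 * ‖ε‖₊ + ‖ε‖₊ * L) (𝓝 0) (𝓝 0) := by
      have : Continuous fun ε : ℝ => 1 * ‖ε‖₊ + ‖ε‖₊ * L := by fun_prop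
      simpa using this.tendsto 0
    exact this.eventually (gt_mem_nhds hκ)
  filter_upwards [h.rest_lipschitz 1 one_pos, h1] with ε h2 h3
  have h4 : LipschitzOnWith (‖ε‖₊ * L) (fun z => ε • u₁ z) Ω :=
    (lipschitzWith_smul ε).comp_lipschitzOnWith (hL.mono subset_closure)
  have h5 := h2.add h4
  simp only [sub_add_cancel] at h5
  exact h5.weaken h3.le

/-- This filter on pairs (ε, z) expresses ε → 0 uniformly in z ∈ D ε, so the calculus of
`FirstOrder` yields estimates uniform in z. -/
theorem eventually_comap_inf_principal {D : ℝ → Set (Eu n)} {P : ℝ × Eu n → Prop} :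
    (∀ᶠ i in comap Prod.fst (𝓝 (0 : ℝ)) ⊓ 𝓟 {i : ℝ × Eu n | i.2 ∈ D i.1}, P i)
      ↔ ∀ᶠ ε in 𝓝 (0 : ℝ), ∀ z ∈ D ε, P (ε, z) := by
  rw [eventually_inf_principal, eventually_comap]
  refine eventually_congr (.of_forall fun ε => ⟨fun h z hz => h (ε, z) rfl hz, ?_⟩)
  rintro h ⟨ε', z⟩ rfl hz
  exact h z hz

/-- Expansion along the points of sets `D ε ⊆ Ω`. -/
theorem IsVariationOn.firstOrder {k : ℕ} {u : ℝ → Eu n → Eu k} {u₀ u₁ : Eu n → Eu k}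
    (h : IsVariationOn Ω u u₀ u₁) (hb : Bornology.IsBounded Ω)
    (hu₀ : ∃ C, ∀ z ∈ Ω, ‖u₀ z‖ ≤ C) {D : ℝ → Set (Eu n)} (hD : ∀ ε, D ε ⊆ Ω) :
    FirstOrder (comap Prod.fst (𝓝 0) ⊓ 𝓟 {i : ℝ × Eu n | i.2 ∈ D i.1}) Prod.fst
      (fun i => u i.1 i.2) (fun i => u₀ i.2) (fun i => u₁ i.2) := by
  obtain ⟨L, hL⟩ := h.lipschitz
  obtain ⟨C, hC⟩ := hu₀
  obtain ⟨C', hC'⟩ := hb.isCompact_closure.exists_bound_of_continuousOn hL.continuousOn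
  refine ⟨.of_bound C ?_, .of_bound C' ?_, Asymptotics.isLittleO_iff.2 fun η hη => ?_⟩
  · exact eventually_comap_inf_principal.2
      (.of_forall fun ε z hz => by simpa using hC z (hD ε hz))
  · exact eventually_comap_inf_principal.2
      (.of_forall fun ε z hz => by simpa using hC' z (subset_closure (hD ε hz)))
  · refine eventually_comap_inf_principal.2 ?_
    filter_upwards [h.rest_le η.toNNReal (Real.toNNReal_pos.2 hη)] with ε h1 z hz
    have h2 := h1 z (hD ε hz)
    rwa [Real.coe_toNNReal _ hη.le] at h2

/-- The derivative of a κ-Lipschitz function has norm at most κ. Hence a remainder small in the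
Lipschitz seminorm gives a uniform expansion of the gradients at the points of differentiability. -/
theorem IsVariationOn.firstOrder_fderiv {k : ℕ} {u : ℝ → Eu n → Eu k} {u₀ u₁ : Eu n → Eu k}
    (h : IsVariationOn Ω u u₀ u₁) (hΩ : IsOpen Ω) {D : ℝ → Set (Eu n)} (hD : ∀ ε, D ε ⊆ Ω)
    (hu₀ : ∃ C, ∀ ε, ∀ z ∈ D ε, ‖fderiv ℝ u₀ z‖ ≤ C)
    (d : ∀ ε, ∀ z ∈ D ε, DifferentiableAt ℝ (u ε) z)
    (d₀ : ∀ ε, ∀ z ∈ D ε, DifferentiableAt ℝ u₀ z)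
    (d₁ : ∀ ε, ∀ z ∈ D ε, DifferentiableAt ℝ u₁ z) :
    FirstOrder (comap Prod.fst (𝓝 0) ⊓ 𝓟 {i : ℝ × Eu n | i.2 ∈ D i.1}) Prod.fst
      (fun i => fderiv ℝ (u i.1) i.2) (fun i => fderiv ℝ u₀ i.2) (fun i => fderiv ℝ u₁ i.2) := by
  obtain ⟨L, hL⟩ := h.lipschitz
  obtain ⟨C, hC⟩ := hu₀
  refine ⟨.of_bound C ?_, .of_bound L ?_, Asymptotics.isLittleO_iff.2 fun η hη => ?_⟩
  · exact eventually_comap_inf_principal.2 (.of_forall fun ε z hz => by simpa using hC ε z hz)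
  · refine eventually_comap_inf_principal.2 (.of_forall fun ε z hz => ?_)
    simpa using norm_fderiv_le_of_lipschitzOn ℝ (hΩ.mem_nhds (hD ε hz)) (hL.mono subset_closure)
  · refine eventually_comap_inf_principal.2 ?_
    filter_upwards [h.rest_lipschitz η.toNNReal (Real.toNNReal_pos.2 hη)] with ε h1 z hz
    have h2 := (((d ε z hz).hasFDerivAt.fun_sub (d₀ ε z hz).hasFDerivAt).fun_sub
      ((d₁ ε z hz).hasFDerivAt.const_smul ε)).le_of_lipschitzOn (hΩ.mem_nhds (hD ε hz)) h1
    rwa [NNReal.coe_mul, Real.coe_toNNReal _ hη.le] at h2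

namespace IsConfiguration

variable {W : Jet n m → ℝ} {U : Set (Jet n m)} (h : IsConfiguration Ω S y W U)
include h

/-- The first variation of the energy as an integral over the undeformed domain. -/
theorem hasDerivAt_graphEnergy {X : ℝ → Eu n → Eu n} {Y : ℝ → Eu n → Eu m} {dx : Eu n → Eu n}
    {dy : Eu n → Eu m} (hX : IsVariationOn Ω X id dx) (hY : IsVariationOn Ω Y y dy)
    (hvd : IntegrableOn (variationDensity W y dx dy) Ω) :
    (∀ᶠ ε in 𝓝 (0 : ℝ), IsLipschitzGraph ((fun z => (X ε z, Y ε z)) '' Ω) ∧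
      IntegrableOn (fun x => W (jet (graphFun ((fun z => (X ε z, Y ε z)) '' Ω)) x))
        (graphDomain ((fun z => (X ε z, Y ε z)) '' Ω))) ∧
    HasDerivAt (fun ε => graphEnergy W ((fun z => (X ε z, Y ε z)) '' Ω))
      (∫ z in Ω, variationDensity W y dx dy z) 0 := by
  obtain ⟨K, hK⟩ := h.lipschitz
  obtain ⟨Lx, hLx⟩ := hX.lipschitz
  obtain ⟨Ly, hLy⟩ := hY.lipschitz
  -- The set of full measure on which all derivatives exist. It depends on ε, since the exceptional
  -- sets of X ε and Y ε do.
  set D : ℝ → Set (Eu n) := fun ε => (Ω \ S) ∩ {z | DifferentiableAt ℝ dx z}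
    ∩ {z | DifferentiableAt ℝ dy z} ∩ {z | DifferentiableAt ℝ (X ε) z}
    ∩ {z | DifferentiableAt ℝ (Y ε) z} with hDdef
  have hDS : ∀ ε, D ε ⊆ Ω \ S := fun ε z hz => hz.1.1.1.1
  have hD : ∀ ε, D ε ⊆ Ω := fun ε => (hDS ε).trans sdiff_subset
  have hDm : ∀ ε, MeasurableSet (D ε) := fun ε =>
    ((((h.isOpen_diff.measurableSet).inter (measurableSet_of_differentiableAt ℝ _)).inter
      (measurableSet_of_differentiableAt ℝ _)).inter (measurableSet_of_differentiableAt ℝ _)).inter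
      (measurableSet_of_differentiableAt ℝ _)
  have hfin : volume Ω < ⊤ := h.isBounded.measure_lt_top
  have bX : ∃ C, ∀ z ∈ Ω, ‖(id z : Eu n)‖ ≤ C := h.isBounded.exists_norm_le
  have bY : ∃ C, ∀ z ∈ Ω, ‖y z‖ ≤ C := by
    obtain ⟨C, hC⟩ := h.isBounded.isCompact_closure.exists_bound_of_continuousOn hK.continuousOn
    exact ⟨C, fun z hz => hC z (subset_closure hz)⟩
  have dy₀ : ∀ ε, ∀ z ∈ D ε, DifferentiableAt ℝ y z := fun ε z hz =>
    (h.piecewise.contDiffOn.differentiableOn two_ne_zero).differentiableAt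
      (h.isOpen_diff.mem_nhds (hDS ε hz))
  have fX := hX.firstOrder h.isBounded bX hD
  have fY := hY.firstOrder h.isBounded bY hD
  have fA := hX.firstOrder_fderiv h.isOpen hD
    ⟨1, fun ε z _ => by rw [fderiv_id]; exact ContinuousLinearMap.norm_id_le⟩
    (fun ε z hz => hz.1.2) (fun ε z _ => differentiableAt_id) (fun ε z hz => hz.1.1.1.2)
  simp only [fderiv_id] at fA
  have fB := hY.firstOrder_fderiv h.isOpen hD
    ⟨K, fun ε z hz => norm_fderiv_le_of_lipschitzOn ℝ (h.isOpen.mem_nhds (hD ε hz))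
      (hK.mono subset_closure)⟩ (fun ε z hz => hz.2) dy₀ (fun ε z hz => hz.1.1.2)
  have hε : Tendsto (Prod.fst : ℝ × Eu n → ℝ)
      (comap Prod.fst (𝓝 0) ⊓ 𝓟 {i : ℝ × Eu n | i.2 ∈ D i.1}) (𝓝 0) :=
    tendsto_comap.mono_left inf_le_left
  obtain ⟨hW₁, hWU, hWb⟩ := FirstOrder.density h.isOpen_jets h.energy h.isCompact_jets h.subset hε
    fX fY fA fB (eventually_comap_inf_principal.2
      (.of_forall fun ε z hz => subset_closure (mem_image_of_mem _ (hDS ε hz))))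
  obtain ⟨C, hC⟩ := hWb.bound
  replace hC := eventually_comap_inf_principal.1 hC
  replace hWU := eventually_comap_inf_principal.1 hWU
  -- The energy density of the transformed graph pulled back to Ω, with the Jacobian of X ε.
  set Q : ℝ → Eu n → ℝ := fun ε z => |(fderiv ℝ (X ε) z).det|
    * W (X ε z, Y ε z, (fderiv ℝ (Y ε) z).comp (Ring.inverse (fderiv ℝ (X ε) z)))
  have hQ : ∀ η : ℝ, 0 < η → ∀ᶠ ε in 𝓝 (0 : ℝ), ∀ z ∈ D ε,
      ‖Q ε z - W (jet y z) - ε • variationDensity W y dx dy z‖ ≤ η * ‖ε‖ := fun η hη =>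
    eventually_comap_inf_principal.1 (Asymptotics.isLittleO_iff.1 hW₁.rest hη)
  have good : ∀ᶠ ε in 𝓝 (0 : ℝ), IsLipschitzGraph ((fun z => (X ε z, Y ε z)) '' Ω) ∧
      IntegrableOn (fun x => W (jet (graphFun ((fun z => (X ε z, Y ε z)) '' Ω)) x))
        (graphDomain ((fun z => (X ε z, Y ε z)) '' Ω)) ∧
      D ε =ᵐ[volume] Ω ∧ IntegrableOn (Q ε) (D ε) ∧
      graphEnergy W ((fun z => (X ε z, Y ε z)) '' Ω) = ∫ z in D ε, Q ε z := by
    filter_upwards [hX.lipschitz_sub (κ := 2⁻¹) (by positivity), hY.lipschitz_sub one_pos, hC, hWU]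
      with ε lX lY' hC hWU
    have lX' := lipschitzOnWith_of_sub lX
    have lY : LipschitzOnWith (1 + K) (Y ε) Ω := by
      have := lY'.add (hK.mono subset_closure)
      simpa only [sub_add_cancel] using this
    have hi := injOn_of_lipschitzOnWith_sub lX
    have hO := isOpen_image_of_lipschitzOnWith_sub h.isOpen lX
    have hnull : volume (Ω \ D ε) = 0 := by
      have r : ∀ {k : ℕ} {f : Eu n → Eu k} {L : ℝ≥0}, LipschitzOnWith L f Ω →
          ∀ᵐ z ∂volume.restrict Ω, z ∈ Ω → DifferentiableAt ℝ f z := fun hf => by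
        filter_upwards [hf.ae_differentiableWithinAt (μ := volume) h.isOpen.measurableSet]
          with z h1 hz
        exact h1.differentiableAt (h.isOpen.mem_nhds hz)
      have h1 : ∀ᵐ z ∂volume.restrict Ω, z ∈ D ε := by
        filter_upwards [h.ae_mem_diff, r (hLx.mono subset_closure), r (hLy.mono subset_closure),
          r lX', r lY] with z h1 h2 h3 h4 h5
        exact ⟨⟨⟨⟨h1, h2 h1.1⟩, h3 h1.1⟩, h4 h1.1⟩, h5 h1.1⟩
      rw [ae_restrict_iff' h.isOpen.measurableSet] at h1
      refine measure_mono_null (fun z hz => ?_) h1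
      exact fun h2 => hz.2 (h2 hz.1)
    have hDΩ : D ε =ᵐ[volume] Ω := by
      refine (LE.le.eventuallyLE (hD ε)).antisymm ?_
      exact ae_le_set.2 hnull
    -- Lipschitz maps send null sets to null sets, so the image of D ε still has full measure in the
    -- new domain.
    have hXD : X ε '' D ε =ᵐ[volume] X ε '' Ω := by
      refine (LE.le.eventuallyLE (image_mono (hD ε))).antisymm (ae_le_set.2 ?_)
      refine measure_mono_null (t := X ε '' (Ω \ D ε)) ?_ ?_
      · rintro _ ⟨⟨z, hz, rfl⟩, hz'⟩
        exact mem_image_of_mem _ ⟨hz, fun h1 => hz' (mem_image_of_mem _ h1)⟩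
      have := volume_image_le (lX'.mono (sdiff_subset (s := Ω) (t := D ε)))
      rw [hnull, mul_zero] at this
      exact le_antisymm this zero_le
    set g := graphFun ((fun z => (X ε z, Y ε z)) '' Ω) with hg
    have hjet : ∀ z ∈ D ε, jet g (X ε z)
        = (X ε z, Y ε z, (fderiv ℝ (Y ε) z).comp (Ring.inverse (fderiv ℝ (X ε) z))) :=
      fun z hz => by
        rw [jet, hg, graphFun_apply hi (hD ε hz), (hasFDerivAt_graphFun h.isOpen lX (hD ε hz)
          hz.1.2.hasFDerivAt hz.2.hasFDerivAt).fderiv]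
    have hae : ∀ᵐ x ∂volume.restrict (X ε '' Ω), x ∈ X ε '' D ε := by
      rw [← Measure.restrict_congr_set hXD]
      refine ae_restrict_mem₀ ?_
      exact (hO.measurableSet.nullMeasurableSet).congr hXD.symm
    have hgc := (lipschitzOnWith_graphFun lX lY).continuousOn
    have hmeas : AEStronglyMeasurable (fun x => W (jet g x)) (volume.restrict (X ε '' Ω)) := by
      have hj : AEMeasurable (jet g) (volume.restrict (X ε '' Ω)) :=
        aemeasurable_id.prodMk ((hgc.aemeasurable hO.measurableSet).prodMk
          (measurable_fderiv ℝ g).aemeasurable)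
      classical
      -- W is controlled only on U, so it is set to 0 elsewhere; at almost all points of the new
      -- domain the jet lies in U.
      have hw : Measurable (U.piecewise W 0) :=
        h.energy.continuousOn.measurable_piecewise continuousOn_const h.isOpen_jets.measurableSet
      refine (hw.comp_aemeasurable hj).aestronglyMeasurable.congr ?_
      filter_upwards [hae]
      rintro _ ⟨z, hz, rfl⟩
      have : jet g (X ε z) ∈ U := by
        rw [hjet z hz]
        exact hWU z hz
      rw [Function.comp_apply, piecewise_eq_of_mem _ _ _ this]
    have hint : IntegrableOn (fun x => W (jet g x)) (X ε '' Ω) := by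
      have hfin' : volume (X ε '' Ω) < ⊤ :=
        (volume_image_le lX').trans_lt (ENNReal.mul_lt_top (by simp) hfin)
      refine (integrableOn_const (C := C) hfin'.ne).mono' hmeas ?_
      filter_upwards [hae]
      rintro _ ⟨z, hz, rfl⟩
      rw [hjet z hz]
      simpa using hC z hz
    have hder : ∀ z ∈ D ε, HasFDerivWithinAt (X ε) (fderiv ℝ (X ε) z) (D ε) z := fun z hz =>
      hz.1.2.hasFDerivAt.hasFDerivWithinAt
    have hcongr : ∀ z ∈ D ε, |(fderiv ℝ (X ε) z).det| • W (jet g (X ε z)) = Q ε z := fun z hz => by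
      rw [hjet z hz, smul_eq_mul]
    refine ⟨isLipschitzGraph_image h.isOpen lX lY, ?_, hDΩ, ?_, ?_⟩
    · rwa [graphDomain_image]
    · refine (integrableOn_congr_fun hcongr (hDm ε)).1 ?_
      exact (integrableOn_image_iff_integrableOn_abs_det_fderiv_smul volume (hDm ε) hder
        (hi.mono (hD ε)) _).1 (hint.mono_set (image_mono (hD ε)))
    · rw [graphEnergy, graphDomain_image, ← setIntegral_congr_set hXD,
        integral_image_eq_integral_abs_det_fderiv_smul volume (hDm ε) hder (hi.mono (hD ε))]
      exact setIntegral_congr_fun (hDm ε) hcongr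
  refine ⟨good.mono fun ε hε => ⟨hε.1, hε.2.1⟩, ?_⟩
  have hWi : IntegrableOn (fun z => W (jet y z)) Ω := by
    obtain ⟨C, hC⟩ := h.exists_bound h.energy.continuousOn
    refine (integrableOn_const (C := C) hfin.ne).mono'
      (h.aestronglyMeasurable (h.continuousOn_comp_jet h.energy.continuousOn)) ?_
    filter_upwards [h.ae_mem_diff] with z hz
    exact hC z hz
  have key : ∀ η : ℝ, 0 < η → ∀ᶠ ε in 𝓝 (0 : ℝ),
      ‖graphEnergy W ((fun z => (X ε z, Y ε z)) '' Ω) - (∫ z in Ω, W (jet y z))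
        - ε • ∫ z in Ω, variationDensity W y dx dy z‖ ≤ η * ‖ε‖ := by
    intro η hη
    -- The added 1 avoids division by zero when Ω is empty.
    have hv : 0 < volume.real Ω + 1 := by positivity
    filter_upwards [good, hQ (η / (volume.real Ω + 1)) (div_pos hη hv)] with ε hg hQ
    obtain ⟨-, -, hDΩ, hQi, hE⟩ := hg
    have i1 := hWi.mono_set (hD ε)
    have i2 : IntegrableOn (fun z => ε • variationDensity W y dx dy z) (D ε) :=
      (hvd.mono_set (hD ε)).smul ε
    have i3 : IntegrableOn (fun z => Q ε z - W (jet y z)) (D ε) := hQi.sub i1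
    rw [hE, ← setIntegral_congr_set hDΩ, ← setIntegral_congr_set hDΩ, ← integral_smul,
      ← integral_sub hQi i1, ← integral_sub i3 i2]
    have hDv : volume (D ε) = volume Ω := measure_congr hDΩ
    refine (norm_setIntegral_le_of_norm_le_const (by rw [hDv]; exact hfin) hQ).trans ?_
    rw [show volume.real (D ε) = volume.real Ω from congrArg ENNReal.toReal hDv, mul_right_comm, div_mul_eq_mul_div]
    refine mul_le_mul_of_nonneg_right ?_ (norm_nonneg _)
    rw [div_le_iff₀ hv]
    gcongr
    linarith
  -- A property that holds eventually near 0 holds at 0, so the estimate with ε = 0 identifies the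
  -- energy of the untransformed graph.
  have hzero : graphEnergy W ((fun z => (X 0 z, Y 0 z)) '' Ω) = ∫ z in Ω, W (jet y z) := by
    have := (key 1 one_pos).self_of_nhds
    rw [zero_smul, sub_zero, norm_zero, mul_zero, norm_le_zero_iff] at this
    exact sub_eq_zero.1 this
  rw [hasDerivAt_iff_isLittleO_nhds_zero, Asymptotics.isLittleO_iff]
  intro η hη
  filter_upwards [key η hη] with ε hε
  rwa [zero_add, hzero]

end IsConfiguration

/-- Compose the expansion of Φ_ε with the map z ↦ (z, y z), which is Lipschitz with constant max 1 K
and sends closure Ω into a ball. The remainder is requested with η / max 1 K to absorb this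
constant. -/
theorem IsC1Family.isVariationOn {Φ : ℝ → Eu n × Eu m → Eu n × Eu m} {ε₀ : ℝ}
    (h : IsC1Family Φ ε₀) (hb : Bornology.IsBounded Ω)
    (hy : ∃ K : ℝ≥0, LipschitzOnWith K y (closure Ω)) :
    IsVariationOn Ω (fun ε z => (Φ ε (z, y z)).1) id (deltaX Φ y) ∧
    IsVariationOn Ω (fun ε z => (Φ ε (z, y z)).2) y (deltaY Φ y) := by
  obtain ⟨K, hK⟩ := hy
  have hbd : Bornology.IsBounded ((fun z => (z, y z)) '' closure Ω) :=
    (hb.isCompact_closure.image_of_continuousOn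
      (continuousOn_id.prodMk hK.continuousOn)).isBounded
  obtain ⟨R, hR, hsub⟩ := hbd.subset_ball_lt 0 0
  have hp : LipschitzOnWith (max 1 K) (fun z => (z, y z)) (closure Ω) :=
    LipschitzWith.id.lipschitzOnWith.prodMk hK
  have hm : MapsTo (fun z => (z, y z)) (closure Ω) (Metric.ball 0 R) := mapsTo_iff_image_subset.2 hsub
  obtain ⟨V, hV⟩ := h.velocity_lipschitz R 0 ⟨neg_lt_zero.2 h.pos, h.pos⟩
  have hv := hV.comp hp hm
  have key : ∀ η : ℝ≥0, 0 < η → ∀ᶠ ε in 𝓝 (0 : ℝ),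
      LipschitzOnWith (η * ‖ε‖₊) (fun z => Φ ε (z, y z) - (z, y z) - ε • velocity Φ 0 (z, y z)) Ω ∧
      ∀ z ∈ Ω, ‖Φ ε (z, y z) - (z, y z) - ε • velocity Φ 0 (z, y z)‖ ≤ η * |ε| := by
    intro η hη
    have hM : 0 < max 1 K := lt_max_of_lt_left one_pos
    filter_upwards [h.expansion hR hη, h.expansion hR (η := η / max 1 K) (div_pos hη hM)]
      with ε h1 h2
    refine ⟨?_, fun z hz => h1.2 _ (hm (subset_closure hz))⟩
    refine ((h2.1.comp hp hm).mono subset_closure).weaken (le_of_eq ?_)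
    rw [mul_right_comm, div_mul_cancel₀ _ hM.ne']
  refine ⟨⟨⟨_, LipschitzWith.prod_fst.comp_lipschitzOnWith hv⟩, fun η hη => ?_, fun η hη => ?_⟩,
    ⟨⟨_, LipschitzWith.prod_snd.comp_lipschitzOnWith hv⟩, fun η hη => ?_, fun η hη => ?_⟩⟩
  · filter_upwards [key η hη] with ε h1
    exact (LipschitzWith.prod_fst.comp_lipschitzOnWith h1.1).weaken (by simp)
  · filter_upwards [key η hη] with ε h1 z hz
    exact (norm_fst_le _).trans (h1.2 z hz)
  · filter_upwards [key η hη] with ε h1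
    exact (LipschitzWith.prod_snd.comp_lipschitzOnWith h1.1).weaken (by simp)
  · filter_upwards [key η hη] with ε h1 z hz
    exact (norm_snd_le _).trans (h1.2 z hz)

end Variation

end GenNoether

end

/-! ### The generalized Noether formula -/

theorem mainTheorem2 {n m : ℕ} (hn : 1 ≤ n)
    (Ω : Set (GenNoether.Eu n)) (hΩ : IsOpen Ω) (hΩb : Bornology.IsBounded Ω)
    (hΩL : GenNoether.HasLipschitzBoundary Ω)
    (S : Set (GenNoether.Eu n)) (hS : GenNoether.IsSurfaceIn Ω S)
    (y : GenNoether.Eu n → GenNoether.Eu m) (hyLip : ∃ K : ℝ≥0, LipschitzOnWith K y (closure Ω))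
    (hy : GenNoether.IsPiecewiseC2 Ω S y)
    (W : GenNoether.Jet n m → ℝ) (U : Set (GenNoether.Jet n m)) (hU : IsOpen U)
    (hW : ContDiffOn ℝ 1 W U) (hyU : closure (GenNoether.jet y '' (Ω \ S)) ⊆ U)
    (hext : GenNoether.IsExtremal W Ω y)
    (ν : GenNoether.Eu n → GenNoether.Eu n) (hν : ∀ x ∈ S, GenNoether.IsUnitNormal S x (ν x)) :
    (∀ x ∈ S,
      GenNoether.frob (GenNoether.piola W (GenNoether.sideJet y x (ν x)))
          (GenNoether.jumpGrad y x (ν x))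
        = GenNoether.frob (GenNoether.piola W (GenNoether.sideJet y x (-ν x)))
          (GenNoether.jumpGrad y x (ν x))) ∧
    (∀ (Φ : ℝ → GenNoether.Eu n × GenNoether.Eu m → GenNoether.Eu n × GenNoether.Eu m) (ε₀ : ℝ),
      GenNoether.IsC1Family Φ ε₀ →
        (∀ᶠ ε in 𝓝 (0 : ℝ), GenNoether.IsLipschitzGraph (Φ ε '' Ω.graphOn y) ∧
          IntegrableOn (fun x => W (GenNoether.jet (GenNoether.graphFun (Φ ε '' Ω.graphOn y)) x))
            (GenNoether.graphDomain (Φ ε '' Ω.graphOn y))) ∧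
        IntegrableOn (GenNoether.boundaryWork W Ω S y Φ) (frontier Ω) μHE[n - 1] ∧
        IntegrableOn (GenNoether.surfaceWork W y ν Φ) S μHE[n - 1] ∧
        HasDerivAt (fun ε : ℝ => GenNoether.graphEnergy W (Φ ε '' Ω.graphOn y))
          ((∫ x in frontier Ω, GenNoether.boundaryWork W Ω S y Φ x ∂μHE[n - 1])
            - ∫ x in S, GenNoether.surfaceWork W y ν Φ x ∂μHE[n - 1]) 0) ∧
    (GenNoether.IsStationary W Ω y → ∀ x ∈ S, GenNoether.pStar W y x (ν x) = 0) := by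
  have h : GenNoether.IsConfiguration Ω S y W U := ⟨hΩ, hΩb, hS, hyLip, hy, hU, hW, hyU⟩
  refine ⟨fun x hx => h.frob_jumpGrad_eq hn hΩL hext hν hx, fun Φ ε₀ hΦ => ?_,
    fun hst x hx => h.pStar_eq_zero hn hΩL hst hν hx⟩
  obtain ⟨hX, hY⟩ := hΦ.isVariationOn hΩb hyLip
  obtain ⟨i1, i2, i3, e⟩ := h.integral_variationDensity hn hΩL hext hν hX.lipschitz hY.lipschitz
  obtain ⟨hg, hE⟩ := h.hasDerivAt_graphEnergy hX hY i1
  rw [e] at hE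
  have himage : ∀ ε, Φ ε '' Ω.graphOn y = (fun z => ((Φ ε (z, y z)).1, (Φ ε (z, y z)).2)) '' Ω :=
    fun ε => by rw [graphOn, image_image]
  simp only [himage]
  exact ⟨hg, i2, i3, hE⟩
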